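/- **Setting.** For each $n\in\mathbb N$ let $\mathcal X_n,\mathcal Y_n$ be measurable spaces, $X^n=(X^n_i)_{i\ge 1}$ i.i.d. random variables with values in $\mathcal X_n$, $X'^n$ an independent copy of the sequence $X^n$, and $\tilde X^n$ a further independent copy of $X^n_1$. Let $f_{l,n}:\mathcal X_n^l\to\mathcal Y_n$ ($l\in\mathbb N$) be measurable estimators and $\mathcal L_n:\mathcal X_n\times\mathcal Y_n\to\mathbb R$ a measurable loss. Let $(K_n)$ be a non-decreasing sequence of integers and let $(B^n_j)_{j\le K_n}$ be a partition of $\{1,\dots,n\}$ into folds with $\bigl||B^n_i|-|B^n_j|\bigr|\le 1$ for all $i,j$. Let $b_n(i)$ be the index of the fold containing $i$, let $N_n=\{\,n-|B^n_j| : j\le K_n\}$ be the set (of at most two elements) of training set sizes, and let $\hat f_j=f_{n-|B_j^n|,n}\bigl(X^n_{\{1,\dots,n\}\setminus B^n_j}\bigr)$. With $R_n(y)=\mathbb E[\mathcal L_n(\tilde X^n,y)]$ put $$\hat R_{\rm cv}=\frac1n\sum_{i\le n}\mathcal L_n\bigl(X^n_i,\hat f_{b_n(i)}\bigr),\qquad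 \hat R^{\rm average}_{n,K_n}=\frac1{K_n}\sum_{j\le K_n}R_n(\hat f_j),\qquad \hat R^{\rm w}_{n,K_n}=\sum_{j\le K_n}\frac{|B^n_j|}{n}R_n(\hat f_j);$$ the last two coincide if all folds have the same size. For a function $F$ of a sequence let $\nabla_iF(X)=F(X)-F(X^{i})$, where $X^{i}$ is $X$ with $X_i$ replaced by $X'_i$, and $\nabla_{i,j}F(X)=\nabla_iF(X)-\nabla_iF(X^{j})$. Let $\beta_1^{l,n}=\nabla_1F_{l,n}(X^n)$ and $\beta_2^{l,n}=\nabla_{1,2}F_{l,n}(X^n)$ for $F_{l,n}(x)=\mathcal L_n(\tilde X^n,f_{l,n}(x_{1:l}))$, let $\sigma^2_{l,n}=\mathbb E\bigl[\mathrm{Var}\bigl(\mathcal L_n(\tilde X^n,f_{l,n}(X^n_{1:l}))\mid f_{l,n}(X^n_{1:l})\bigr)\bigr]$, and $$\mathcal S=\sup_{n\ge1}\max_{l\in N_n}\bigl\|\mathcal L_n(\tilde X^n,f_{l,n}(X^n_{1:l}))\bigr\|_{L_4},\quad \epsilon_n(\Delta)=\sqrt n\max_{l\in N_n}\|\beta_1^{l,n}\|_{L_4},\quad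 \epsilon_n(\nabla)=n\max_{l\in N_n}\|\beta_2^{l,n}\|_{L_4}.$$ **Theorem.** There is a universal constant $C$ such that the following holds in every such setting. Suppose that every $f_{l,n}$ is invariant under permutations of its $l$ arguments, that $\mathcal S<\infty$, that $\epsilon_n(\Delta)\to0$ and $\epsilon_n(\nabla)\to0$ as $n\to\infty$, and that there is $\sigma_1>0$ with $\max_{l\in N_n}|\sigma^2_{l,n}-\sigma_1^2|\to0$. Put $$\mathcal B_n=C\Bigl\{\frac{\mathcal S\bigl(\epsilon_n(\Delta)+\epsilon_n(\nabla)\bigr)}{\sigma_1}+\frac{\mathcal S^3+\epsilon_n(\Delta)^2\bigl(\epsilon_n(\nabla)+\mathcal S\bigr)+\mathcal S\,\epsilon_n(\nabla)^2}{\sigma_1^2\sqrt n}\Bigr\}+\frac1{\sigma_1}\max_{l\in N_n}\bigl|\sigma_{l,n}^2-\sigma_1^2\bigr| .$$ Then, for every $n\ge1$, with $d_W$ the Wasserstein-1 distance, $$d_W\Bigl(\sqrt n\bigl(\hat R_{\rm cv}-\hat R^{\rm average}_{n,K_n}\bigr),\mathcal N(0,\sigma_1^2)\Bigr)\le\mathcal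 B_n+\sqrt n\,\mathcal S\sum_{j\le K_n}\Bigl|\frac{|B^n_j|}n-\frac1{K_n}\Bigr|,$$ where the last sum vanishes if all folds have the same size, and $$d_W\Bigl(\sqrt n\bigl(\hat R_{\rm cv}-\hat R^{\rm w}_{n,K_n}\bigr),\mathcal N(0,\sigma_1^2)\Bigr)\le\mathcal B_n .$$ -/

import Mathlib

open MeasureTheory ProbabilityTheory Filter Topology
open scoped ENNReal NNReal

noncomputable section

namespace CrossVal

/-- The Wasserstein-1 distance of two distributions on the real line, in its dual (Kantorovich) form:
the supremum of `|∫ h dP - ∫ h dQ|` over all 1-Lipschitz functions `h`.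
It is only considered for distributions with a finite first moment; otherwise the value is `⊤`,
so that a finite upper bound includes the existence of the first moments. -/
def wassersteinOne (P Q : Measure ℝ) : ℝ≥0∞ :=
  open Classical in
  if Integrable (fun x : ℝ => x) P ∧ Integrable (fun x : ℝ => x) Q then
    ⨆ (h : ℝ → ℝ) (_ : LipschitzWith 1 h), ENNReal.ofReal |(∫ x, h x ∂P) - ∫ x, h x ∂Q|
  else ⊤

section Folds

variable {n K : ℕ}

/-- The indices of the `j`-th fold `B_j`, where the partition of `Fin n` (the `n` observations) into
`K` folds is given by the map `b` that sends an index to the number of its fold. -/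
def fold (b : Fin n → Fin K) (j : Fin K) : Finset (Fin n) :=
  Finset.univ.filter (fun i => b i = j)

/-- The complement of the `j`-th fold: the indices on which the `j`-th estimator is trained. -/
def trainSet (b : Fin n → Fin K) (j : Fin K) : Finset (Fin n) :=
  (fold b j)ᶜ

/-- The size `n - |B_j|` of the `j`-th training set (see `trainSize_eq`). -/
def trainSize (b : Fin n → Fin K) (j : Fin K) : ℕ :=
  (trainSet b j).card

theorem trainSize_eq (b : Fin n → Fin K) (j : Fin K) :
    trainSize b j = n - (fold b j).card := by
  simp [trainSize, trainSet, Finset.card_compl]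

/-- The set `N_n` of the sizes of the training sets. -/
def trainSizes (b : Fin n → Fin K) : Finset ℕ :=
  Finset.univ.image (trainSize b)

/-- The sizes of any two folds differ by at most one. -/
def Balanced (b : Fin n → Fin K) : Prop :=
  ∀ i j : Fin K, |((fold b i).card : ℤ) - ((fold b j).card : ℤ)| ≤ 1

/-- `∑_j | |B_j| / n - 1 / K |`, which vanishes if all the folds have the same size. -/
def imbalance (b : Fin n → Fin K) : ℝ :=
  ∑ j : Fin K, |((fold b j).card : ℝ) / n - 1 / K|

end Folds

section Risks

variable {𝒳 𝒴 : Type*} {n K : ℕ}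

/-- The first `l` observations of a sequence. -/
def initial (l : ℕ) (x : ℕ → 𝒳) : Fin l → 𝒳 := fun k => x k

/-- The observations outside of the `j`-th fold, in increasing order of their indices. -/
def trainSample (b : Fin n → Fin K) (j : Fin K) (x : ℕ → 𝒳) : Fin (trainSize b j) → 𝒳 :=
  fun k => x ((trainSet b j).orderEmbOfFin rfl k : Fin n)

/-- The estimator trained on all observations outside of the `j`-th fold. -/
def foldEstimator (f : ∀ l : ℕ, (Fin l → 𝒳) → 𝒴) (b : Fin n → Fin K) (j : Fin K)
    (x : ℕ → 𝒳) : 𝒴 :=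
  f (trainSize b j) (trainSample b j x)

/-- The cross-validated risk. -/
def cvRisk (L : 𝒳 → 𝒴 → ℝ) (f : ∀ l : ℕ, (Fin l → 𝒳) → 𝒴) (b : Fin n → Fin K)
    (x : ℕ → 𝒳) : ℝ :=
  (1 / n) * ∑ i : Fin n, L (x i) (foldEstimator f b (b i) x)

/-- The average, with equal weights `1 / K`, of the risks of the `K` trained estimators;
`R` is the risk of a hypothesis. -/
def averageRisk (R : 𝒴 → ℝ) (f : ∀ l : ℕ, (Fin l → 𝒳) → 𝒴) (b : Fin n → Fin K)
    (x : ℕ → 𝒳) : ℝ :=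
  (1 / K) * ∑ j : Fin K, R (foldEstimator f b j x)

/-- The average, with weights `|B_j| / n`, of the risks of the `K` trained estimators. -/
def weightedAverageRisk (R : 𝒴 → ℝ) (f : ∀ l : ℕ, (Fin l → 𝒳) → 𝒴) (b : Fin n → Fin K)
    (x : ℕ → 𝒳) : ℝ :=
  (1 / n) * ∑ j : Fin K, ((fold b j).card : ℝ) * R (foldEstimator f b j x)

/-- The first-order difference `F(x) - F(x^i)`, where `x^i` is `x` with its `i`-th entry replaced by
that of `x'`. -/
def nabla (i : ℕ) (F : (ℕ → 𝒳) → ℝ) (x x' : ℕ → 𝒳) : ℝ :=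
  F x - F (Function.update x i (x' i))

/-- The second-order difference `∇_i(F, x) - ∇_i(F, x^j)`. -/
def nabla₂ (i j : ℕ) (F : (ℕ → 𝒳) → ℝ) (x x' : ℕ → 𝒳) : ℝ :=
  nabla i F x x' - nabla i F (Function.update x j (x' j)) x'

end Risks

section Probability

variable {Ω 𝒳 𝒴 : Type*} [MeasurableSpace Ω] [MeasurableSpace 𝒳] [MeasurableSpace 𝒴]

/-- The observations `X`, their copies `X'` and one further observation `Xt`, as one family. -/
def allObservations (X X' : ℕ → Ω → 𝒳) (Xt : Ω → 𝒳) : ℕ ⊕ ℕ ⊕ Unit → Ω → 𝒳 :=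
  Sum.elim X (Sum.elim X' (fun _ => Xt))

/-- `X` is an i.i.d. sequence, `X'` is an independent copy of `X`, and `Xt` is an independent copy
of a single observation, independent of `X` and `X'`. -/
structure IsIIDWithCopies (μ : Measure Ω) (X X' : ℕ → Ω → 𝒳) (Xt : Ω → 𝒳) : Prop where
  measurable : ∀ k, Measurable (allObservations X X' Xt k)
  indep : iIndepFun (allObservations X X' Xt) μ
  identDistrib : ∀ k, IdentDistrib (allObservations X X' Xt k) (X 0) μ μ

/-- The risk `R(y) = 𝔼 L(Xt, y)` of a hypothesis `y`. -/
def risk (μ : Measure Ω) (Xt : Ω → 𝒳) (L : 𝒳 → 𝒴 → ℝ) (y : 𝒴) : ℝ :=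
  ∫ ω, L (Xt ω) y ∂μ

/-- The random variable `L(Xt, f_l(X_{1:l}))`. -/
def estimatorLoss (X : ℕ → Ω → 𝒳) (Xt : Ω → 𝒳) (L : 𝒳 → 𝒴 → ℝ)
    (f : ∀ l : ℕ, (Fin l → 𝒳) → 𝒴) (l : ℕ) (ω : Ω) : ℝ :=
  L (Xt ω) (f l (initial l (fun i => X i ω)))

/-- The first-order stability variable `β₁^l` (the first observation has index `0`). -/
def beta₁ (X X' : ℕ → Ω → 𝒳) (Xt : Ω → 𝒳) (L : 𝒳 → 𝒴 → ℝ)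
    (f : ∀ l : ℕ, (Fin l → 𝒳) → 𝒴) (l : ℕ) (ω : Ω) : ℝ :=
  nabla 0 (fun x => L (Xt ω) (f l (initial l x))) (fun i => X i ω) (fun i => X' i ω)

/-- The second-order stability variable `β₂^l` (the first two observations have indices `0, 1`). -/
def beta₂ (X X' : ℕ → Ω → 𝒳) (Xt : Ω → 𝒳) (L : 𝒳 → 𝒴 → ℝ)
    (f : ∀ l : ℕ, (Fin l → 𝒳) → 𝒴) (l : ℕ) (ω : Ω) : ℝ :=
  nabla₂ 0 1 (fun x => L (Xt ω) (f l (initial l x))) (fun i => X i ω) (fun i => X' i ω)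

/-- `σ²_l`, the expected conditional variance of `L(Xt, f_l(X_{1:l}))` given `f_l(X_{1:l})`. -/
def sigmaSq (μ : Measure Ω) (X : ℕ → Ω → 𝒳) (Xt : Ω → 𝒳) (L : 𝒳 → 𝒴 → ℝ)
    (f : ∀ l : ℕ, (Fin l → 𝒳) → 𝒴) (l : ℕ) : ℝ :=
  ∫ ω, (Var[estimatorLoss X Xt L f l; μ |
    MeasurableSpace.comap (fun ω => f l (initial l (fun i => X i ω))) inferInstance]) ω ∂μ

variable {n K : ℕ}

/-- `max_{l ∈ N_n} ‖L(Xt, f_l(X_{1:l}))‖_{L₄}`. -/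
def lossNorm (μ : Measure Ω) (X : ℕ → Ω → 𝒳) (Xt : Ω → 𝒳) (L : 𝒳 → 𝒴 → ℝ)
    (f : ∀ l : ℕ, (Fin l → 𝒳) → 𝒴) (b : Fin n → Fin K) : ℝ≥0∞ :=
  ⨆ l ∈ trainSizes b, eLpNorm (estimatorLoss X Xt L f l) 4 μ

/-- `ε_n(Δ) = √n max_{l ∈ N_n} ‖β₁^l‖_{L₄}`. -/
def epsDelta (μ : Measure Ω) (X X' : ℕ → Ω → 𝒳) (Xt : Ω → 𝒳) (L : 𝒳 → 𝒴 → ℝ)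
    (f : ∀ l : ℕ, (Fin l → 𝒳) → 𝒴) (b : Fin n → Fin K) : ℝ≥0∞ :=
  ENNReal.ofReal (√(n : ℝ)) * ⨆ l ∈ trainSizes b, eLpNorm (beta₁ X X' Xt L f l) 4 μ

/-- `ε_n(∇) = n max_{l ∈ N_n} ‖β₂^l‖_{L₄}`. -/
def epsNabla (μ : Measure Ω) (X X' : ℕ → Ω → 𝒳) (Xt : Ω → 𝒳) (L : 𝒳 → 𝒴 → ℝ)
    (f : ∀ l : ℕ, (Fin l → 𝒳) → 𝒴) (b : Fin n → Fin K) : ℝ≥0∞ :=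
  (n : ℝ≥0∞) * ⨆ l ∈ trainSizes b, eLpNorm (beta₂ X X' Xt L f l) 4 μ

/-- `max_{l ∈ N_n} |σ²_l - v|`. -/
def sigmaGap (μ : Measure Ω) (X : ℕ → Ω → 𝒳) (Xt : Ω → 𝒳) (L : 𝒳 → 𝒴 → ℝ)
    (f : ∀ l : ℕ, (Fin l → 𝒳) → 𝒴) (b : Fin n → Fin K) (v : ℝ) : ℝ :=
  ⨆ l : trainSizes b, |sigmaSq μ X Xt L f l - v|

/-- The Berry–Esseen bound, as a function of the constant `C`, the standard deviation `σ`, the sample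
size `n`, `s = S`, `d = ε_n(Δ)`, `e = ε_n(∇)` and `g = max_l |σ²_l - σ²|`. -/
def rate (C σ : ℝ) (n : ℕ) (s d e g : ℝ) : ℝ :=
  C * (s * (d + e) / σ
    + 1 / √(n : ℝ) * (s ^ 3 + d ^ 2 * (e + s) + s * e ^ 2) / σ ^ 2) + g / σ

end Probability

end CrossVal

end

/-!
The normalized error `√n (R̂_cv - R̂^w)` is `W = n^{-1/2} ∑_k g_k`, where `g_k` is the loss of the
`k`-th observation under the estimator of its fold, minus its conditional mean given all the other
observations: as the estimator does not see the `k`-th observation, this mean is its risk. So `g_k`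
is centered in the `k`-th observation, and it depends on the other observations only through the
stable estimator. The bound on the distance of `W` to `𝒩(0, σ²)` comes from Stein's method.

For a 1-Lipschitz `h` let `φ` solve `σ² φ'(w) - w φ(w) = h(w) - 𝔼 h(σ Z)`, with `|φ'| ≤ 1 / σ` and
`φ'` Lipschitz (`exists_stein_solution`). Let `V` be `W` without its `k`-th summand, and `V^k` the
value of `V` once the `k`-th observation is exchanged with its independent copy. As `V^k` does not
depend on the `k`-th observation, `𝔼 g_k φ(V^k) = 0`, so that
`𝔼 g_k φ(W) = 𝔼 g_k (φ(W) - φ(V)) + 𝔼 g_k (φ(V) - φ(V^k))`.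
By Taylor's formula, the first part is `n^{-1/2} 𝔼 g_k² φ'(W)` up to an error in third moments; the
second one is at most `𝔼 |g_k (V - V^k)| / σ` (`abs_integral_summand_le`).

Two second moments remain. The difference `V - V^k` is `n^{-1/2}` times the sum of the increments
`A_j = g_j - g_j^k`, and each `A_j` is centered in the `j`-th observation. Hence the covariance of
`A_j` and `A_l` is that of the increment of `A_j` in the `l`-th observation and the increment of
`A_l` in the `j`-th one, which are second-order differences (`integral_mul_eq_of_centeredAt`,
`integral_sum_diff_sq_le`). And `n⁻¹ ∑ g_k²` concentrates at its mean, by the Efron–Stein inequality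
and the first-order differences (`integral_abs_sub_mean_sq_le`). That mean is an average of the
variances `σ²_l` (`integral_centering_foldLoss_sq`).

All this takes place on the product space of the `n` observations and their copies, where the
exchange of an observation with its copy preserves the measure. By the symmetry of the estimators,
all the differences of the losses there have the laws of the differences `β₁` and `β₂`. Finally,
`σ² ≤ 4 S²`, as a limit of the variances, so that the error `S² / (σ √n)` of the concentration is of
the order of `S³ / (σ² √n)`; and passing to the average with equal weights costs at most the first
moments of the risks, times the imbalance of the folds.
-/

noncomputable section

namespace CrossVal

/-! ### Stein's equation for the normal distribution -/

section Stein

/-- The standard Gaussian density. -/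
abbrev stdPDF : ℝ → ℝ := gaussianPDFReal 0 1

theorem stdPDF_eq (x : ℝ) : stdPDF x = (√(2 * Real.pi))⁻¹ * Real.exp (-x ^ 2 / 2) := by
  simp [gaussianPDFReal]

theorem stdPDF_pos (x : ℝ) : 0 < stdPDF x := gaussianPDFReal_pos 0 1 x one_ne_zero

theorem hasDerivAt_stdPDF (x : ℝ) : HasDerivAt stdPDF (-x * stdPDF x) x := by
  have h : HasDerivAt (fun x : ℝ => (√(2 * Real.pi))⁻¹ * Real.exp (-x ^ 2 / 2))
      ((√(2 * Real.pi))⁻¹ * (Real.exp (-x ^ 2 / 2) * (-(2 * x) / 2))) x := by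
    have h1 : HasDerivAt (fun x : ℝ => -x ^ 2 / 2) (-(2 * x) / 2) x := by
      simpa using ((hasDerivAt_pow 2 x).neg.div_const 2)
    exact (h1.exp).const_mul _
  have e : stdPDF = fun x : ℝ => (√(2 * Real.pi))⁻¹ * Real.exp (-x ^ 2 / 2) :=
    funext stdPDF_eq
  rw [e]
  convert h using 1
  ring

theorem continuous_stdPDF : Continuous stdPDF :=
  continuous_iff_continuousAt.2 fun x => (hasDerivAt_stdPDF x).continuousAt

theorem stdPDF_neg (x : ℝ) : stdPDF (-x) = stdPDF x := by simp [stdPDF_eq]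

theorem integrable_mul_stdPDF {k : ℝ → ℝ} (hk : Integrable k (gaussianReal 0 1)) :
    Integrable (fun x => k x * stdPDF x) := by
  rw [gaussianReal_of_var_ne_zero 0 one_ne_zero] at hk
  rw [integrable_withDensity_iff_integrable_smul' (measurable_gaussianPDF 0 1)
    (ae_of_all _ fun x => gaussianPDF_lt_top)] at hk
  refine hk.congr (ae_of_all _ fun x => ?_)
  simp [toReal_gaussianPDF, mul_comm]

theorem integral_mul_stdPDF (k : ℝ → ℝ) :
    ∫ x, k x * stdPDF x = ∫ x, k x ∂gaussianReal 0 1 := by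
  rw [integral_gaussianReal_eq_integral_smul one_ne_zero]
  simp [mul_comm]

theorem integrable_id_gaussianReal (m : ℝ) (v : ℝ≥0) :
    Integrable (fun x : ℝ => x) (gaussianReal m v) :=
  (memLp_id_gaussianReal (μ := m) (v := v) 1).integrable (by simp)

theorem integrable_lipschitz {P : Measure ℝ} [IsFiniteMeasure P]
    (hP : Integrable (fun x : ℝ => x) P) {h : ℝ → ℝ} {c : ℝ≥0} (hh : LipschitzWith c h) :
    Integrable h P := by
  refine Integrable.mono' (g := fun x => c * |x| + |h 0|) ?_ hh.continuous.aestronglyMeasurable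
    (ae_of_all _ fun x => ?_)
  · exact (hP.abs.const_mul _).add (integrable_const _)
  · have h1 := hh.dist_le_mul x 0
    rw [Real.dist_eq, Real.dist_eq, sub_zero] at h1
    have h2 := abs_sub_abs_le_abs_sub (h x) (h 0)
    rw [Real.norm_eq_abs]
    linarith

theorem tendsto_stdPDF : Tendsto stdPDF atTop (𝓝 0) := by
  have e : stdPDF = fun x : ℝ => (√(2 * Real.pi))⁻¹ * Real.exp (-x ^ 2 / 2) :=
    funext stdPDF_eq
  rw [e, ← mul_zero (√(2 * Real.pi))⁻¹]
  refine Tendsto.const_mul _ (Real.tendsto_exp_atBot.comp ?_)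
  have : Tendsto (fun x : ℝ => x ^ 2 / 2) atTop atTop :=
    (tendsto_pow_atTop two_ne_zero).atTop_div_const two_pos
  refine (tendsto_neg_atTop_atBot.comp this).congr fun x => ?_
  simp only [Function.comp_apply]; ring

/-- The first moment of the upper tail: `∫_x^∞ t stdPDF(t) dt = stdPDF(x)`. -/
theorem setIntegral_id_mul_stdPDF (x : ℝ) : ∫ t in Set.Ioi x, t * stdPDF t = stdPDF x := by
  have h := integral_Ioi_of_hasDerivAt_of_tendsto (f := fun t => -stdPDF t)
    (f' := fun t => t * stdPDF t) (a := x) (m := 0) (continuous_stdPDF.neg.continuousWithinAt)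
    (fun t _ => (hasDerivAt_stdPDF t).neg.congr_deriv (by ring))
    (integrable_mul_stdPDF (integrable_id_gaussianReal 0 1)).integrableOn
    (by simpa using tendsto_stdPDF.neg)
  simpa using h

theorem hasDerivAt_setIntegral_Ioi {k : ℝ → ℝ} (hc : Continuous k) (hk : Integrable k) (x : ℝ) :
    HasDerivAt (fun x => ∫ t in Set.Ioi x, k t) (-k x) x := by
  have e : (fun x => ∫ t in Set.Ioi x, k t)
      = fun x => (∫ t in Set.Ioi 0, k t) - ∫ t in (0 : ℝ)..x, k t := by
    funext x
    have := intervalIntegral.integral_Ioi_sub_Ioi' (f := k) (μ := volume) (a := 0) (b := x)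
      hk.integrableOn hk.integrableOn
    linarith
  rw [e]
  simpa using (intervalIntegral.integral_hasDerivAt_right (hk.intervalIntegrable (a := 0) (b := x))
    hc.aestronglyMeasurable.stronglyMeasurableAtFilter hc.continuousAt).const_sub _

theorem tendsto_setIntegral_Ioi {k : ℝ → ℝ} (hk : Integrable k) :
    Tendsto (fun x => ∫ t in Set.Ioi x, k t) atTop (𝓝 0) := by
  have e : (fun x => ∫ t in Set.Ioi x, k t)
      = fun x => (∫ t in Set.Ioi 0, k t) - ∫ t in (0 : ℝ)..x, k t := by
    funext x
    have := intervalIntegral.integral_Ioi_sub_Ioi' (f := k) (μ := volume) (a := 0) (b := x)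
      hk.integrableOn hk.integrableOn
    linarith
  rw [e]
  simpa using (intervalIntegral_tendsto_integral_Ioi 0 hk.integrableOn tendsto_id).const_sub
    (∫ t in Set.Ioi 0, k t)

/-- The function `(√(x² + 4) - x) / 2`, Birnbaum's lower bound for the Mills ratio
`∫_x^∞ stdPDF / stdPDF(x)`; it is the positive root of `m² + x m = 1`. -/
def millsBound (x : ℝ) : ℝ := (√(x ^ 2 + 4) - x) / 2

theorem millsBound_sq (x : ℝ) : millsBound x ^ 2 = 1 - x * millsBound x := by
  have h : √(x ^ 2 + 4) ^ 2 = x ^ 2 + 4 := Real.sq_sqrt (by positivity)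
  unfold millsBound
  nlinarith

theorem millsBound_pos (x : ℝ) : 0 < millsBound x := by
  have h : |x| < √(x ^ 2 + 4) := by
    rw [← Real.sqrt_sq_eq_abs]; exact Real.sqrt_lt_sqrt (by positivity) (by linarith)
  have := le_abs_self x
  unfold millsBound
  linarith

theorem hasDerivAt_millsBound (x : ℝ) :
    HasDerivAt millsBound (-millsBound x / √(x ^ 2 + 4)) x := by
  have hp : (0 : ℝ) < √(x ^ 2 + 4) := Real.sqrt_pos.2 (by positivity)
  have h1 : HasDerivAt (fun x : ℝ => x ^ 2 + 4) (2 * x) x := by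
    simpa using (hasDerivAt_pow 2 x).add_const (4 : ℝ)
  have h2 := ((h1.sqrt (by positivity)).sub (hasDerivAt_id x)).div_const 2
  refine h2.congr_deriv ?_
  unfold millsBound
  field_simp
  ring

/-- Birnbaum's inequality for the Mills ratio: the difference of the two sides vanishes at infinity,
and it is decreasing. -/
theorem millsBound_mul_stdPDF_le {x : ℝ} (hx : 0 ≤ x) :
    millsBound x * stdPDF x ≤ ∫ t in Set.Ioi x, stdPDF t := by
  set G : ℝ → ℝ := fun x => (∫ t in Set.Ioi x, stdPDF t) - millsBound x * stdPDF x with hG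
  have hd : ∀ x, HasDerivAt G
      (-stdPDF x - (-millsBound x / √(x ^ 2 + 4) * stdPDF x + millsBound x * (-x * stdPDF x))) x :=
    fun x =>
    (hasDerivAt_setIntegral_Ioi continuous_stdPDF (integrable_gaussianPDFReal 0 1) x).sub
      ((hasDerivAt_millsBound x).mul (hasDerivAt_stdPDF x))
  have hanti : AntitoneOn G (Set.Ici 0) := by
    refine antitoneOn_of_deriv_nonpos (convex_Ici 0)
      (fun x _ => (hd x).continuousAt.continuousWithinAt)
      (fun x _ => (hd x).differentiableAt.differentiableWithinAt) fun x hx => ?_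
    rw [interior_Ici, Set.mem_Ioi] at hx
    rw [(hd x).deriv]
    have hp : (0 : ℝ) < √(x ^ 2 + 4) := Real.sqrt_pos.2 (by positivity)
    have hm := millsBound_pos x
    have hsq := millsBound_sq x
    have hr := stdPDF_pos x
    -- `1 / √(x² + 4) ≤ m`, because `x ≤ √(x² + 4)`
    have h1 : 1 / √(x ^ 2 + 4) ≤ millsBound x := by
      have h4 : √(x ^ 2 + 4) ^ 2 = x ^ 2 + 4 := Real.sq_sqrt (by positivity)
      have hle : x ≤ √(x ^ 2 + 4) := Real.le_sqrt_of_sq_le (by linarith)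
      rw [div_le_iff₀ hp]
      unfold millsBound
      nlinarith [mul_nonneg hx.le (sub_nonneg.2 hle), sq_nonneg (√(x ^ 2 + 4) - x)]
    have e : -stdPDF x - (-millsBound x / √(x ^ 2 + 4) * stdPDF x + millsBound x * (-x * stdPDF x))
        = stdPDF x * millsBound x * (1 / √(x ^ 2 + 4) - millsBound x) := by
      linear_combination (stdPDF x) * hsq
    rw [e]
    exact mul_nonpos_of_nonneg_of_nonpos (by positivity) (by linarith)
  have hlim : Tendsto G atTop (𝓝 0) := by
    have h2 : Tendsto (fun x => millsBound x * stdPDF x) atTop (𝓝 0) := by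
      refine squeeze_zero' (Eventually.of_forall fun x =>
        (mul_pos (millsBound_pos x) (stdPDF_pos x)).le) ?_ tendsto_stdPDF
      filter_upwards [eventually_ge_atTop (0 : ℝ)] with x hx
      have h1 : millsBound x ≤ 1 := by
        nlinarith [millsBound_sq x, mul_nonneg hx (millsBound_pos x).le, millsBound_pos x]
      nlinarith [stdPDF_pos x]
    simpa using (tendsto_setIntegral_Ioi (integrable_gaussianPDFReal 0 1)).sub h2
  have : 0 ≤ G x := by
    refine le_of_tendsto hlim ?_
    filter_upwards [eventually_ge_atTop x] with y hy
    exact hanti (Set.mem_Ici.2 hx) (Set.mem_Ici.2 (hx.trans hy)) hy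
  simp only [hG] at this
  linarith

/-- The bound on the derivative of the Stein solution, see `abs_steinDeriv_le`, is at most `1`. -/
theorem sqrt_one_add_sq_add_le {x : ℝ} (hx : 0 ≤ x) :
    millsBound x ^ 2 * (√(1 + x ^ 2) + x) ≤ 1 := by
  set m := millsBound x
  have hm : 0 < m := millsBound_pos x
  have hsq : m ^ 2 = 1 - x * m := millsBound_sq x
  have hm1 : m ≤ 1 := by nlinarith [mul_nonneg hx hm.le]
  have hxm : x = (1 - m ^ 2) / m := by field_simp; linarith
  -- in terms of `m`, the claim is `√(1 + x²) ≤ 1 / m² - x` with `x = 1 / m - m`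
  have h1 : 0 ≤ 1 / m ^ 2 - x := by
    rw [hxm]
    have : 1 / m ^ 2 - (1 - m ^ 2) / m = (1 - m + m ^ 3) / m ^ 2 := by field_simp; ring
    rw [this]
    have := pow_pos hm 3
    exact div_nonneg (by linarith) (by positivity)
  have h2 : √(1 + x ^ 2) ≤ 1 / m ^ 2 - x := by
    refine Real.sqrt_le_iff.2 ⟨h1, ?_⟩
    have : (1 / m ^ 2 - x) ^ 2 - (1 + x ^ 2) = (1 - m) ^ 3 * (1 + m) / m ^ 4 := by
      rw [hxm]; field_simp; ring
    have h3 : 0 ≤ (1 - m) ^ 3 * (1 + m) / m ^ 4 := by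
      have : 0 ≤ 1 - m := by linarith
      positivity
    linarith
  calc m ^ 2 * (√(1 + x ^ 2) + x) ≤ m ^ 2 * (1 / m ^ 2) := by gcongr; linarith
    _ = 1 := by field_simp

theorem integral_abs_sub_gaussian_le (x : ℝ) :
    ∫ t, |x - t| ∂gaussianReal 0 1 ≤ √(1 + x ^ 2) := by
  have hp : (0 : ℝ) < √(1 + x ^ 2) := Real.sqrt_pos.2 (by positivity)
  have hsq : √(1 + x ^ 2) ^ 2 = 1 + x ^ 2 := Real.sq_sqrt (by positivity)
  have hi := integrable_id_gaussianReal 0 1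
  have hi2 : Integrable (fun t : ℝ => t ^ 2) (gaussianReal 0 1) :=
    (memLp_id_gaussianReal (μ := 0) (v := 1) 2).integrable_sq
  have hv : ∫ t : ℝ, t ^ 2 ∂gaussianReal 0 1 = 1 := by
    have := variance_fun_id_gaussianReal (μ := 0) (v := 1)
    rw [variance_eq_integral (by fun_prop)] at this
    simpa [integral_id_gaussianReal] using this
  have hle : ∀ t : ℝ,
      |x - t| ≤ ((x ^ 2 - 2 * x * t + t ^ 2) / √(1 + x ^ 2) + √(1 + x ^ 2)) / 2 := by
    intro t
    have h0 : 0 ≤ (|x - t| - √(1 + x ^ 2)) ^ 2 := sq_nonneg _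
    rw [le_div_iff₀ two_pos, ← sub_nonneg]
    have : (x ^ 2 - 2 * x * t + t ^ 2) / √(1 + x ^ 2) + √(1 + x ^ 2) - |x - t| * 2
        = (|x - t| - √(1 + x ^ 2)) ^ 2 / √(1 + x ^ 2) := by
      field_simp
      nlinarith [sq_abs (x - t)]
    rw [this]; positivity
  have hint : Integrable (fun t : ℝ => x ^ 2 - 2 * x * t + t ^ 2) (gaussianReal 0 1) :=
    ((integrable_const _).sub (hi.const_mul _)).add hi2
  calc ∫ t, |x - t| ∂gaussianReal 0 1
      ≤ ∫ t, ((x ^ 2 - 2 * x * t + t ^ 2) / √(1 + x ^ 2) + √(1 + x ^ 2)) / 2 ∂gaussianReal 0 1 :=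
        integral_mono ((integrable_const x).sub hi).abs
          (((hint.div_const _).add (integrable_const _)).div_const _) hle
    _ = √(1 + x ^ 2) := by
        rw [integral_div, integral_add (hint.div_const _) (integrable_const _), integral_div,
          integral_add (f := fun t : ℝ => x ^ 2 - 2 * x * t)
            ((integrable_const _).sub (hi.const_mul _)) hi2,
          integral_sub (integrable_const _) (hi.const_mul _), integral_const_mul, hv,
          integral_id_gaussianReal]
        simp
        field_simp
        nlinarith

/-- The bounded solution of Stein's equation `f' - x f = h - 𝔼 h(Z)` for the standard Gaussian. -/
def steinSol (h : ℝ → ℝ) (x : ℝ) : ℝ :=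
  -(stdPDF x)⁻¹ * ∫ t in Set.Ioi x, (h t - ∫ y, h y ∂gaussianReal 0 1) * stdPDF t

/-- The derivative of `steinSol h`, see `hasDerivAt_steinSol`; it is given by Stein's equation. -/
def steinDeriv (h : ℝ → ℝ) (x : ℝ) : ℝ :=
  x * steinSol h x + (h x - ∫ y, h y ∂gaussianReal 0 1)

theorem integrable_centered_mul_stdPDF {h : ℝ → ℝ} (hh : LipschitzWith 1 h) :
    Integrable (fun t => (h t - ∫ y, h y ∂gaussianReal 0 1) * stdPDF t) :=
  integrable_mul_stdPDF
    ((integrable_lipschitz (integrable_id_gaussianReal 0 1) hh).sub (integrable_const _))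

theorem hasDerivAt_steinSol {h : ℝ → ℝ} (hh : LipschitzWith 1 h) (x : ℝ) :
    HasDerivAt (steinSol h) (steinDeriv h x) x := by
  have h1 := ((hasDerivAt_stdPDF x).inv (stdPDF_pos x).ne').neg.mul
    (hasDerivAt_setIntegral_Ioi (k := fun t => (h t - ∫ y, h y ∂gaussianReal 0 1) * stdPDF t)
      ((hh.continuous.sub continuous_const).mul continuous_stdPDF)
      (integrable_centered_mul_stdPDF hh) x)
  refine h1.congr_deriv ?_
  have := (stdPDF_pos x).ne'
  simp only [steinDeriv, steinSol, Pi.neg_apply, Pi.inv_apply]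
  field_simp

theorem abs_centered_le {h : ℝ → ℝ} (hh : LipschitzWith 1 h) (x : ℝ) :
    |h x - ∫ y, h y ∂gaussianReal 0 1| ≤ √(1 + x ^ 2) := by
  have hi := integrable_lipschitz (integrable_id_gaussianReal 0 1) hh
  have e : h x - ∫ y, h y ∂gaussianReal 0 1 = ∫ y, (h x - h y) ∂gaussianReal 0 1 := by
    rw [integral_sub (integrable_const _) hi]; simp
  rw [e]
  refine (abs_integral_le_integral_abs).trans (le_trans ?_ (integral_abs_sub_gaussian_le x))
  refine integral_mono ((integrable_const _).sub hi).abs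
    ((integrable_const _).sub (integrable_id_gaussianReal 0 1)).abs fun y => ?_
  simpa [Real.dist_eq] using hh.dist_le_mul x y

/-- The pointwise bound behind both `|f'| ≤ 1` and `|x f'| ≤ 3`, for the solution `f` of Stein's
equation. With `h t - h x` in place of `h t - 𝔼 h(Z)`, both terms of the derivative contain the
factor `stdPDF x - x ∫_x^∞ stdPDF`, which Birnbaum's inequality bounds. -/
theorem abs_steinDeriv_le_of_nonneg {h : ℝ → ℝ} (hh : LipschitzWith 1 h) {x : ℝ} (hx : 0 ≤ x) :
    |steinDeriv h x| ≤ millsBound x ^ 2 * (√(1 + x ^ 2) + x) := by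
  set m := ∫ y, h y ∂gaussianReal 0 1 with hm
  have hr := stdPDF_pos x
  have hI := (integrable_gaussianPDFReal 0 1)
  have hI1 := integrable_mul_stdPDF (integrable_id_gaussianReal 0 1)
  have hk := integrable_centered_mul_stdPDF hh
  set T := ∫ t in Set.Ioi x, stdPDF t with hT
  have hB : stdPDF x - x * T ≤ millsBound x ^ 2 * stdPDF x := by
    rw [millsBound_sq]
    nlinarith [mul_le_mul_of_nonneg_left (millsBound_mul_stdPDF_le hx) hx]
  have hdiff : Integrable (fun t => (h t - h x) * stdPDF t) := by
    refine (hk.sub (hI.const_mul (h x - m))).congr (ae_of_all _ fun t => ?_)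
    simp only [Pi.sub_apply, hm]; ring
  have hA : |∫ t in Set.Ioi x, (h t - h x) * stdPDF t| ≤ stdPDF x - x * T := by
    have e : stdPDF x - x * T = ∫ t in Set.Ioi x, (t * stdPDF t - x * stdPDF t) := by
      rw [integral_sub hI1.integrableOn (hI.const_mul x).integrableOn, setIntegral_id_mul_stdPDF,
        integral_const_mul]
    rw [e]
    refine (abs_integral_le_integral_abs).trans (setIntegral_mono_on hdiff.abs.integrableOn
      (hI1.sub (hI.const_mul x)).integrableOn measurableSet_Ioi fun t ht => ?_)
    have h1 := hh.dist_le_mul t x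
    rw [Real.dist_eq, Real.dist_eq, abs_of_pos (sub_pos.2 (Set.mem_Ioi.1 ht))] at h1
    rw [abs_mul, abs_of_pos (stdPDF_pos t), ← sub_mul]
    refine mul_le_mul_of_nonneg_right (by simpa using h1) (stdPDF_pos t).le
  have hsplit : ∫ t in Set.Ioi x, (h t - m) * stdPDF t
      = (∫ t in Set.Ioi x, (h t - h x) * stdPDF t) + (h x - m) * T := by
    rw [hT, ← integral_const_mul, ← integral_add hdiff.integrableOn (hI.const_mul _).integrableOn]
    congr 1; funext t; ring
  have hD : steinDeriv h x
      = (stdPDF x)⁻¹ * ((h x - m) * (stdPDF x - x * T)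
        - x * ∫ t in Set.Ioi x, (h t - h x) * stdPDF t) := by
    simp only [steinDeriv, steinSol, ← hm]
    rw [hsplit]
    field_simp
    ring
  have hc := abs_centered_le hh x
  rw [← hm] at hc
  have h0 : 0 ≤ stdPDF x - x * T := (abs_nonneg _).trans hA
  rw [hD, abs_mul, abs_of_pos (inv_pos.2 hr), inv_mul_le_iff₀ hr]
  calc |(h x - m) * (stdPDF x - x * T) - x * ∫ t in Set.Ioi x, (h t - h x) * stdPDF t|
      ≤ |h x - m| * (stdPDF x - x * T) + x * |∫ t in Set.Ioi x, (h t - h x) * stdPDF t| := by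
        refine (abs_sub _ _).trans (le_of_eq ?_)
        rw [abs_mul, abs_mul, abs_of_nonneg h0, abs_of_nonneg hx]
    _ ≤ √(1 + x ^ 2) * (stdPDF x - x * T) + x * (stdPDF x - x * T) := by gcongr
    _ = (√(1 + x ^ 2) + x) * (stdPDF x - x * T) := by ring
    _ ≤ (√(1 + x ^ 2) + x) * (millsBound x ^ 2 * stdPDF x) := by gcongr
    _ = _ := by ring

/-- Reflection of the Stein solution; it carries the bounds for `x ≥ 0` over to `x ≤ 0`. -/
theorem steinSol_neg {h : ℝ → ℝ} (hh : LipschitzWith 1 h) (x : ℝ) :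
    steinSol h (-x) = -steinSol (fun t => h (-t)) x := by
  set m := ∫ y, h y ∂gaussianReal 0 1 with hm
  have hm' : ∫ y, h (-y) ∂gaussianReal 0 1 = m := by
    have : gaussianReal 0 1 = (gaussianReal 0 1).map (fun x => -x) := by
      rw [gaussianReal_map_neg, neg_zero]
    rw [hm]
    conv_rhs => rw [this]
    rw [integral_map (by fun_prop) (hh.continuous.aestronglyMeasurable)]
  have hk := integrable_centered_mul_stdPDF hh
  rw [← hm] at hk
  have htot : ∫ t, (h t - m) * stdPDF t = 0 := by
    rw [integral_mul_stdPDF, integral_sub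
      (integrable_lipschitz (integrable_id_gaussianReal 0 1) hh) (integrable_const _), ← hm]
    simp
  have h1 := intervalIntegral.integral_Iic_add_Ioi (f := fun t => (h t - m) * stdPDF t)
    (μ := volume) (b := -x) hk.integrableOn hk.integrableOn
  have h2 := integral_comp_neg_Ioi (-(-x)) (fun t => (h t - m) * stdPDF t)
  simp only [neg_neg, stdPDF_neg] at h2
  simp only [steinSol, hm', ← hm, stdPDF_neg]
  rw [h2]
  have : ∫ t in Set.Ioi (-x), (h t - m) * stdPDF t
      = -∫ t in Set.Iic (-x), (h t - m) * stdPDF t := by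
    linarith
  rw [this]; ring

theorem steinDeriv_neg {h : ℝ → ℝ} (hh : LipschitzWith 1 h) (x : ℝ) :
    steinDeriv h (-x) = steinDeriv (fun t => h (-t)) x := by
  have hm' : ∫ y, h (-y) ∂gaussianReal 0 1 = ∫ y, h y ∂gaussianReal 0 1 := by
    have : gaussianReal 0 1 = (gaussianReal 0 1).map (fun x => -x) := by
      rw [gaussianReal_map_neg, neg_zero]
    conv_rhs => rw [this]
    rw [integral_map (by fun_prop) (hh.continuous.aestronglyMeasurable)]
  simp only [steinDeriv, steinSol_neg hh, hm']
  ring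

theorem abs_steinDeriv_le {h : ℝ → ℝ} (hh : LipschitzWith 1 h) (x : ℝ) :
    |steinDeriv h x| ≤ millsBound |x| ^ 2 * (√(1 + |x| ^ 2) + |x|) := by
  rcases le_total 0 x with hx | hx
  · rw [abs_of_nonneg hx]; exact abs_steinDeriv_le_of_nonneg hh hx
  · rw [abs_of_nonpos hx, ← neg_neg x, steinDeriv_neg hh, neg_neg]
    refine abs_steinDeriv_le_of_nonneg ?_ (neg_nonneg.2 hx)
    refine LipschitzWith.of_dist_le_mul fun a b => ?_
    simpa using hh.dist_le_mul (-a) (-b)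

theorem abs_steinDeriv_le_one {h : ℝ → ℝ} (hh : LipschitzWith 1 h) (x : ℝ) : |steinDeriv h x| ≤ 1 :=
  (abs_steinDeriv_le hh x).trans (sqrt_one_add_sq_add_le (abs_nonneg x))

theorem abs_mul_steinDeriv_le {h : ℝ → ℝ} (hh : LipschitzWith 1 h) (x : ℝ) :
    |x * steinDeriv h x| ≤ 3 := by
  have hx := abs_nonneg x
  have hm := millsBound_pos |x|
  have hsq := millsBound_sq |x|
  set m := millsBound |x|
  have hs : √(1 + |x| ^ 2) ≤ 1 + |x| :=
    Real.sqrt_le_iff.2 ⟨by positivity, by nlinarith⟩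
  have hm1 : m ≤ 1 := by nlinarith [mul_nonneg hx hm.le]
  have hxm : |x| * m ≤ 1 := by nlinarith [sq_nonneg m]
  rw [abs_mul]
  calc |x| * |steinDeriv h x| ≤ |x| * (m ^ 2 * (√(1 + |x| ^ 2) + |x|)) := by
        gcongr; exact abs_steinDeriv_le hh x
    _ ≤ |x| * (m ^ 2 * ((1 + |x|) + |x|)) := by gcongr
    _ = (|x| * m) * (m + 2 * (|x| * m)) := by ring
    _ ≤ 1 * (1 + 2 * 1) := by gcongr
    _ = 3 := by norm_num

theorem abs_steinSol_le {h : ℝ → ℝ} (hh : LipschitzWith 1 h) (x : ℝ) : |steinSol h x| ≤ 4 := by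
  have far : ∀ x, 1 ≤ |x| → |steinSol h x| ≤ 3 := by
    intro x hx
    have h1 := abs_steinDeriv_le_one hh x
    have h2 := abs_centered_le hh x
    have hs : √(1 + x ^ 2) ≤ 1 + |x| :=
      Real.sqrt_le_iff.2 ⟨by positivity, by nlinarith [sq_abs x]⟩
    have h3 : |x * steinSol h x| ≤ 2 + |x| := by
      have e : x * steinSol h x = steinDeriv h x - (h x - ∫ y, h y ∂gaussianReal 0 1) := by
        simp [steinDeriv]
      rw [e]
      refine (abs_sub _ _).trans (by linarith)
    rw [abs_mul] at h3
    by_contra hcon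
    push Not at hcon
    nlinarith
  rcases le_total 1 |x| with hx | hx
  · linarith [far x hx]
  · -- compare with the value at `±1`, using `|f'| ≤ 1`
    have key : ∀ y, |y| = 1 → |x - y| ≤ 1 → |steinSol h x| ≤ 4 := by
      intro y hy hxy
      have h1 := Convex.norm_image_sub_le_of_norm_hasDerivWithin_le (f := steinSol h)
        (f' := steinDeriv h) (s := Set.univ) (C := 1) (x := y) (y := x)
        (fun z _ => (hasDerivAt_steinSol hh z).hasDerivWithinAt)
        (fun z _ => abs_steinDeriv_le_one hh z) convex_univ trivial trivial
      rw [Real.norm_eq_abs, Real.norm_eq_abs] at h1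
      have h2 := far y hy.ge
      have h3 := abs_sub_abs_le_abs_sub (steinSol h x) (steinSol h y)
      linarith
    rw [abs_le] at hx
    rcases le_total 0 x with h0 | h0
    · exact key 1 (by simp) (abs_le.2 ⟨by linarith, by linarith⟩)
    · exact key (-1) (by simp) (abs_le.2 ⟨by linarith, by linarith⟩)

theorem lipschitz_steinDeriv {h : ℝ → ℝ} (hh : LipschitzWith 1 h) (x y : ℝ) :
    |steinDeriv h x - steinDeriv h y| ≤ 8 * |x - y| := by
  have hd : ∀ z, HasDerivAt (fun z => z * steinSol h z)
      (steinSol h z + z * steinDeriv h z) z := fun z => by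
    exact ((hasDerivAt_id z).mul (hasDerivAt_steinSol hh z)).congr_deriv (by simp)
  have h1 := Convex.norm_image_sub_le_of_norm_hasDerivWithin_le (s := Set.univ) (C := 7)
    (x := y) (y := x) (fun z _ => (hd z).hasDerivWithinAt)
    (fun z _ => by
      have h1 := abs_steinSol_le hh z
      have h2 := abs_mul_steinDeriv_le hh z
      exact (abs_add_le _ _).trans (by linarith)) convex_univ trivial trivial
  have h2 := hh.dist_le_mul x y
  rw [Real.norm_eq_abs, Real.norm_eq_abs] at h1
  rw [Real.dist_eq, Real.dist_eq, NNReal.coe_one, one_mul] at h2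
  have e : steinDeriv h x - steinDeriv h y
      = (x * steinSol h x - y * steinSol h y) + (h x - h y) := by
    simp only [steinDeriv]; ring
  rw [e]
  exact (abs_add_le _ _).trans (by linarith)

/-- Stein's equation for `𝒩(0, σ²)` and a 1-Lipschitz test function. -/
theorem exists_stein_solution {h : ℝ → ℝ} (hh : LipschitzWith 1 h) {σ : ℝ≥0} (hσ : 0 < σ) :
    ∃ φ φ' : ℝ → ℝ, (∀ w, HasDerivAt φ (φ' w) w) ∧ (∀ w, |φ w| ≤ 4) ∧
      (∀ w, |φ' w| ≤ 1 / σ) ∧ (∀ w v, |φ' w - φ' v| ≤ 8 / (σ : ℝ) ^ 2 * |w - v|) ∧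
      ∀ w, (σ : ℝ) ^ 2 * φ' w - w * φ w = h w - ∫ y, h y ∂gaussianReal 0 (σ ^ 2) := by
  have hs : (0 : ℝ) < σ := hσ
  set k : ℝ → ℝ := fun u => h (σ * u) / σ with hk
  have hkL : LipschitzWith 1 k := by
    refine LipschitzWith.of_dist_le_mul fun a b => ?_
    have h1 := hh.dist_le_mul (σ * a) (σ * b)
    rw [Real.dist_eq, Real.dist_eq, ← mul_sub, abs_mul, abs_of_pos hs] at h1
    rw [Real.dist_eq, Real.dist_eq, hk, ← sub_div, abs_div, abs_of_pos hs, div_le_iff₀ hs]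
    simpa [mul_comm] using h1
  have hmean : ∫ u, k u ∂gaussianReal 0 1 = (∫ y, h y ∂gaussianReal 0 (σ ^ 2)) / σ := by
    have : gaussianReal 0 (σ ^ 2) = (gaussianReal 0 1).map (fun x => (σ : ℝ) * x) := by
      rw [gaussianReal_map_const_mul]; congr 1
      · simp
      · ext; simp
    rw [this, integral_map (by fun_prop) hh.continuous.aestronglyMeasurable, ← integral_div]
  refine ⟨fun w => steinSol k (w / σ), fun w => steinDeriv k (w / σ) / σ, fun w => ?_, fun w =>
    abs_steinSol_le hkL _, fun w => ?_, fun w v => ?_, fun w => ?_⟩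
  · have := (hasDerivAt_steinSol hkL (w / σ)).comp w ((hasDerivAt_id w).div_const (σ : ℝ))
    refine this.congr_deriv ?_
    ring
  · rw [abs_div, abs_of_pos hs]
    exact div_le_div_of_nonneg_right (abs_steinDeriv_le_one hkL _) hs.le
  · rw [← sub_div, abs_div, abs_of_pos hs, div_le_iff₀ hs]
    refine (lipschitz_steinDeriv hkL _ _).trans (le_of_eq ?_)
    rw [← sub_div, abs_div, abs_of_pos hs]
    field_simp
  · simp only [steinDeriv, hmean]
    simp only [hk]
    have : (σ : ℝ) * (w / σ) = w := by field_simp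
    rw [this]
    field_simp
    ring

end Stein

/-! ### Bounds in `L^p` and conditional means on product spaces -/

section LpBounds

variable {E E' : Type*} [MeasurableSpace E] [MeasurableSpace E'] {P : Measure E} {P' : Measure E'}
  {p : ℝ≥0∞} {f g : E → ℝ} {a c : ℝ}

/-- `f` is measurable up to null sets and its `L^p` norm is at most the real number `a`. -/
structure LpBound (p : ℝ≥0∞) (P : Measure E) (f : E → ℝ) (a : ℝ) : Prop where
  aesm : AEStronglyMeasurable f P
  le : eLpNorm f p P ≤ ENNReal.ofReal a

namespace LpBound

theorem memLp (h : LpBound p P f a) : MemLp f p P :=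
  ⟨h.aesm, h.le.trans_lt ENNReal.ofReal_lt_top⟩

theorem mono (h : LpBound p P f a) (hac : a ≤ c) : LpBound p P f c :=
  ⟨h.aesm, h.le.trans (ENNReal.ofReal_le_ofReal hac)⟩

theorem congr (h : LpBound p P f a) (hfg : f =ᵐ[P] g) : LpBound p P g a :=
  ⟨h.aesm.congr hfg, (eLpNorm_congr_ae hfg).symm.le.trans h.le⟩

theorem sub (hf : LpBound p P f a) (hg : LpBound p P g c) (hp : 1 ≤ p) (ha : 0 ≤ a) (hc : 0 ≤ c) :
    LpBound p P (fun x => f x - g x) (a + c) :=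
  ⟨hf.aesm.sub hg.aesm, (eLpNorm_sub_le hf.aesm hg.aesm hp).trans <| by
    rw [ENNReal.ofReal_add ha hc]; exact add_le_add hf.le hg.le⟩

theorem add (hf : LpBound p P f a) (hg : LpBound p P g c) (hp : 1 ≤ p) (ha : 0 ≤ a) (hc : 0 ≤ c) :
    LpBound p P (fun x => f x + g x) (a + c) :=
  ⟨hf.aesm.add hg.aesm, (eLpNorm_add_le hf.aesm hg.aesm hp).trans <| by
    rw [ENNReal.ofReal_add ha hc]; exact add_le_add hf.le hg.le⟩

theorem const_mul (hf : LpBound p P f a) {r : ℝ} (hr : 0 ≤ r) :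
    LpBound p P (fun x => r * f x) (r * a) := by
  refine ⟨hf.aesm.const_mul r, ?_⟩
  have := eLpNorm_const_smul_le (c := r) (f := f) (p := p) (μ := P)
  refine this.trans ?_
  rw [ENNReal.ofReal_mul hr, Real.enorm_eq_ofReal hr]
  gcongr
  exact hf.le

theorem sum {ι : Type*} (s : Finset ι) {f : ι → E → ℝ} {a : ι → ℝ}
    (hf : ∀ i ∈ s, LpBound p P (f i) (a i)) (hp : 1 ≤ p) (ha : ∀ i ∈ s, 0 ≤ a i) :
    LpBound p P (fun x => ∑ i ∈ s, f i x) (∑ i ∈ s, a i) := by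
  have e : (fun x => ∑ i ∈ s, f i x) = ∑ i ∈ s, f i := by ext x; simp
  rw [e]
  refine ⟨Finset.aestronglyMeasurable_sum s fun i hi => (hf i hi).aesm,
    (eLpNorm_sum_le (fun i hi => (hf i hi).aesm) hp).trans ?_⟩
  rw [ENNReal.ofReal_sum_of_nonneg ha]
  exact Finset.sum_le_sum fun i hi => (hf i hi).le

theorem comp {f' : E' → ℝ} {T : E → E'} (hf : LpBound p P' f' a)
    (hT : MeasurePreserving T P P') : LpBound p P (fun x => f' (T x)) a :=
  ⟨hf.aesm.comp_measurePreserving hT,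
    (eLpNorm_comp_measurePreserving hf.aesm hT).le.trans hf.le⟩

theorem mono_exponent [IsProbabilityMeasure P] {q : ℝ≥0∞} (hf : LpBound p P f a) (hq : q ≤ p) :
    LpBound q P f a :=
  ⟨hf.aesm, (eLpNorm_le_eLpNorm_of_exponent_le hq hf.aesm).trans hf.le⟩

theorem mul {q r : ℝ≥0∞} [ENNReal.HolderTriple p q r] (hf : LpBound p P f a) (hg : LpBound q P g c)
    (ha : 0 ≤ a) : LpBound r P (fun x => f x * g x) (a * c) := by
  refine ⟨hf.aesm.mul hg.aesm,
    (eLpNorm_smul_le_mul_eLpNorm (p := p) (q := q) hg.aesm hf.aesm).trans ?_⟩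
  rw [ENNReal.ofReal_mul ha]
  exact mul_le_mul' hf.le hg.le

theorem integrable (hf : LpBound 1 P f a) : Integrable f P := memLp_one_iff_integrable.1 hf.memLp

theorem integral_abs_le (hf : LpBound 1 P f a) (ha : 0 ≤ a) : ∫ x, |f x| ∂P ≤ a := by
  have h := hf.le
  rw [eLpNorm_one_eq_lintegral_enorm] at h
  rw [← ENNReal.ofReal_le_ofReal_iff ha]
  refine le_trans (le_of_eq ?_) h
  rw [ofReal_integral_eq_lintegral_ofReal hf.integrable.abs (ae_of_all _ fun x => abs_nonneg _)]
  refine lintegral_congr fun x => ?_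
  rw [← Real.enorm_abs, Real.enorm_eq_ofReal (abs_nonneg _)]

theorem abs_integral_le (hf : LpBound 1 P f a) (ha : 0 ≤ a) : |∫ x, f x ∂P| ≤ a :=
  abs_integral_le_integral_abs.trans (hf.integral_abs_le ha)

theorem integral_sq_le (hf : LpBound 2 P f a) (ha : 0 ≤ a) : ∫ x, f x ^ 2 ∂P ≤ a ^ 2 := by
  have h := (hf.mul hf ha (r := 1)).integral_abs_le (by positivity)
  simpa [abs_mul_abs_self, ← pow_two] using h

theorem of_integral_sq_le (hf : MemLp f 2 P) (ha : 0 ≤ a) (h : ∫ x, f x ^ 2 ∂P ≤ a ^ 2) :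
    LpBound 2 P f a := by
  refine ⟨hf.1, ?_⟩
  rw [hf.eLpNorm_eq_integral_rpow_norm two_ne_zero ENNReal.ofNat_ne_top]
  refine ENNReal.ofReal_le_ofReal ?_
  have e : ∫ x, ‖f x‖ ^ (2 : ℝ≥0∞).toReal ∂P = ∫ x, f x ^ 2 ∂P := by
    congr 1; funext x; simp
  rw [e]
  calc (∫ x, f x ^ 2 ∂P) ^ ((2 : ℝ≥0∞).toReal)⁻¹ ≤ (a ^ 2) ^ ((2 : ℝ≥0∞).toReal)⁻¹ := by
        refine Real.rpow_le_rpow (integral_nonneg fun x => sq_nonneg _) h (by simp)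
    _ = a := by
        have : ((2 : ℝ≥0∞).toReal)⁻¹ = 1 / 2 := by simp
        rw [this, ← Real.sqrt_eq_rpow, Real.sqrt_sq ha]

end LpBound

instance holderTriple_four_four_two : ENNReal.HolderTriple 4 4 2 where
  inv_add_inv_eq_inv := by
    have : (4 : ℝ≥0∞) = 2 * 2 := by norm_num
    rw [this, ENNReal.mul_inv (by simp) (by simp), ← mul_add, ENNReal.inv_two_add_inv_two, mul_one]

end LpBounds

/-- Distinct coordinates of an i.i.d. family form an i.i.d. family. -/
theorem measurePreserving_comp_injective {J κ 𝒳 : Type*} [Fintype J] [Fintype κ]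
    [MeasurableSpace 𝒳] (ν : Measure 𝒳) [IsProbabilityMeasure ν] {e : κ → J}
    (he : Function.Injective e) :
    MeasurePreserving (fun s : J → 𝒳 => s ∘ e) (Measure.pi fun _ => ν) (Measure.pi fun _ => ν) := by
  have hev : ∀ j : J, (Measure.pi fun _ : J => ν).map (fun s => s j) = ν := fun j =>
    (measurePreserving_eval (fun _ : J => ν) j).map_eq
  have hind : iIndepFun (fun (j : J) (s : J → 𝒳) => s j) (Measure.pi fun _ => ν) := by
    rw [iIndepFun_iff_map_fun_eq_pi_map fun j => (measurable_pi_apply j).aemeasurable]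
    simp only [hev]
    exact Measure.map_id
  refine ⟨measurable_pi_lambda _ fun k => measurable_pi_apply (e k), ?_⟩
  have h := (iIndepFun_iff_map_fun_eq_pi_map
    fun k => (measurable_pi_apply (e k)).aemeasurable).1 (hind.precomp he)
  simp only [hev] at h
  exact h

theorem measurePreserving_comp_perm {J 𝒳 : Type*} [Fintype J] [MeasurableSpace 𝒳]
    (ν : Measure 𝒳) [IsProbabilityMeasure ν] (e : Equiv.Perm J) :
    MeasurePreserving (fun s : J → 𝒳 => s ∘ e) (Measure.pi fun _ => ν) (Measure.pi fun _ => ν) :=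
  measurePreserving_comp_injective ν e.injective

section Path

variable {J 𝒳 : Type*} [DecidableEq J]

/-- `Ψ` does not depend on the coordinate `j`. -/
def FreeAt {β : Type*} (j : J) (Ψ : (J → 𝒳) → β) : Prop :=
  ∀ s c, Ψ (Function.update s j c) = Ψ s

theorem FreeAt.comp_perm {β : Type*} {j : J} {Ψ : (J → 𝒳) → β} (e : Equiv.Perm J)
    (h : FreeAt (e.symm j) Ψ) : FreeAt j (fun s => Ψ (s ∘ e)) := fun s c => by
  simp only [Function.update_comp_equiv]; exact h _ c

variable [MeasurableSpace 𝒳] (ν : Measure 𝒳)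

/-- The conditional mean given all the coordinates but `j`: that coordinate is integrated out. -/
def condMean (j : J) (U : (J → 𝒳) → ℝ) (s : J → 𝒳) : ℝ :=
  ∫ c, U (Function.update s j c) ∂ν

theorem condMean_comp_perm {j : J} (e : Equiv.Perm J) (he : e j = j) (U : (J → 𝒳) → ℝ)
    (s : J → 𝒳) : condMean ν j (fun s => U (s ∘ e)) s = condMean ν j U (s ∘ e) := by
  simp only [condMean, Function.update_comp_equiv]
  rw [e.symm_apply_eq.2 he.symm]

variable [Fintype J] [IsProbabilityMeasure ν]

/-- Replacing one coordinate by an independent copy does not change the law. -/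
theorem measurePreserving_update (j : J) :
    MeasurePreserving (fun q : (J → 𝒳) × 𝒳 => Function.update q.1 j q.2)
      ((Measure.pi fun _ => ν).prod ν) (Measure.pi fun _ => ν) := by
  have hm : Measurable (fun q : (J → 𝒳) × 𝒳 => Function.update q.1 j q.2) := by
    refine measurable_pi_lambda _ fun i => ?_
    by_cases h : i = j
    · subst h; simpa using measurable_snd
    · simp only [Function.update_of_ne h]; fun_prop
  refine ⟨hm, ?_⟩
  symm
  refine Measure.pi_eq fun t ht => ?_
  rw [Measure.map_apply hm (MeasurableSet.univ_pi ht)]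
  have e : (fun q : (J → 𝒳) × 𝒳 => Function.update q.1 j q.2) ⁻¹' Set.univ.pi t
      = (Set.univ.pi (Function.update t j Set.univ)) ×ˢ t j := by
    ext ⟨s, c⟩
    simp only [Set.mem_preimage, Set.mem_pi, Set.mem_univ, true_imp_iff, Set.mem_prod]
    constructor
    · intro h
      refine ⟨fun i => ?_, by simpa using h j⟩
      by_cases hi : i = j
      · subst hi; simp
      · simpa [Function.update_of_ne hi] using h i
    · rintro ⟨h, hc⟩ i
      by_cases hi : i = j
      · subst hi; simpa using hc
      · simpa [Function.update_of_ne hi] using h i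
  rw [e, Measure.prod_prod, Measure.pi_pi, ← Finset.mul_prod_erase _ _ (Finset.mem_univ j),
    ← Finset.mul_prod_erase Finset.univ (fun i => ν (t i)) (Finset.mem_univ j)]
  have : ∏ i ∈ Finset.univ.erase j, ν (Function.update t j Set.univ i)
      = ∏ i ∈ Finset.univ.erase j, ν (t i) :=
    Finset.prod_congr rfl fun i hi => by rw [Function.update_of_ne (Finset.ne_of_mem_erase hi)]
  rw [this]
  simp [mul_comm]

theorem measurable_condMean (j : J) {U : (J → 𝒳) → ℝ} (hU : Measurable U) :
    Measurable (condMean ν j U) :=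
  (StronglyMeasurable.integral_prod_right'
    (hU.comp (measurePreserving_update ν j).measurable).stronglyMeasurable).measurable

/-- `condMean ν j U` is the orthogonal projection of `U` to the functions that do not depend on the
coordinate `j`. -/
theorem integral_mul_eq_condMean_mul (j : J) {U Ψ : (J → 𝒳) → ℝ} (hΨ : FreeAt j Ψ)
    (hint : Integrable (fun s => U s * Ψ s) (Measure.pi fun _ => ν)) :
    ∫ s, U s * Ψ s ∂(Measure.pi fun _ => ν)
      = ∫ s, condMean ν j U s * Ψ s ∂(Measure.pi fun _ => ν) := by
  have hmp := measurePreserving_update ν j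
  have h1 : ∫ s, U s * Ψ s ∂(Measure.pi fun _ => ν)
      = ∫ q, U (Function.update q.1 j q.2) * Ψ (Function.update q.1 j q.2)
          ∂((Measure.pi fun _ => ν).prod ν) := by
    conv_lhs => rw [← hmp.map_eq]
    rw [integral_map hmp.measurable.aemeasurable]
    rw [hmp.map_eq]; exact hint.aestronglyMeasurable
  have h2 := (hmp.integrable_comp hint.aestronglyMeasurable).2 hint
  rw [h1, integral_prod (fun q : (J → 𝒳) × 𝒳 =>
    U (Function.update q.1 j q.2) * Ψ (Function.update q.1 j q.2)) h2]
  refine integral_congr_ae (ae_of_all _ fun s => ?_)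
  simp only [hΨ s, condMean]
  rw [integral_mul_const]

/-- The conditional mean is a contraction of `L^p`. -/
theorem LpBound.condMean {p : ℝ≥0∞} (hp : 1 ≤ p) (hp' : p ≠ ∞) (j : J) {U : (J → 𝒳) → ℝ} {a : ℝ}
    (hU : Measurable U) (h : LpBound p (Measure.pi fun _ => ν) U a) :
    LpBound p (Measure.pi fun _ => ν) (CrossVal.condMean ν j U) a := by
  refine ⟨(measurable_condMean ν j hU).aestronglyMeasurable, le_trans ?_ h.le⟩
  have hp0 : p ≠ 0 := (zero_lt_one.trans_le hp).ne'
  have hpr : 0 < p.toReal := ENNReal.toReal_pos hp0 hp'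
  have hmp := measurePreserving_update ν j
  rw [eLpNorm_eq_lintegral_rpow_enorm_toReal hp0 hp',
    eLpNorm_eq_lintegral_rpow_enorm_toReal hp0 hp']
  refine ENNReal.rpow_le_rpow ?_ (by positivity)
  rw [← hmp.lintegral_comp (f := fun s => ‖U s‖ₑ ^ p.toReal) (by fun_prop),
    lintegral_prod _ (by
      have := hU.comp hmp.measurable
      exact (this.enorm.pow_const _).aemeasurable)]
  refine lintegral_mono fun s => ?_
  have hm : Measurable fun c => U (Function.update s j c) :=
    hU.comp (measurable_update s)
  calc ‖CrossVal.condMean ν j U s‖ₑ ^ p.toReal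
      ≤ (∫⁻ c, ‖U (Function.update s j c)‖ₑ ∂ν) ^ p.toReal :=
        ENNReal.rpow_le_rpow (enorm_integral_le_lintegral_enorm _) hpr.le
    _ = (eLpNorm (fun c => U (Function.update s j c)) 1 ν) ^ p.toReal := by
        rw [eLpNorm_one_eq_lintegral_enorm]
    _ ≤ (eLpNorm (fun c => U (Function.update s j c)) p ν) ^ p.toReal :=
        ENNReal.rpow_le_rpow
          (eLpNorm_le_eLpNorm_of_exponent_le hp hm.aestronglyMeasurable) hpr.le
    _ = ∫⁻ c, ‖U (Function.update s j c)‖ₑ ^ p.toReal ∂ν := by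
        rw [eLpNorm_eq_lintegral_rpow_enorm_toReal hp0 hp', one_div, ENNReal.rpow_inv_rpow hpr.ne']

theorem condMean_sub_ae (j : J) {U V : (J → 𝒳) → ℝ} (hU : Integrable U (Measure.pi fun _ => ν))
    (hV : Integrable V (Measure.pi fun _ => ν)) :
    condMean ν j (fun s => U s - V s)
      =ᵐ[Measure.pi fun _ => ν] fun s => condMean ν j U s - condMean ν j V s := by
  have hmp := measurePreserving_update ν j
  have h1 := ((hmp.integrable_comp hU.aestronglyMeasurable).2 hU).prod_right_ae
  have h2 := ((hmp.integrable_comp hV.aestronglyMeasurable).2 hV).prod_right_ae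
  filter_upwards [h1, h2] with s hs1 hs2
  exact integral_sub hs1 hs2

end Path

/-! ### Exchanging observations with their copies, and the Efron–Stein inequality -/

theorem integral_comp_mp {E E' : Type*} [MeasurableSpace E] [MeasurableSpace E'] {P : Measure E}
    {P' : Measure E'} {T : E → E'} (hT : MeasurePreserving T P P') {F : E' → ℝ}
    (hF : AEStronglyMeasurable F P') : ∫ s, F (T s) ∂P = ∫ s, F s ∂P' := by
  conv_rhs => rw [← hT.map_eq]
  rw [integral_map hT.measurable.aemeasurable (by rwa [hT.map_eq])]

section Resampling

variable {ι 𝒳 : Type*} [DecidableEq ι]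

/-- Exchange the `i`-th observation, at `inl i`, with its independent copy, at `inr i`. -/
def resample (i : ι) (s : ι ⊕ ι → 𝒳) : ι ⊕ ι → 𝒳 :=
  s ∘ Equiv.swap (Sum.inl i) (Sum.inr i)

theorem resample_resample (i : ι) (s : ι ⊕ ι → 𝒳) : resample i (resample i s) = s := by
  funext j; simp [resample]

theorem resample_comm (i l : ι) (s : ι ⊕ ι → 𝒳) :
    resample i (resample l s) = resample l (resample i s) := by
  by_cases h : i = l
  · rw [h]
  · funext j
    rcases j with j | j <;> by_cases h1 : j = i <;> by_cases h2 : j = l <;>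
      simp_all [resample, Equiv.swap_apply_def]

theorem resample_comp_inl (i : ι) (s : ι ⊕ ι → 𝒳) :
    resample i s ∘ Sum.inl = Function.update (s ∘ Sum.inl) i (s (Sum.inr i)) := by
  funext j
  by_cases h : j = i
  · subst h; simp [resample]
  · have : Equiv.swap (Sum.inl i : ι ⊕ ι) (Sum.inr i) (Sum.inl j) = Sum.inl j :=
      Equiv.swap_apply_of_ne_of_ne (by simpa using h) (by simp)
    simp [resample, Function.update_of_ne h, this]

theorem freeAt_inr_comp_inl {β : Type*} (j : ι) (γ : (ι → 𝒳) → β) :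
    FreeAt (Sum.inr j : ι ⊕ ι) (fun s => γ (s ∘ Sum.inl)) := fun s c => by
  have : Function.update s (Sum.inr j) c ∘ Sum.inl = s ∘ Sum.inl := by
    funext i; simp
  simp only [this]

theorem FreeAt.resample {β : Type*} {j : ι ⊕ ι} (i : ι) {Ψ : (ι ⊕ ι → 𝒳) → β}
    (h : FreeAt (Equiv.swap (Sum.inl i) (Sum.inr i) j) Ψ) :
    FreeAt j (fun s => Ψ (resample i s)) :=
  FreeAt.comp_perm (Equiv.swap (Sum.inl i) (Sum.inr i)) (by simpa using h)

theorem FreeAt.resample_of_ne {β : Type*} {l i : ι} (hl : l ≠ i) {Ψ : (ι ⊕ ι → 𝒳) → β}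
    (h : FreeAt (Sum.inl l) Ψ) : FreeAt (Sum.inl l) (fun s => Ψ (CrossVal.resample i s)) :=
  FreeAt.resample i (by
    rwa [Equiv.swap_apply_of_ne_of_ne (by simpa using hl) (by simp)])

theorem FreeAt.resample_of_ne' {β : Type*} {l i : ι} (hl : l ≠ i) {Ψ : (ι ⊕ ι → 𝒳) → β}
    (h : FreeAt (Sum.inr l) Ψ) : FreeAt (Sum.inr l) (fun s => Ψ (CrossVal.resample i s)) :=
  FreeAt.resample i (by
    rwa [Equiv.swap_apply_of_ne_of_ne (by simp) (by simpa using hl)])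

theorem FreeAt.resample_self {β : Type*} {i : ι} {Ψ : (ι ⊕ ι → 𝒳) → β}
    (h : FreeAt (Sum.inr i) Ψ) : FreeAt (Sum.inl i) (fun s => Ψ (CrossVal.resample i s)) :=
  FreeAt.resample i (by simpa using h)

/-- Exchange all the observations with indices in `A` with their independent copies. -/
def swapSet (A : Finset ι) : Equiv.Perm (ι ⊕ ι) :=
  Function.Involutive.toPerm
    (Sum.elim (fun i => if i ∈ A then Sum.inr i else Sum.inl i)
      (fun i => if i ∈ A then Sum.inl i else Sum.inr i))
    (by rintro (i | i) <;> by_cases h : i ∈ A <;> simp [h])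

theorem swapSet_inl (A : Finset ι) (i : ι) :
    swapSet A (Sum.inl i) = if i ∈ A then Sum.inr i else Sum.inl i := rfl

theorem swapSet_inr (A : Finset ι) (i : ι) :
    swapSet A (Sum.inr i) = if i ∈ A then Sum.inl i else Sum.inr i := rfl

theorem comp_swapSet_insert {A : Finset ι} {a : ι} (ha : a ∉ A) (s : ι ⊕ ι → 𝒳) :
    s ∘ swapSet (insert a A) = resample a s ∘ swapSet A := by
  funext j
  rcases j with i | i <;> by_cases h : i = a
  · subst h; simp [resample, swapSet_inl, ha]
  · by_cases hi : i ∈ A <;> simp [resample, swapSet_inl, h, hi, Equiv.swap_apply_def]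
  · subst h; simp [resample, swapSet_inr, ha]
  · by_cases hi : i ∈ A <;> simp [resample, swapSet_inr, h, hi, Equiv.swap_apply_def]

theorem comp_swapSet_insert' {A : Finset ι} {a : ι} (ha : a ∉ A) (s : ι ⊕ ι → 𝒳) :
    s ∘ swapSet (insert a A) = resample a (s ∘ swapSet A) := by
  funext j
  rcases j with i | i <;> by_cases h : i = a
  · subst h; simp [resample, swapSet_inl, swapSet_inr, ha]
  · by_cases hi : i ∈ A <;> simp [resample, swapSet_inl, h, hi, Equiv.swap_apply_def]
  · subst h; simp [resample, swapSet_inl, swapSet_inr, ha]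
  · by_cases hi : i ∈ A <;> simp [resample, swapSet_inr, h, hi, Equiv.swap_apply_def]

variable [Fintype ι] [MeasurableSpace 𝒳] (ν : Measure 𝒳)

/-- The joint law of the observations and of their independent copies. -/
abbrev pathMeasure (ι : Type*) [Fintype ι] (ν : Measure 𝒳) : Measure (ι ⊕ ι → 𝒳) :=
  Measure.pi fun _ => ν

variable [IsProbabilityMeasure ν]

theorem measurePreserving_resample (i : ι) :
    MeasurePreserving (resample (𝒳 := 𝒳) i) (pathMeasure ι ν) (pathMeasure ι ν) :=
  measurePreserving_comp_perm ν _

theorem integral_resample (i : ι) {F : (ι ⊕ ι → 𝒳) → ℝ}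
    (hF : AEStronglyMeasurable F (pathMeasure ι ν)) :
    ∫ s, F (resample i s) ∂pathMeasure ι ν = ∫ s, F s ∂pathMeasure ι ν :=
  integral_comp_mp (measurePreserving_resample ν i) hF

/-- The telescoping step of the Efron-Stein inequality. -/
theorem integral_mul_sub_swapSet_le {Z : (ι ⊕ ι → 𝒳) → ℝ} (hZ : MemLp Z 2 (pathMeasure ι ν))
    (A : Finset ι) :
    ∫ s, Z s * (Z s - Z (s ∘ swapSet A)) ∂pathMeasure ι ν
      ≤ ∑ i ∈ A, (∫ s, (Z s - Z (resample i s)) ^ 2 ∂pathMeasure ι ν) / 2 := by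
  induction A using Finset.induction_on with
  | empty =>
    have : ∀ s : ι ⊕ ι → 𝒳, s ∘ swapSet (∅ : Finset ι) = s := fun s => by
      funext j; rcases j with i | i <;> simp [swapSet_inl, swapSet_inr]
    simp [this]
  | insert a A ha ih =>
    have hmA := measurePreserving_comp_perm ν (swapSet A)
    have hma := measurePreserving_resample (ι := ι) ν a
    set Y : (ι ⊕ ι → 𝒳) → ℝ := fun s => Z (s ∘ swapSet A) with hY
    have hYL : MemLp Y 2 (pathMeasure ι ν) := hZ.comp_measurePreserving hmA
    have hZa : MemLp (fun s => Z (resample a s)) 2 (pathMeasure ι ν) :=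
      hZ.comp_measurePreserving hma
    have hYa : MemLp (fun s => Y (resample a s)) 2 (pathMeasure ι ν) :=
      hYL.comp_measurePreserving hma
    have iZZ : Integrable (fun s => Z s * Z s) (pathMeasure ι ν) := hZ.integrable_mul hZ
    have iZY : Integrable (fun s => Z s * Y s) (pathMeasure ι ν) := hZ.integrable_mul hYL
    have iZYa : Integrable (fun s => Z s * Y (resample a s)) (pathMeasure ι ν) :=
      hZ.integrable_mul hYa
    have iZaY : Integrable (fun s => Z (resample a s) * Y s) (pathMeasure ι ν) :=
      hZa.integrable_mul hYL
    have iZaYa : Integrable (fun s => Z (resample a s) * Y (resample a s)) (pathMeasure ι ν) :=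
      hZa.integrable_mul hYa
    have iDZ : Integrable (fun s => (Z s - Z (resample a s)) ^ 2) (pathMeasure ι ν) :=
      (hZ.sub hZa).integrable_sq
    have iDY : Integrable (fun s => (Y s - Y (resample a s)) ^ 2) (pathMeasure ι ν) :=
      (hYL.sub hYa).integrable_sq
    have e1 : ∫ s, Z (resample a s) * Y (resample a s) ∂pathMeasure ι ν
        = ∫ s, Z s * Y s ∂pathMeasure ι ν :=
      integral_resample ν a (F := fun s => Z s * Y s) iZY.aestronglyMeasurable
    have e2 : ∫ s, Z (resample a s) * Y s ∂pathMeasure ι ν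
        = ∫ s, Z s * Y (resample a s) ∂pathMeasure ι ν := by
      rw [← integral_resample ν a (F := fun s => Z s * Y (resample a s))
        iZYa.aestronglyMeasurable]
      simp only [resample_resample]
    have e3 : ∫ s, (Y s - Y (resample a s)) ^ 2 ∂pathMeasure ι ν
        = ∫ s, (Z s - Z (resample a s)) ^ 2 ∂pathMeasure ι ν := by
      rw [← integral_comp_mp hmA (F := fun s => (Z s - Z (resample a s)) ^ 2)
        iDZ.aestronglyMeasurable]
      simp only [hY, ← comp_swapSet_insert' ha, ← comp_swapSet_insert ha]
    have e4 : ∫ s, (Z s - Z (resample a s)) * (Y s - Y (resample a s)) ∂pathMeasure ι ν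
        = 2 * (∫ s, Z s * Y s ∂pathMeasure ι ν)
          - 2 * ∫ s, Z s * Y (resample a s) ∂pathMeasure ι ν := by
      have : ∀ s, (Z s - Z (resample a s)) * (Y s - Y (resample a s))
          = (Z s * Y s - Z s * Y (resample a s))
            - (Z (resample a s) * Y s - Z (resample a s) * Y (resample a s)) := fun s => by ring
      have i1 : Integrable (fun s => Z s * Y s - Z s * Y (resample a s)) (pathMeasure ι ν) :=
        iZY.sub iZYa
      have i2 : Integrable (fun s => Z (resample a s) * Y s - Z (resample a s) * Y (resample a s))
        (pathMeasure ι ν) := iZaY.sub iZaYa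
      simp only [this]
      rw [integral_sub i1 i2, integral_sub iZY iZYa,
        integral_sub iZaY iZaYa, e1, e2]
      ring
    have e5 : ∫ s, (Z s - Z (resample a s)) * (Y s - Y (resample a s)) ∂pathMeasure ι ν
        ≤ ∫ s, (Z s - Z (resample a s)) ^ 2 ∂pathMeasure ι ν := by
      have h : ∫ s, (Z s - Z (resample a s)) * (Y s - Y (resample a s)) ∂pathMeasure ι ν
          ≤ ∫ s, ((Z s - Z (resample a s)) ^ 2 / 2 + (Y s - Y (resample a s)) ^ 2 / 2)
            ∂pathMeasure ι ν := by
        refine integral_mono ((hZ.sub hZa).integrable_mul (hYL.sub hYa))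
          ((iDZ.div_const 2).add (iDY.div_const 2)) fun s => ?_
        change (Z s - Z (resample a s)) * (Y s - Y (resample a s)) ≤ _
        nlinarith [sq_nonneg ((Z s - Z (resample a s)) - (Y s - Y (resample a s)))]
      rw [integral_add (iDZ.div_const 2) (iDY.div_const 2), integral_div, integral_div, e3] at h
      linarith
    have e6 : ∫ s, Z s * (Z s - Z (s ∘ swapSet (insert a A))) ∂pathMeasure ι ν
        = (∫ s, Z s * (Z s - Y s) ∂pathMeasure ι ν)
          + ((∫ s, Z s * Y s ∂pathMeasure ι ν) - ∫ s, Z s * Y (resample a s) ∂pathMeasure ι ν) := by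
      have : ∀ s, Z s * (Z s - Z (s ∘ swapSet (insert a A)))
          = Z s * (Z s - Y s) + (Z s * Y s - Z s * Y (resample a s)) := fun s => by
        simp only [hY, comp_swapSet_insert ha]; ring
      have i1 : Integrable (fun s => Z s * (Z s - Y s)) (pathMeasure ι ν) :=
        hZ.integrable_mul (hZ.sub hYL)
      have i2 : Integrable (fun s => Z s * Y s - Z s * Y (resample a s)) (pathMeasure ι ν) :=
        iZY.sub iZYa
      simp only [this]
      rw [integral_add i1 i2, integral_sub iZY iZYa]
    rw [e6, Finset.sum_insert ha]
    linarith

/-- The Efron-Stein inequality, with independent copies of the variables. -/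
theorem efron_stein {z : (ι → 𝒳) → ℝ}
    (hZ : MemLp (fun s : ι ⊕ ι → 𝒳 => z (s ∘ Sum.inl)) 2 (pathMeasure ι ν)) :
    (∫ s, z (s ∘ Sum.inl) ^ 2 ∂pathMeasure ι ν) - (∫ s, z (s ∘ Sum.inl) ∂pathMeasure ι ν) ^ 2
      ≤ ∑ i, (∫ s, (z (s ∘ Sum.inl) - z (resample i s ∘ Sum.inl)) ^ 2 ∂pathMeasure ι ν) / 2 := by
  have h := integral_mul_sub_swapSet_le ν hZ Finset.univ
  refine le_trans (le_of_eq ?_) h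
  have hm := measurePreserving_comp_perm (𝒳 := 𝒳) ν (swapSet (Finset.univ : Finset ι))
  have e : ∀ s : ι ⊕ ι → 𝒳, (s ∘ swapSet Finset.univ) ∘ Sum.inl = s ∘ Sum.inr := fun s => by
    funext i; simp [swapSet_inl]
  have hZ' : MemLp (fun s : ι ⊕ ι → 𝒳 => z (s ∘ Sum.inr)) 2 (pathMeasure ι ν) := by
    have := hZ.comp_measurePreserving hm
    refine (memLp_congr_ae (ae_of_all _ fun s => ?_)).1 this
    simp only [Function.comp_apply, e]
  have hprod : ∫ s, z (s ∘ Sum.inl) * z (s ∘ Sum.inr) ∂pathMeasure ι ν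
      = (∫ s, z (s ∘ Sum.inl) ∂pathMeasure ι ν) * ∫ s, z (s ∘ Sum.inr) ∂pathMeasure ι ν := by
    have hmp := measurePreserving_sumPiEquivProdPi (X := fun _ : ι ⊕ ι => 𝒳) (fun _ => ν)
    have key : ∀ F : (ι → 𝒳) × (ι → 𝒳) → ℝ,
        ∫ s, F (s ∘ Sum.inl, s ∘ Sum.inr) ∂pathMeasure ι ν
          = ∫ q, F q ∂((Measure.pi fun _ : ι => ν).prod (Measure.pi fun _ : ι => ν)) := fun F =>
      hmp.integral_comp' F
    rw [key (fun q => z q.1 * z q.2), key (fun q => z q.1), key (fun q => z q.2),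
      integral_prod_mul, integral_fun_fst, integral_fun_snd]
    simp
  have hsame : ∫ s, z (s ∘ Sum.inr) ∂pathMeasure ι ν = ∫ s, z (s ∘ Sum.inl) ∂pathMeasure ι ν := by
    rw [← integral_comp_mp hm hZ.1]
    simp only [e]
  have iZ : Integrable (fun s : ι ⊕ ι → 𝒳 => z (s ∘ Sum.inl) * z (s ∘ Sum.inl))
    (pathMeasure ι ν) := hZ.integrable_mul hZ
  have iZ' : Integrable (fun s : ι ⊕ ι → 𝒳 => z (s ∘ Sum.inl) * z (s ∘ Sum.inr))
    (pathMeasure ι ν) := hZ.integrable_mul hZ'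
  simp only [e, mul_sub]
  rw [integral_sub iZ iZ', hprod, hsame]
  simp only [pow_two]

end Resampling

/-! ### Second moments of sums of centered functions -/

section Centered

variable {ι 𝒳 : Type*} [DecidableEq ι] [Fintype ι] [MeasurableSpace 𝒳] (ν : Measure 𝒳)

/-- `A` is orthogonal to every square-integrable function that does not depend on the `l`-th
observation; that is, the conditional mean of `A` given all the other coordinates vanishes. -/
def CenteredAt (l : ι) (A : (ι ⊕ ι → 𝒳) → ℝ) : Prop :=
  ∀ Ψ : (ι ⊕ ι → 𝒳) → ℝ, FreeAt (Sum.inl l) Ψ → MemLp Ψ 2 (pathMeasure ι ν) →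
    ∫ s, A s * Ψ s ∂pathMeasure ι ν = 0

variable {ν} {A B : (ι ⊕ ι → 𝒳) → ℝ} {l k : ι}

theorem CenteredAt.sub (hA : CenteredAt ν l A) (hB : CenteredAt ν l B)
    (hA2 : MemLp A 2 (pathMeasure ι ν)) (hB2 : MemLp B 2 (pathMeasure ι ν)) :
    CenteredAt ν l (fun s => A s - B s) := fun Ψ hΨ hΨ2 => by
  simp only [sub_mul]
  have h1 : Integrable (fun s => A s * Ψ s) (pathMeasure ι ν) := hA2.integrable_mul hΨ2
  have h2 : Integrable (fun s => B s * Ψ s) (pathMeasure ι ν) := hB2.integrable_mul hΨ2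
  rw [integral_sub h1 h2, hA Ψ hΨ hΨ2, hB Ψ hΨ hΨ2, sub_zero]

variable [IsProbabilityMeasure ν]

theorem MemLp.resample {p : ℝ≥0∞} (i : ι) (hA : MemLp A p (pathMeasure ι ν)) :
    MemLp (fun s => A (resample i s)) p (pathMeasure ι ν) :=
  hA.comp_measurePreserving (measurePreserving_resample ν i)

theorem LpBound.resample {p : ℝ≥0∞} {a : ℝ} (i : ι) (hA : LpBound p (pathMeasure ι ν) A a) :
    LpBound p (pathMeasure ι ν) (fun s => A (CrossVal.resample i s)) a :=
  hA.comp (measurePreserving_resample ν i)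

theorem CenteredAt.resample {i : ι} (hli : l ≠ i) (hA : CenteredAt ν l A)
    (hA2 : MemLp A 2 (pathMeasure ι ν)) : CenteredAt ν l (fun s => A (CrossVal.resample i s)) :=
  fun Ψ hΨ hΨ2 => by
    have h := hA _ (hΨ.resample_of_ne hli) (MemLp.resample i hΨ2)
    rw [← integral_resample ν i (F := fun s => A s * Ψ (CrossVal.resample i s))
      (hA2.1.mul (MemLp.resample i hΨ2).1)] at h
    simpa only [resample_resample] using h

/-- The covariance of two functions, each centered in its own observation, is that of their
increments in the observation of the other one. -/
theorem integral_mul_eq_of_centeredAt (hkl : k ≠ l) (hA : CenteredAt ν k A)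
    (hB : CenteredAt ν l B) (hA2 : MemLp A 2 (pathMeasure ι ν))
    (hB2 : MemLp B 2 (pathMeasure ι ν)) (hAf : FreeAt (Sum.inr l) A)
    (hBf : FreeAt (Sum.inr k) B) :
    ∫ s, A s * B s ∂pathMeasure ι ν
      = ∫ s, (A s - A (resample l s)) * (B s - B (resample k s)) ∂pathMeasure ι ν := by
  have hAl := MemLp.resample l hA2
  have hBk := MemLp.resample k hB2
  have i1 : Integrable (fun s => A s * B s) (pathMeasure ι ν) := hA2.integrable_mul hB2
  have i2 : Integrable (fun s => A s * B (resample k s)) (pathMeasure ι ν) :=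
    hA2.integrable_mul hBk
  have i3 : Integrable (fun s => B s * A (resample l s)) (pathMeasure ι ν) :=
    hB2.integrable_mul hAl
  have i4 : Integrable (fun s => B (resample k s) * A (resample l s)) (pathMeasure ι ν) :=
    hBk.integrable_mul hAl
  have z2 := hA _ hBf.resample_self hBk
  have z3 := hB _ hAf.resample_self hAl
  have z4 := (hB.resample hkl.symm hB2) _ hAf.resample_self hAl
  have e : ∀ s, (A s - A (resample l s)) * (B s - B (resample k s))
      = (A s * B s - A s * B (resample k s))
        - (B s * A (resample l s) - B (resample k s) * A (resample l s)) := fun s => by ring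
  have j1 : Integrable (fun s => A s * B s - A s * B (resample k s)) (pathMeasure ι ν) :=
    i1.sub i2
  have j2 : Integrable (fun s => B s * A (resample l s) - B (resample k s) * A (resample l s))
    (pathMeasure ι ν) := i3.sub i4
  simp only [e]
  rw [integral_sub j1 j2, integral_sub i1 i2, integral_sub i3 i4, z2, z3, z4]
  ring

end Centered

section CenteredSums

variable {ι 𝒳 : Type*} [DecidableEq ι] [Fintype ι] [MeasurableSpace 𝒳] {ν : Measure 𝒳}
  [IsProbabilityMeasure ν]

/-- Replacing the `k`-th observation changes the sum of the other summands by a random variable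
whose second moment is bounded through the first and second differences of the summands. -/
theorem integral_sum_diff_sq_le {g : ι → (ι → 𝒳) → ℝ} {d e : ℝ} (hd : 0 ≤ d) (he : 0 ≤ e)
    (hg2 : ∀ k, MemLp (fun s : ι ⊕ ι → 𝒳 => g k (s ∘ Sum.inl)) 2 (pathMeasure ι ν))
    (hc : ∀ k, CenteredAt ν k (fun s => g k (s ∘ Sum.inl)))
    (h1 : ∀ i k, i ≠ k → LpBound 2 (pathMeasure ι ν)
      (fun s => g k (s ∘ Sum.inl) - g k (resample i s ∘ Sum.inl)) d)
    (h2 : ∀ i l k, i ≠ k → l ≠ k → i ≠ l → LpBound 2 (pathMeasure ι ν)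
      (fun s => g k (s ∘ Sum.inl) - g k (resample i s ∘ Sum.inl)
        - (g k (resample l s ∘ Sum.inl) - g k (resample i (resample l s) ∘ Sum.inl))) e)
    (k : ι) :
    ∫ s, (∑ j ∈ Finset.univ.erase k,
        (g j (s ∘ Sum.inl) - g j (resample k s ∘ Sum.inl))) ^ 2 ∂pathMeasure ι ν
      ≤ Fintype.card ι * d ^ 2 + (Fintype.card ι) ^ 2 * e ^ 2 := by
  set A : ι → (ι ⊕ ι → 𝒳) → ℝ := fun j s => g j (s ∘ Sum.inl) - g j (resample k s ∘ Sum.inl)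
    with hA
  have hA2 : ∀ j, MemLp (A j) 2 (pathMeasure ι ν) := fun j =>
    (hg2 j).sub (MemLp.resample k (hg2 j))
  have hAA : ∀ j l, Integrable (fun s => A j s * A l s) (pathMeasure ι ν) := fun j l =>
    (hA2 j).integrable_mul (hA2 l)
  have hcA : ∀ j, j ≠ k → CenteredAt ν j (A j) := fun j hj =>
    (hc j).sub ((hc j).resample hj (hg2 j)) (hg2 j) (MemLp.resample k (hg2 j))
  have hfA : ∀ j l, l ≠ k → FreeAt (Sum.inr l) (A j) := fun j l hl s c => by
    have e1 := freeAt_inr_comp_inl l (g j) s c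
    have e2 := (freeAt_inr_comp_inl l (g j)).resample_of_ne' hl s c
    exact congrArg₂ (· - ·) e1 e2
  have hterm : ∀ j ∈ Finset.univ.erase k, ∀ l ∈ Finset.univ.erase k,
      ∫ s, A j s * A l s ∂pathMeasure ι ν ≤ (if j = l then d ^ 2 else 0) + e ^ 2 := by
    intro j hj l hl
    have hjk := Finset.ne_of_mem_erase hj
    have hlk := Finset.ne_of_mem_erase hl
    split_ifs with hjl
    · subst hjl
      have := (h1 k j hjk.symm).integral_sq_le hd
      simp only [hA, ← pow_two]
      nlinarith [sq_nonneg e]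
    · rw [integral_mul_eq_of_centeredAt hjl (hcA j hjk) (hcA l hlk) (hA2 j) (hA2 l)
        (hfA j l hlk) (hfA l j hjk), zero_add]
      have b1 := h2 k l j hjk.symm (Ne.symm hjl) hlk.symm
      have b2 := h2 k j l hlk.symm hjl hjk.symm
      have := (b1.mul b2 he (r := 1)).abs_integral_le (by positivity)
      rw [pow_two]
      exact (le_abs_self _).trans this
  have hexp : ∀ s, (∑ j ∈ Finset.univ.erase k, A j s) ^ 2
      = ∑ j ∈ Finset.univ.erase k, ∑ l ∈ Finset.univ.erase k, A j s * A l s := fun s => by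
    rw [pow_two, Finset.sum_mul_sum]
  have hcard : ((Finset.univ.erase k).card : ℝ) ≤ Fintype.card ι := by
    exact_mod_cast Finset.card_le_univ _
  calc ∫ s, (∑ j ∈ Finset.univ.erase k, A j s) ^ 2 ∂pathMeasure ι ν
      = ∑ j ∈ Finset.univ.erase k, ∑ l ∈ Finset.univ.erase k,
          ∫ s, A j s * A l s ∂pathMeasure ι ν := by
        simp only [hexp]
        rw [integral_finsetSum _ fun j _ => integrable_finsetSum _ fun l _ => hAA j l]
        exact Finset.sum_congr rfl fun j _ => integral_finsetSum _ fun l _ => hAA j l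
    _ ≤ ∑ j ∈ Finset.univ.erase k, ∑ l ∈ Finset.univ.erase k,
          ((if j = l then d ^ 2 else 0) + e ^ 2) :=
        Finset.sum_le_sum fun j hj => Finset.sum_le_sum fun l hl => hterm j hj l hl
    _ = (Finset.univ.erase k).card * (d ^ 2 + (Finset.univ.erase k).card * e ^ 2) := by
        simp only [Finset.sum_add_distrib, Finset.sum_ite_eq, Finset.sum_const, nsmul_eq_mul]
        rw [Finset.sum_congr rfl fun j hj => if_pos hj]
        simp only [Finset.sum_const, nsmul_eq_mul]
        ring
    _ ≤ Fintype.card ι * (d ^ 2 + Fintype.card ι * e ^ 2) := by gcongr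
    _ = _ := by ring

/-- The average of the squares of the summands concentrates around its mean. -/
theorem integral_abs_sub_mean_sq_le {g : ι → (ι → 𝒳) → ℝ} {a d : ℝ} (ha : 0 ≤ a) (hd : 0 ≤ d)
    (hn : 0 < Fintype.card ι)
    (hg : ∀ k, LpBound 4 (pathMeasure ι ν) (fun s => g k (s ∘ Sum.inl)) a)
    (h1 : ∀ i k, i ≠ k → LpBound 4 (pathMeasure ι ν)
      (fun s => g k (s ∘ Sum.inl) - g k (resample i s ∘ Sum.inl)) d) :
    ∫ s, |(Fintype.card ι : ℝ)⁻¹ * ∑ k, g k (s ∘ Sum.inl) ^ 2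
        - ∫ s', (Fintype.card ι : ℝ)⁻¹ * ∑ k, g k (s' ∘ Sum.inl) ^ 2 ∂pathMeasure ι ν|
        ∂pathMeasure ι ν
      ≤ 4 * a ^ 2 / √(Fintype.card ι : ℝ) + 2 * √(Fintype.card ι : ℝ) * (a * d) := by
  set n : ℝ := ((Fintype.card ι : ℕ) : ℝ) with hnd
  have hn0 : 0 < n := by rw [hnd]; exact_mod_cast hn
  have hs0 : 0 < √n := Real.sqrt_pos.2 hn0
  have hss : √n * √n = n := Real.mul_self_sqrt hn0.le
  set z : (ι → 𝒳) → ℝ := fun x => n⁻¹ * ∑ k, g k x ^ 2 with hz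
  have hsq : ∀ k, LpBound 2 (pathMeasure ι ν) (fun s => g k (s ∘ Sum.inl) ^ 2) (a * a) :=
    fun k => by simpa only [pow_two] using (hg k).mul (hg k) ha (r := 2)
  have hZ : LpBound 2 (pathMeasure ι ν) (fun s => z (s ∘ Sum.inl)) (n⁻¹ * ∑ _k : ι, a * a) :=
    (LpBound.sum Finset.univ (fun k _ => hsq k) (by norm_num) (fun k _ => by positivity)).const_mul
      (by positivity)
  have hZ2 := hZ.memLp
  -- one observation enters one summand directly, and all the others through the training
  have hdiff : ∀ i, LpBound 2 (pathMeasure ι ν)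
      (fun s => z (s ∘ Sum.inl) - z (resample i s ∘ Sum.inl))
      (n⁻¹ * (4 * a ^ 2 + n * (2 * (a * d)))) := by
    intro i
    have hterm : ∀ k, LpBound 2 (pathMeasure ι ν)
        (fun s => g k (s ∘ Sum.inl) ^ 2 - g k (resample i s ∘ Sum.inl) ^ 2)
        ((if k = i then 4 * a ^ 2 else 0) + 2 * (a * d)) := by
      intro k
      have hplus := (hg k).add (LpBound.resample i (hg k)) (by norm_num) ha ha
      have e : ∀ s : ι ⊕ ι → 𝒳, g k (s ∘ Sum.inl) ^ 2 - g k (resample i s ∘ Sum.inl) ^ 2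
          = (g k (s ∘ Sum.inl) + g k (resample i s ∘ Sum.inl))
            * (g k (s ∘ Sum.inl) - g k (resample i s ∘ Sum.inl)) := fun s => by ring
      simp only [e]
      split_ifs with hki
      · have hminus := (hg k).sub (LpBound.resample i (hg k)) (by norm_num) ha ha
        exact (hplus.mul hminus (by positivity) (r := 2)).mono (by
          nlinarith [mul_nonneg ha hd])
      · exact (hplus.mul (h1 i k (Ne.symm hki)) (by positivity) (r := 2)).mono (by linarith)
    have hsum := (LpBound.sum Finset.univ (fun k _ => hterm k) (by norm_num)
      (fun k _ => by split_ifs <;> positivity)).const_mul (r := n⁻¹) (by positivity)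
    have e : ∀ s : ι ⊕ ι → 𝒳, z (s ∘ Sum.inl) - z (resample i s ∘ Sum.inl)
        = n⁻¹ * ∑ k, (g k (s ∘ Sum.inl) ^ 2 - g k (resample i s ∘ Sum.inl) ^ 2) := fun s => by
      simp only [hz, Finset.sum_sub_distrib]; ring
    simp only [e]
    refine hsum.mono (le_of_eq ?_)
    simp [Finset.sum_add_distrib, hnd]
  set v : ℝ := n⁻¹ * (4 * a ^ 2 + n * (2 * (a * d))) with hv
  have hv0 : 0 ≤ v := by positivity
  set m : ℝ := ∫ s, z (s ∘ Sum.inl) ∂pathMeasure ι ν with hm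
  have hES := efron_stein ν hZ2
  have hsumv : ∑ i, (∫ s, (z (s ∘ Sum.inl) - z (resample i s ∘ Sum.inl)) ^ 2
      ∂pathMeasure ι ν) / 2 ≤ (√n * v) ^ 2 := by
    calc ∑ i, (∫ s, (z (s ∘ Sum.inl) - z (resample i s ∘ Sum.inl)) ^ 2 ∂pathMeasure ι ν) / 2
        ≤ ∑ _i : ι, v ^ 2 := Finset.sum_le_sum fun i _ => by
          have := (hdiff i).integral_sq_le hv0
          nlinarith [sq_nonneg v]
      _ = n * v ^ 2 := by simp [hnd]
      _ = (√n * v) ^ 2 := by rw [mul_pow (√n) v, Real.sq_sqrt hn0.le]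
  have hZi : Integrable (fun s : ι ⊕ ι → 𝒳 => z (s ∘ Sum.inl)) (pathMeasure ι ν) :=
    hZ2.integrable (by norm_num)
  have hvar : ∫ s, (z (s ∘ Sum.inl) - m) ^ 2 ∂pathMeasure ι ν ≤ (√n * v) ^ 2 := by
    have e : ∀ s : ι ⊕ ι → 𝒳, (z (s ∘ Sum.inl) - m) ^ 2
        = z (s ∘ Sum.inl) ^ 2 - (2 * m * z (s ∘ Sum.inl) - m ^ 2) := fun s => by ring
    have i2 : Integrable (fun s : ι ⊕ ι → 𝒳 => 2 * m * z (s ∘ Sum.inl) - m ^ 2)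
      (pathMeasure ι ν) := (hZi.const_mul _).sub (integrable_const _)
    simp only [e]
    rw [integral_sub hZ2.integrable_sq i2, integral_sub (hZi.const_mul _) (integrable_const _),
      integral_const_mul, ← hm]
    simp only [integral_const, probReal_univ, smul_eq_mul]
    linarith
  have hB : LpBound 2 (pathMeasure ι ν) (fun s => z (s ∘ Sum.inl) - m) (√n * v) :=
    LpBound.of_integral_sq_le (hZ2.sub (memLp_const _)) (by positivity) hvar
  refine ((hB.mono_exponent (q := 1) (by norm_num)).integral_abs_le (by positivity)).trans
    (le_of_eq ?_)
  have hinv : √n * n⁻¹ = (√n)⁻¹ := by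
    nth_rewrite 2 [← hss]
    field_simp
  calc √n * v = √n * n⁻¹ * (4 * a ^ 2) + √n * (n * n⁻¹) * (2 * (a * d)) := by rw [hv]; ring
    _ = 4 * a ^ 2 / √n + 2 * √n * (a * d) := by
        rw [hinv, mul_inv_cancel₀ hn0.ne']; ring

end CenteredSums

/-! ### Stein's method for sums of centered functions -/

section SteinBound

theorem abs_sub_le_of_deriv {φ φ' : ℝ → ℝ} {c : ℝ} (hφ : ∀ w, HasDerivAt φ (φ' w) w)
    (hc : ∀ w, |φ' w| ≤ c) (x y : ℝ) : |φ x - φ y| ≤ c * |x - y| := by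
  simpa only [Real.norm_eq_abs] using
    Convex.norm_image_sub_le_of_norm_hasDerivWithin_le (f := φ) (s := Set.univ) (C := c)
      (x := y) (y := x) (fun z _ => (hφ z).hasDerivWithinAt) (fun z _ => hc z) convex_univ
      trivial trivial

/-- Taylor's formula of order one for a function with Lipschitz derivative. -/
theorem abs_taylor_le {φ φ' : ℝ → ℝ} {M : ℝ} (hM : 0 ≤ M) (hφ : ∀ w, HasDerivAt φ (φ' w) w)
    (hL : ∀ w v, |φ' w - φ' v| ≤ M * |w - v|) (x y : ℝ) :
    |φ y - φ x - (y - x) * φ' x| ≤ M * (y - x) ^ 2 := by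
  have hd : ∀ z, HasDerivAt (fun z => φ z - z * φ' x) (φ' z - φ' x) z := fun z => by
    exact ((hφ z).sub ((hasDerivAt_id z).mul_const (φ' x))).congr_deriv (by simp)
  have h := Convex.norm_image_sub_le_of_norm_hasDerivWithin_le (f := fun z => φ z - z * φ' x)
    (s := Set.uIcc x y) (C := M * |y - x|) (x := x) (y := y)
    (fun z _ => (hd z).hasDerivWithinAt)
    (fun z hz => by
      rw [Real.norm_eq_abs]
      refine (hL z x).trans ?_
      exact mul_le_mul_of_nonneg_left (Set.abs_sub_left_of_mem_uIcc hz) hM)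
    (convex_uIcc x y) Set.left_mem_uIcc Set.right_mem_uIcc
  rw [Real.norm_eq_abs, Real.norm_eq_abs] at h
  have e : φ y - φ x - (y - x) * φ' x = φ y - y * φ' x - (φ x - x * φ' x) := by ring
  rw [e]
  refine h.trans (le_of_eq ?_)
  rw [mul_assoc, abs_mul_abs_self, pow_two]

theorem continuous_of_abs_sub_le {ψ : ℝ → ℝ} {M : ℝ} (hL : ∀ w v, |ψ w - ψ v| ≤ M * |w - v|) :
    Continuous ψ :=
  (LipschitzWith.of_dist_le_mul (K := M.toNNReal) fun w v => by
    rw [Real.dist_eq, Real.dist_eq]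
    exact (hL w v).trans (by gcongr; exact Real.le_coe_toNNReal M)).continuous

variable {ι 𝒳 : Type*} [DecidableEq ι] [Fintype ι] [MeasurableSpace 𝒳] {ν : Measure 𝒳}
  [IsProbabilityMeasure ν]

theorem memLp_comp_of_bounded {ψ : ℝ → ℝ} (hψ : Continuous ψ) {c : ℝ} (hb : ∀ w, |ψ w| ≤ c)
    {E : Type*} [MeasurableSpace E] {P : Measure E} [IsFiniteMeasure P] {V : E → ℝ}
    (hV : AEStronglyMeasurable V P) (p : ℝ≥0∞) : MemLp (fun s => ψ (V s)) p P :=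
  MemLp.of_bound (hψ.comp_aestronglyMeasurable hV) c (ae_of_all _ fun s => by
    rw [Real.norm_eq_abs]; exact hb _)

/-- One summand of `𝔼[W φ(W)]`, where `W = r ∑ g_k`: up to controlled errors, it is
`r 𝔼[g_k² φ'(W)]`. -/
theorem abs_integral_summand_le {g : ι → (ι → 𝒳) → ℝ} {a δ r L M : ℝ} (ha : 0 ≤ a) (hδ : 0 ≤ δ)
    (hr : 0 ≤ r) (hL : 0 ≤ L) (hM : 0 ≤ M)
    (hg : ∀ k, LpBound 4 (pathMeasure ι ν) (fun s => g k (s ∘ Sum.inl)) a)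
    {k : ι} (hc : CenteredAt ν k (fun s => g k (s ∘ Sum.inl)))
    (hD : LpBound 2 (pathMeasure ι ν) (fun s => ∑ j ∈ Finset.univ.erase k,
        (g j (s ∘ Sum.inl) - g j (resample k s ∘ Sum.inl))) δ)
    {φ φ' : ℝ → ℝ} (hφ : ∀ w, HasDerivAt φ (φ' w) w) {c : ℝ} (hφc : ∀ w, |φ w| ≤ c)
    (hφL : ∀ w, |φ' w| ≤ L) (hφM : ∀ w v, |φ' w - φ' v| ≤ M * |w - v|) :
    |(∫ s, g k (s ∘ Sum.inl) * φ (r * ∑ j, g j (s ∘ Sum.inl)) ∂pathMeasure ι ν)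
        - ∫ s, r * (g k (s ∘ Sum.inl) ^ 2 * φ' (r * ∑ j, g j (s ∘ Sum.inl))) ∂pathMeasure ι ν|
      ≤ M * r ^ 2 * a ^ 3 + L * r * (a * δ) := by
  set G : ι → (ι ⊕ ι → 𝒳) → ℝ := fun j s => g j (s ∘ Sum.inl) with hG
  set W : (ι ⊕ ι → 𝒳) → ℝ := fun s => r * ∑ j, g j (s ∘ Sum.inl) with hW
  set V : (ι ⊕ ι → 𝒳) → ℝ := fun s => r * ∑ j ∈ Finset.univ.erase k, g j (s ∘ Sum.inl) with hV
  set D : (ι ⊕ ι → 𝒳) → ℝ := fun s => ∑ j ∈ Finset.univ.erase k,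
        (g j (s ∘ Sum.inl) - g j (resample k s ∘ Sum.inl)) with hDd
  have hφc' : Continuous φ := continuous_iff_continuousAt.2 fun x => (hφ x).continuousAt
  have hφ'c : Continuous φ' := continuous_of_abs_sub_le hφM
  have hGm : ∀ j, AEStronglyMeasurable (G j) (pathMeasure ι ν) := fun j => (hg j).aesm
  have hWm : AEStronglyMeasurable W (pathMeasure ι ν) :=
    (Finset.aestronglyMeasurable_fun_sum Finset.univ fun j _ => hGm j).const_mul r
  have hVm : AEStronglyMeasurable V (pathMeasure ι ν) :=
    (Finset.aestronglyMeasurable_fun_sum _ fun j _ => hGm j).const_mul r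
  have hVkm : AEStronglyMeasurable (fun s => V (resample k s)) (pathMeasure ι ν) :=
    hVm.comp_measurePreserving (measurePreserving_resample ν k)
  have hg2 := (hg k).mono_exponent (q := 2) (by norm_num)
  have hg1 := (hg k).mono_exponent (q := 1) (by norm_num)
  have hgsq : LpBound 2 (pathMeasure ι ν) (fun s => G k s * G k s) (a * a) :=
    (hg k).mul (hg k) ha
  -- after the exchange of the `k`-th observation, `V` is independent of it
  have hzero : ∫ s, G k s * φ (V (resample k s)) ∂pathMeasure ι ν = 0 := by
    refine hc _ ?_ (memLp_comp_of_bounded hφc' hφc hVkm 2)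
    exact FreeAt.resample_self (Ψ := fun s => φ (V s))
      (freeAt_inr_comp_inl k (fun x => φ (r * ∑ j ∈ Finset.univ.erase k, g j x)))
  have hWV : ∀ s, W s = V s + r * G k s := fun s => by
    simp only [hW, hV, hG, ← mul_add]
    rw [Finset.sum_erase_add _ _ (Finset.mem_univ k)]
  have hVD : ∀ s, V s - V (resample k s) = r * D s := fun s => by
    simp only [hV, hDd, Finset.sum_sub_distrib]; ring
  have i1 : Integrable (fun s => G k s * φ (W s)) (pathMeasure ι ν) :=
    hg2.memLp.integrable_mul (memLp_comp_of_bounded hφc' hφc hWm 2)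
  have i2 : Integrable (fun s => G k s * φ (V (resample k s))) (pathMeasure ι ν) :=
    hg2.memLp.integrable_mul (memLp_comp_of_bounded hφc' hφc hVkm 2)
  have i3 : Integrable (fun s => r * (G k s ^ 2 * φ' (W s))) (pathMeasure ι ν) := by
    have := hgsq.memLp.integrable_mul (memLp_comp_of_bounded hφ'c hφL hWm 2)
    simp only [pow_two]
    exact this.const_mul r
  have b3 : LpBound 1 (pathMeasure ι ν) (fun s => G k s * (G k s * G k s)) (a * (a * a)) :=
    hg2.mul hgsq ha
  have bD : LpBound 1 (pathMeasure ι ν) (fun s => G k s * D s) (a * δ) := hg2.mul hD ha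
  have hpt : ∀ s, |G k s * φ (W s) - G k s * φ (V (resample k s)) - r * (G k s ^ 2 * φ' (W s))|
      ≤ M * r ^ 2 * |G k s * (G k s * G k s)| + L * r * |G k s * D s| := by
    intro s
    have t1 := abs_taylor_le hM hφ hφM (W s) (V s)
    have t2 := abs_sub_le_of_deriv hφ hφL (V s) (V (resample k s))
    have e1 : V s - W s = -(r * G k s) := by rw [hWV]; ring
    rw [e1] at t1
    rw [hVD, abs_mul, abs_of_nonneg hr] at t2
    have e : G k s * φ (W s) - G k s * φ (V (resample k s)) - r * (G k s ^ 2 * φ' (W s))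
        = -(G k s * (φ (V s) - φ (W s) - -(r * G k s) * φ' (W s)))
          + G k s * (φ (V s) - φ (V (resample k s))) := by ring
    rw [e]
    refine (abs_add_le _ _).trans ?_
    have h0 := abs_nonneg (G k s)
    have hG3 : |G k s * (G k s * G k s)| = |G k s| * G k s ^ 2 := by
      rw [abs_mul, abs_mul_self, pow_two]
    rw [abs_neg, abs_mul (G k s), abs_mul (G k s) (φ (V s) - φ (V (resample k s))), hG3,
      abs_mul (G k s) (D s)]
    calc _ ≤ |G k s| * (M * (-(r * G k s)) ^ 2) + |G k s| * (L * (r * |D s|)) :=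
          add_le_add (mul_le_mul_of_nonneg_left t1 h0) (mul_le_mul_of_nonneg_left t2 h0)
      _ = _ := by ring
  calc _ = |∫ s, (G k s * φ (W s) - G k s * φ (V (resample k s))
            - r * (G k s ^ 2 * φ' (W s))) ∂pathMeasure ι ν| := by
        have i12 : Integrable (fun s => G k s * φ (W s) - G k s * φ (V (resample k s)))
          (pathMeasure ι ν) := i1.sub i2
        rw [integral_sub i12 i3, integral_sub i1 i2, hzero, sub_zero]
    _ ≤ ∫ s, (M * r ^ 2 * |G k s * (G k s * G k s)| + L * r * |G k s * D s|)
          ∂pathMeasure ι ν :=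
        abs_integral_le_integral_abs.trans (integral_mono ((i1.sub i2).sub i3).abs
          ((b3.integrable.abs.const_mul _).add (bD.integrable.abs.const_mul _)) hpt)
    _ = M * r ^ 2 * (∫ s, |G k s * (G k s * G k s)| ∂pathMeasure ι ν)
          + L * r * ∫ s, |G k s * D s| ∂pathMeasure ι ν := by
        rw [integral_add (b3.integrable.abs.const_mul _) (bD.integrable.abs.const_mul _),
          integral_const_mul, integral_const_mul]
    _ ≤ M * r ^ 2 * (a * (a * a)) + L * r * (a * δ) := by
        gcongr
        · exact b3.integral_abs_le (by positivity)
        · exact bD.integral_abs_le (by positivity)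
    _ = _ := by ring

/-- Stein's method for a normalized sum of functions, each centered in its own observation and
stable with respect to the other ones. -/
theorem abs_integral_stein_le {g : ι → (ι → 𝒳) → ℝ} {a d e L M : ℝ} (ha : 0 ≤ a) (hd : 0 ≤ d)
    (he : 0 ≤ e) (hL : 0 ≤ L) (hM : 0 ≤ M) (hn : 0 < Fintype.card ι)
    (hg : ∀ k, LpBound 4 (pathMeasure ι ν) (fun s => g k (s ∘ Sum.inl)) a)
    (hc : ∀ k, CenteredAt ν k (fun s => g k (s ∘ Sum.inl)))
    (h1 : ∀ i k, i ≠ k → LpBound 4 (pathMeasure ι ν)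
      (fun s => g k (s ∘ Sum.inl) - g k (resample i s ∘ Sum.inl)) d)
    (h2 : ∀ i l k, i ≠ k → l ≠ k → i ≠ l → LpBound 2 (pathMeasure ι ν)
      (fun s => g k (s ∘ Sum.inl) - g k (resample i s ∘ Sum.inl)
        - (g k (resample l s ∘ Sum.inl) - g k (resample i (resample l s) ∘ Sum.inl))) e)
    {φ φ' : ℝ → ℝ} (hφ : ∀ w, HasDerivAt φ (φ' w) w) {c : ℝ} (hφc : ∀ w, |φ w| ≤ c)
    (hφL : ∀ w, |φ' w| ≤ L) (hφM : ∀ w v, |φ' w - φ' v| ≤ M * |w - v|) (t : ℝ) :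
    |∫ s, (t * φ' ((√(Fintype.card ι : ℝ))⁻¹ * ∑ k, g k (s ∘ Sum.inl))
        - ((√(Fintype.card ι : ℝ))⁻¹ * ∑ k, g k (s ∘ Sum.inl))
          * φ ((√(Fintype.card ι : ℝ))⁻¹ * ∑ k, g k (s ∘ Sum.inl))) ∂pathMeasure ι ν|
      ≤ L * (4 * a ^ 2 / √(Fintype.card ι : ℝ) + 2 * √(Fintype.card ι : ℝ) * (a * d)
            + |(Fintype.card ι : ℝ)⁻¹ * ∑ k, (∫ s, g k (s ∘ Sum.inl) ^ 2 ∂pathMeasure ι ν) - t|)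
        + M * a ^ 3 / √(Fintype.card ι : ℝ)
        + L * (a * (√(Fintype.card ι : ℝ) * d + Fintype.card ι * e)) := by
  set n : ℝ := ((Fintype.card ι : ℕ) : ℝ) with hnd
  have hn0 : 0 < n := by rw [hnd]; exact_mod_cast hn
  have hs0 : 0 < √n := Real.sqrt_pos.2 hn0
  have hss : √n * √n = n := Real.mul_self_sqrt hn0.le
  set r : ℝ := (√n)⁻¹ with hr
  have hr0 : 0 < r := by positivity
  have hrr : r * r = n⁻¹ := by rw [hr, ← mul_inv, hss]
  set δ : ℝ := √n * d + n * e with hδ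
  have hδ0 : 0 ≤ δ := by positivity
  have hφc' : Continuous φ := continuous_iff_continuousAt.2 fun x => (hφ x).continuousAt
  have hφ'c : Continuous φ' := continuous_of_abs_sub_le hφM
  have hg2 : ∀ k, LpBound 2 (pathMeasure ι ν) (fun s => g k (s ∘ Sum.inl)) a := fun k =>
    (hg k).mono_exponent (by norm_num)
  have hgsq : ∀ k, LpBound 2 (pathMeasure ι ν) (fun s => g k (s ∘ Sum.inl) ^ 2) (a * a) :=
    fun k => by simpa only [pow_two] using (hg k).mul (hg k) ha (r := 2)
  set W : (ι ⊕ ι → 𝒳) → ℝ := fun s => r * ∑ j, g j (s ∘ Sum.inl) with hW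
  have hWm : AEStronglyMeasurable W (pathMeasure ι ν) :=
    (Finset.aestronglyMeasurable_fun_sum Finset.univ fun j _ => (hg j).aesm).const_mul r
  have hD : ∀ k, LpBound 2 (pathMeasure ι ν) (fun s => ∑ j ∈ Finset.univ.erase k,
        (g j (s ∘ Sum.inl) - g j (resample k s ∘ Sum.inl))) δ := fun k => by
    refine LpBound.of_integral_sq_le ?_ hδ0 ((integral_sum_diff_sq_le hd he
      (fun k => (hg2 k).memLp) hc (fun i k hik => (h1 i k hik).mono_exponent (by norm_num))
      h2 k).trans ?_)
    · exact memLp_finsetSum _ fun j _ => (hg2 j).memLp.sub (MemLp.resample k (hg2 j).memLp)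
    · have : δ ^ 2 = (√n * √n) * d ^ 2 + n ^ 2 * e ^ 2 + 2 * (√n * d) * (n * e) := by
        rw [hδ]; ring
      rw [this, hss]
      have : 0 ≤ 2 * (√n * d) * (n * e) := by positivity
      linarith
  have hφW : MemLp (fun s => φ (W s)) 2 (pathMeasure ι ν) :=
    memLp_comp_of_bounded hφc' hφc hWm 2
  have hφ'W : MemLp (fun s => φ' (W s)) 2 (pathMeasure ι ν) :=
    memLp_comp_of_bounded hφ'c hφL hWm 2
  have ig : ∀ k, Integrable (fun s => g k (s ∘ Sum.inl) * φ (W s)) (pathMeasure ι ν) := fun k =>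
    (hg2 k).memLp.integrable_mul hφW
  have igs : ∀ k, Integrable (fun s => r * (g k (s ∘ Sum.inl) ^ 2 * φ' (W s)))
      (pathMeasure ι ν) := fun k => ((hgsq k).memLp.integrable_mul hφ'W).const_mul r
  set Z : (ι ⊕ ι → 𝒳) → ℝ := fun s => n⁻¹ * ∑ k, g k (s ∘ Sum.inl) ^ 2 with hZ
  have hZ2 : MemLp Z 2 (pathMeasure ι ν) :=
    (memLp_finsetSum Finset.univ fun k _ => (hgsq k).memLp).const_mul n⁻¹
  have hZ1 : Integrable Z (pathMeasure ι ν) := hZ2.integrable (by norm_num)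
  have hZm : ∫ s, Z s ∂pathMeasure ι ν
      = n⁻¹ * ∑ k, (∫ s, g k (s ∘ Sum.inl) ^ 2 ∂pathMeasure ι ν) := by
    simp only [hZ]
    rw [integral_const_mul, integral_finsetSum _ fun k _ => (hgsq k).memLp.integrable (by norm_num)]
  -- the summands of `𝔼[W φ(W)]`
  have hsum : |(∫ s, W s * φ (W s) ∂pathMeasure ι ν) - ∫ s, Z s * φ' (W s) ∂pathMeasure ι ν|
      ≤ M * a ^ 3 / √n + L * (a * δ) := by
    have e1 : ∫ s, W s * φ (W s) ∂pathMeasure ι ν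
        = r * ∑ k, ∫ s, g k (s ∘ Sum.inl) * φ (W s) ∂pathMeasure ι ν := by
      rw [← integral_finsetSum _ fun k _ => ig k, ← integral_const_mul]
      congr 1; funext s
      rw [← Finset.sum_mul, ← mul_assoc]
    have e2 : ∫ s, Z s * φ' (W s) ∂pathMeasure ι ν
        = r * ∑ k, ∫ s, r * (g k (s ∘ Sum.inl) ^ 2 * φ' (W s)) ∂pathMeasure ι ν := by
      rw [← integral_finsetSum _ fun k _ => igs k, ← integral_const_mul]
      congr 1; funext s
      rw [← Finset.mul_sum, ← Finset.sum_mul, ← mul_assoc, ← mul_assoc, hrr]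
    rw [e1, e2, ← mul_sub, ← Finset.sum_sub_distrib, abs_mul, abs_of_pos hr0]
    calc _ ≤ r * ∑ _k : ι, (M * r ^ 2 * a ^ 3 + L * r * (a * δ)) := by
          gcongr
          exact (Finset.abs_sum_le_sum_abs _ _).trans (Finset.sum_le_sum fun k _ =>
            abs_integral_summand_le ha hδ0 hr0.le hL hM hg (hc k) (hD k) hφ hφc hφL hφM)
      _ = (n * (r * r)) * (M * a ^ 3 * r + L * (a * δ)) := by
          simp only [Finset.sum_const, Finset.card_univ, nsmul_eq_mul, ← hnd]; ring
      _ = M * a ^ 3 / √n + L * (a * δ) := by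
          rw [hrr, mul_inv_cancel₀ hn0.ne', one_mul, hr, div_eq_mul_inv]
  have hconc := integral_abs_sub_mean_sq_le ha hd hn hg h1
  have hvar : |∫ s, (t - Z s) * φ' (W s) ∂pathMeasure ι ν|
      ≤ L * (4 * a ^ 2 / √n + 2 * √n * (a * d) + |(∫ s, Z s ∂pathMeasure ι ν) - t|) := by
    calc |∫ s, (t - Z s) * φ' (W s) ∂pathMeasure ι ν|
        ≤ ∫ s, L * (|Z s - ∫ s', Z s' ∂pathMeasure ι ν|
            + |(∫ s', Z s' ∂pathMeasure ι ν) - t|) ∂pathMeasure ι ν := by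
          refine abs_integral_le_integral_abs.trans (integral_mono
            (((memLp_const t).sub hZ2).integrable_mul hφ'W).abs
            (((hZ1.sub (integrable_const _)).abs.add (integrable_const _)).const_mul L)
            fun s => ?_)
          simp only [abs_mul]
          rw [mul_comm]
          refine mul_le_mul (hφL _) ?_ (abs_nonneg _) hL
          rw [abs_sub_comm]
          exact abs_sub_le _ _ _
      _ = L * ((∫ s, |Z s - ∫ s', Z s' ∂pathMeasure ι ν| ∂pathMeasure ι ν)
            + |(∫ s', Z s' ∂pathMeasure ι ν) - t|) := by
          have j1 : Integrable (fun s => |Z s - ∫ s', Z s' ∂pathMeasure ι ν|)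
            (pathMeasure ι ν) := (hZ1.sub (integrable_const _)).abs
          rw [integral_const_mul, integral_add j1 (integrable_const _)]
          simp
      _ ≤ _ := by gcongr
  have hsplit : ∫ s, (t * φ' (W s) - W s * φ (W s)) ∂pathMeasure ι ν
      = (∫ s, (t - Z s) * φ' (W s) ∂pathMeasure ι ν)
        - ((∫ s, W s * φ (W s) ∂pathMeasure ι ν) - ∫ s, Z s * φ' (W s) ∂pathMeasure ι ν) := by
    have hW2 : MemLp W 2 (pathMeasure ι ν) :=
      (memLp_finsetSum Finset.univ fun k _ => (hg2 k).memLp).const_mul r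
    have j1 : Integrable (fun s => (t - Z s) * φ' (W s)) (pathMeasure ι ν) :=
      ((memLp_const t).sub hZ2).integrable_mul hφ'W
    have j2 : Integrable (fun s => W s * φ (W s)) (pathMeasure ι ν) := hW2.integrable_mul hφW
    have j3 : Integrable (fun s => Z s * φ' (W s)) (pathMeasure ι ν) := hZ2.integrable_mul hφ'W
    have j4 : Integrable (fun s => W s * φ (W s) - Z s * φ' (W s)) (pathMeasure ι ν) := j2.sub j3
    rw [← integral_sub j2 j3, ← integral_sub j1 j4]
    congr 1; funext s; ring
  rw [hsplit]
  rw [hZm] at hvar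
  refine (abs_sub _ _).trans ?_
  linarith

end SteinBound

/-! ### Centering in one observation -/

theorem measurable_comp_inl {ι 𝒳 : Type*} [MeasurableSpace 𝒳] {u : (ι → 𝒳) → ℝ}
    (hu : Measurable u) : Measurable (fun s : ι ⊕ ι → 𝒳 => u (s ∘ Sum.inl)) :=
  hu.comp (measurable_pi_lambda _ fun i => measurable_pi_apply (Sum.inl i))

section Centering

variable {ι 𝒳 : Type*} [DecidableEq ι] [MeasurableSpace 𝒳] (ν : Measure 𝒳)

/-- `u` minus its conditional mean given all the observations but the `k`-th one. -/
def centering (k : ι) (u : (ι → 𝒳) → ℝ) (x : ι → 𝒳) : ℝ :=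
  u x - condMean ν k u x

theorem condMean_comp_inl (k : ι) (u : (ι → 𝒳) → ℝ) (s : ι ⊕ ι → 𝒳) :
    condMean ν (Sum.inl k) (fun s => u (s ∘ Sum.inl)) s = condMean ν k u (s ∘ Sum.inl) := by
  have e : ∀ c, Function.update s (Sum.inl k) c ∘ Sum.inl = Function.update (s ∘ Sum.inl) k c :=
    fun c => Function.update_comp_eq_of_injective _ Sum.inl_injective _ _
  simp only [condMean, e]

theorem condMean_resample {k i : ι} (hki : k ≠ i) (U : (ι ⊕ ι → 𝒳) → ℝ) (s : ι ⊕ ι → 𝒳) :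
    condMean ν (Sum.inl k) (fun s => U (resample i s)) s
      = condMean ν (Sum.inl k) U (resample i s) :=
  condMean_comp_perm ν (Equiv.swap (Sum.inl i) (Sum.inr i))
    (Equiv.swap_apply_of_ne_of_ne (by simpa using hki) (by simp)) U s

variable [Fintype ι] {ν} [IsProbabilityMeasure ν] {u : (ι → 𝒳) → ℝ} {p : ℝ≥0∞} {a : ℝ} {k : ι}

theorem LpBound.sub_condMean (hp : 1 ≤ p) (hp' : p ≠ ∞) (ha : 0 ≤ a) {U : (ι ⊕ ι → 𝒳) → ℝ}
    (hU : Measurable U) (h : LpBound p (pathMeasure ι ν) U a) :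
    LpBound p (pathMeasure ι ν) (fun s => U s - CrossVal.condMean ν (Sum.inl k) U s) (2 * a) := by
  rw [two_mul]
  exact h.sub (LpBound.condMean ν hp hp' (Sum.inl k) hU h) hp ha ha

theorem lpBound_centering (hp : 1 ≤ p) (hp' : p ≠ ∞) (ha : 0 ≤ a) (hu : Measurable u)
    (h : LpBound p (pathMeasure ι ν) (fun s => u (s ∘ Sum.inl)) a) :
    LpBound p (pathMeasure ι ν) (fun s => centering ν k u (s ∘ Sum.inl)) (2 * a) := by
  simp only [centering, ← condMean_comp_inl]
  exact LpBound.sub_condMean hp hp' ha (measurable_comp_inl hu) h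

theorem lpBound_centering_diff {i : ι} (hki : k ≠ i) (hp : 1 ≤ p) (hp' : p ≠ ∞) (ha : 0 ≤ a)
    (hu : Measurable u) (hi : Integrable (fun s => u (s ∘ Sum.inl)) (pathMeasure ι ν))
    (h : LpBound p (pathMeasure ι ν)
      (fun s => u (s ∘ Sum.inl) - u (resample i s ∘ Sum.inl)) a) :
    LpBound p (pathMeasure ι ν) (fun s => centering ν k u (s ∘ Sum.inl)
      - centering ν k u (resample i s ∘ Sum.inl)) (2 * a) := by
  set U : (ι ⊕ ι → 𝒳) → ℝ := fun s => u (s ∘ Sum.inl) with hU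
  have hUm : Measurable U := measurable_comp_inl hu
  have hrm := (measurePreserving_resample (𝒳 := 𝒳) ν i).measurable
  have hir : Integrable (fun s => U (resample i s)) (pathMeasure ι ν) :=
    (measurePreserving_resample ν i).integrable_comp_of_integrable hi
  refine (LpBound.sub_condMean (k := k) hp hp' ha (hUm.sub (hUm.comp hrm)) h).congr ?_
  filter_upwards [condMean_sub_ae ν (Sum.inl k) hi hir] with s hs
  have e1 := condMean_resample ν hki U s
  simp only [centering, ← condMean_comp_inl]
  change _ - condMean ν (Sum.inl k) (fun s => U s - U (resample i s)) s = _
  rw [hs, e1]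
  simp only [hU]
  change u _ - u _ - _ = _
  ring

theorem lpBound_centering_diff₂ {i l : ι} (hki : k ≠ i) (hkl : k ≠ l) (hp : 1 ≤ p) (hp' : p ≠ ∞)
    (ha : 0 ≤ a) (hu : Measurable u)
    (hi : Integrable (fun s => u (s ∘ Sum.inl)) (pathMeasure ι ν))
    (h : LpBound p (pathMeasure ι ν)
      (fun s => u (s ∘ Sum.inl) - u (resample i s ∘ Sum.inl)
        - (u (resample l s ∘ Sum.inl) - u (resample i (resample l s) ∘ Sum.inl))) a) :
    LpBound p (pathMeasure ι ν) (fun s => centering ν k u (s ∘ Sum.inl)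
      - centering ν k u (resample i s ∘ Sum.inl)
      - (centering ν k u (resample l s ∘ Sum.inl)
        - centering ν k u (resample i (resample l s) ∘ Sum.inl))) (2 * a) := by
  set U : (ι ⊕ ι → 𝒳) → ℝ := fun s => u (s ∘ Sum.inl) with hU
  set V : (ι ⊕ ι → 𝒳) → ℝ := fun s => U s - U (resample i s) with hV
  have hUm : Measurable U := measurable_comp_inl hu
  have hri := measurePreserving_resample (𝒳 := 𝒳) ν i
  have hrl := measurePreserving_resample (𝒳 := 𝒳) ν l
  have hir : Integrable (fun s => U (resample i s)) (pathMeasure ι ν) :=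
    hri.integrable_comp_of_integrable hi
  have hVm : Measurable V := hUm.sub (hUm.comp hri.measurable)
  have hVi : Integrable V (pathMeasure ι ν) := hi.sub hir
  have hVr : Integrable (fun s => V (resample l s)) (pathMeasure ι ν) :=
    hrl.integrable_comp_of_integrable hVi
  refine (LpBound.sub_condMean (k := k) hp hp' ha (hVm.sub (hVm.comp hrl.measurable)) h).congr ?_
  have hae := condMean_sub_ae ν (Sum.inl k) hi hir
  filter_upwards [condMean_sub_ae ν (Sum.inl k) hVi hVr, hae,
    hrl.quasiMeasurePreserving.ae hae] with s hs hs1 hs2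
  have e0 := condMean_resample ν hkl V s
  have e1 := condMean_resample ν hki U s
  have e2 := condMean_resample ν hki U (resample l s)
  simp only [centering, ← condMean_comp_inl]
  change _ - condMean ν (Sum.inl k) (fun s => V s - V (resample l s)) s = _
  rw [hs, e0]
  change _ - (condMean ν (Sum.inl k) (fun s => U s - U (resample i s)) s
    - condMean ν (Sum.inl k) (fun s => U s - U (resample i s)) (resample l s)) = _
  rw [hs1, hs2, e1, e2]
  simp only [hU]
  change u _ - u _ - (u _ - u _) - _ = _
  ring

theorem centeredAt_centering (hu : Measurable u)
    (h : LpBound 2 (pathMeasure ι ν) (fun s => u (s ∘ Sum.inl)) a) :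
    CenteredAt ν k (fun s => centering ν k u (s ∘ Sum.inl)) := fun Ψ hΨ hΨ2 => by
  have hc := LpBound.condMean ν (by norm_num) (by norm_num) (Sum.inl k) (measurable_comp_inl hu) h
  have i1 : Integrable (fun s => u (s ∘ Sum.inl) * Ψ s) (pathMeasure ι ν) :=
    h.memLp.integrable_mul hΨ2
  have i2 : Integrable (fun s => condMean ν (Sum.inl k) (fun s => u (s ∘ Sum.inl)) s * Ψ s)
    (pathMeasure ι ν) := hc.memLp.integrable_mul hΨ2
  simp only [centering, ← condMean_comp_inl, sub_mul]
  rw [integral_sub i1 i2, integral_mul_eq_condMean_mul ν (Sum.inl k) hΨ i1, sub_self]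

end Centering

section NormalApproximation

variable {ι 𝒳 : Type*} [DecidableEq ι] [Fintype ι] [MeasurableSpace 𝒳] {ν : Measure 𝒳}
  [IsProbabilityMeasure ν]

/-- Normal approximation, for a 1-Lipschitz test function, of the normalized sum of the functions
`u k` of the observations, the `k`-th one being centered in the `k`-th observation. -/
theorem abs_integral_lipschitz_sub_le {u : ι → (ι → 𝒳) → ℝ} (hu : ∀ k, Measurable (u k))
    {a d e : ℝ} (ha : 0 ≤ a) (hd : 0 ≤ d) (he : 0 ≤ e) (hn : 0 < Fintype.card ι)
    (hU : ∀ k, LpBound 4 (pathMeasure ι ν) (fun s => u k (s ∘ Sum.inl)) a)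
    (h1 : ∀ i k, i ≠ k → LpBound 4 (pathMeasure ι ν)
      (fun s => u k (s ∘ Sum.inl) - u k (resample i s ∘ Sum.inl)) (d / √(Fintype.card ι : ℝ)))
    (h2 : ∀ i l k, i ≠ k → l ≠ k → i ≠ l → LpBound 4 (pathMeasure ι ν)
      (fun s => u k (s ∘ Sum.inl) - u k (resample i s ∘ Sum.inl)
        - (u k (resample l s ∘ Sum.inl) - u k (resample i (resample l s) ∘ Sum.inl)))
      (e / Fintype.card ι))
    {h : ℝ → ℝ} (hh : LipschitzWith 1 h) {σ : ℝ≥0} (hσ : 0 < σ) :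
    |(∫ s, h ((√(Fintype.card ι : ℝ))⁻¹ * ∑ k, centering ν k (u k) (s ∘ Sum.inl))
          ∂pathMeasure ι ν) - ∫ y, h y ∂gaussianReal 0 (σ ^ 2)|
      ≤ 1 / σ * (16 * a ^ 2 / √(Fintype.card ι : ℝ) + 12 * (a * d) + 4 * (a * e)
            + |(Fintype.card ι : ℝ)⁻¹
                * ∑ k, (∫ s, centering ν k (u k) (s ∘ Sum.inl) ^ 2 ∂pathMeasure ι ν)
              - (σ : ℝ) ^ 2|)
        + 64 * a ^ 3 / (σ ^ 2 * √(Fintype.card ι : ℝ)) := by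
  have hs : (0 : ℝ) < σ := hσ
  obtain ⟨φ, φ', hφ, hφc, hφL, hφM, hstein⟩ := exists_stein_solution hh hσ
  have hi : ∀ k, Integrable (fun s => u k (s ∘ Sum.inl)) (pathMeasure ι ν) := fun k =>
    ((hU k).mono_exponent (q := 1) (by norm_num)).integrable
  have hn0 : (0 : ℝ) < Fintype.card ι := by exact_mod_cast hn
  set n : ℝ := ((Fintype.card ι : ℕ) : ℝ) with hnd
  have hs0 : 0 < √n := Real.sqrt_pos.2 hn0
  have hg : ∀ k, LpBound 4 (pathMeasure ι ν) (fun s => centering ν k (u k) (s ∘ Sum.inl))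
      (2 * a) := fun k =>
    lpBound_centering (by norm_num) (by norm_num) ha (hu k) (hU k)
  have key := abs_integral_stein_le (ν := ν) (g := fun k => centering ν k (u k)) (a := 2 * a)
    (d := 2 * (d / √n)) (e := 2 * (e / n)) (L := 1 / σ) (M := 8 / (σ : ℝ) ^ 2) (by positivity)
    (by positivity) (by positivity) (by positivity) (by positivity) hn hg
    (fun k => centeredAt_centering (hu k) ((hU k).mono_exponent (by norm_num)))
    (fun i k hik => lpBound_centering_diff hik.symm (by norm_num) (by norm_num) (by positivity)
      (hu k) (hi k) (h1 i k hik))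
    (fun i l k hik hlk hil => (lpBound_centering_diff₂ hik.symm hlk.symm (by norm_num)
      (by norm_num) (by positivity) (hu k) (hi k) (h2 i l k hik hlk hil)).mono_exponent
        (by norm_num))
    hφ hφc hφL hφM ((σ : ℝ) ^ 2)
  simp only [hstein] at key
  have hW : Integrable (fun s => (√n)⁻¹ * ∑ k, centering ν k (u k) (s ∘ Sum.inl))
      (pathMeasure ι ν) :=
    (integrable_finsetSum _ fun k _ =>
      ((hg k).mono_exponent (q := 1) (by norm_num)).integrable).const_mul _
  have hhW : Integrable (fun s => h ((√n)⁻¹ * ∑ k, centering ν k (u k) (s ∘ Sum.inl)))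
      (pathMeasure ι ν) := by
    refine Integrable.mono' (hW.abs.add (integrable_const |h 0|))
      (hh.continuous.comp_aestronglyMeasurable hW.aestronglyMeasurable) (ae_of_all _ fun s => ?_)
    have h3 := hh.dist_le_mul ((√n)⁻¹ * ∑ k, centering ν k (u k) (s ∘ Sum.inl)) 0
    rw [Real.dist_eq, Real.dist_eq, sub_zero, NNReal.coe_one, one_mul] at h3
    have h4 := abs_sub_abs_le_abs_sub (h ((√n)⁻¹ * ∑ k, centering ν k (u k) (s ∘ Sum.inl))) (h 0)
    rw [Real.norm_eq_abs]
    simp only [Pi.add_apply]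
    linarith
  rw [integral_sub hhW (integrable_const _)] at key
  simp only [integral_const, probReal_univ, one_smul] at key
  refine key.trans (le_of_eq ?_)
  have e1 : √n * (d / √n) = d := by field_simp
  have e2 : n * (e / n) = e := by field_simp
  calc _ = 1 / σ * (16 * a ^ 2 / √n + 8 * (a * (√n * (d / √n))) + |n⁻¹ * ∑ k, (∫ s, centering ν k
            (u k) (s ∘ Sum.inl) ^ 2 ∂pathMeasure ι ν) - (σ : ℝ) ^ 2|)
          + 8 / (σ : ℝ) ^ 2 * (2 * a) ^ 3 / √n
          + 1 / σ * (4 * (a * (√n * (d / √n))) + 4 * (a * (n * (e / n)))) := by ring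
    _ = _ := by
      rw [e1, e2]
      field_simp
      ring

end NormalApproximation

/-! ### The losses of cross-validation as functions of the observations -/

section TrainingSets

variable {n K : ℕ}

/-- The increasing enumeration of the training set of the `j`-th fold. -/
def trainEmb (b : Fin n → Fin K) (j : Fin K) : Fin (trainSize b j) → Fin n :=
  (trainSet b j).orderEmbOfFin rfl

theorem trainEmb_injective (b : Fin n → Fin K) (j : Fin K) : Function.Injective (trainEmb b j) :=
  ((trainSet b j).orderEmbOfFin rfl).injective

theorem trainEmb_ne (b : Fin n → Fin K) (k : Fin n) (m : Fin (trainSize b (b k))) :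
    trainEmb b (b k) m ≠ k := fun h => by
  have := (trainSet b (b k)).orderEmbOfFin_mem rfl m
  rw [show (trainSet b (b k)).orderEmbOfFin rfl m = k from h] at this
  simp [trainSet, fold] at this

theorem trainSize_mem (b : Fin n → Fin K) (j : Fin K) : trainSize b j ∈ trainSizes b :=
  Finset.mem_image_of_mem _ (Finset.mem_univ j)

/-- A permutation with prescribed values at two points. -/
theorem exists_perm_apply_eq {α : Type*} [DecidableEq α] {z o a c : α} (hzo : z ≠ o)
    (hac : a ≠ c) : ∃ π : Equiv.Perm α, π z = a ∧ π o = c := by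
  refine ⟨Equiv.swap z a * Equiv.swap o (Equiv.swap z a c), ?_, ?_⟩
  · have h : z ≠ Equiv.swap z a c := fun h => hac (by
      have := congrArg (Equiv.swap z a) h
      rwa [Equiv.swap_apply_left, Equiv.swap_apply_self] at this)
    rw [Equiv.Perm.mul_apply, Equiv.swap_apply_of_ne_of_ne hzo h, Equiv.swap_apply_left]
  · rw [Equiv.Perm.mul_apply, Equiv.swap_apply_left, Equiv.swap_apply_self]

end TrainingSets

section Differences

variable {𝒳 𝒴 : Type*} {l : ℕ} (L : 𝒳 → 𝒴 → ℝ) (fl : (Fin l → 𝒳) → 𝒴)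

/-- The loss at the test point `r (inr (inr ()))` of the estimator trained on the `l` observations
`r (inl m)`; the entries `r (inr (inl m))` are copies of the latter, for resampling. -/
def lossAt (r : Fin l ⊕ Fin l ⊕ Unit → 𝒳) : ℝ :=
  L (r (Sum.inr (Sum.inr ()))) (fl (r ∘ Sum.inl))

/-- The path `r` with the `z`-th training observation replaced by its copy. -/
def replaceAt (z : Fin l) (r : Fin l ⊕ Fin l ⊕ Unit → 𝒳) : Fin l ⊕ Fin l ⊕ Unit → 𝒳 :=
  Function.update r (Sum.inl z) (r (Sum.inr (Sum.inl z)))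

/-- The first-order difference of the loss in the `z`-th training observation. -/
def firstDiff (z : Fin l) (r : Fin l ⊕ Fin l ⊕ Unit → 𝒳) : ℝ :=
  lossAt L fl r - lossAt L fl (replaceAt z r)

/-- The second-order difference of the loss in the training observations `z` and `o`. -/
def secondDiff (z o : Fin l) (r : Fin l ⊕ Fin l ⊕ Unit → 𝒳) : ℝ :=
  firstDiff L fl z r - firstDiff L fl z (replaceAt o r)

theorem lossAt_replaceAt (z : Fin l) (r : Fin l ⊕ Fin l ⊕ Unit → 𝒳) :
    lossAt L fl (replaceAt z r) = L (r (Sum.inr (Sum.inr ())))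
      (fl (Function.update (r ∘ Sum.inl) z (r (Sum.inr (Sum.inl z))))) := by
  simp only [lossAt, replaceAt]
  rw [Function.update_comp_eq_of_injective _ Sum.inl_injective, Function.update_of_ne (by simp)]

theorem lossAt_replaceAt_replaceAt (z o : Fin l) (r : Fin l ⊕ Fin l ⊕ Unit → 𝒳) :
    lossAt L fl (replaceAt z (replaceAt o r)) = L (r (Sum.inr (Sum.inr ())))
      (fl (Function.update (Function.update (r ∘ Sum.inl) o (r (Sum.inr (Sum.inl o)))) z
        (r (Sum.inr (Sum.inl z))))) := by
  rw [lossAt_replaceAt]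
  simp only [replaceAt]
  rw [Function.update_comp_eq_of_injective _ Sum.inl_injective, Function.update_of_ne (by simp),
    Function.update_of_ne (by simp)]

variable {L fl} [MeasurableSpace 𝒳] [MeasurableSpace 𝒴]

theorem measurable_lossAt (hL : Measurable (Function.uncurry L)) (hf : Measurable fl) :
    Measurable (lossAt L fl) := by
  have h : Measurable fun r : Fin l ⊕ Fin l ⊕ Unit → 𝒳 => r ∘ Sum.inl :=
    measurable_pi_lambda _ fun m => measurable_pi_apply (Sum.inl m)
  exact hL.comp (Measurable.prodMk (measurable_pi_apply (Sum.inr (Sum.inr ()))) (hf.comp h))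

theorem measurable_replaceAt (z : Fin l) : Measurable (replaceAt (𝒳 := 𝒳) z) := by
  refine measurable_pi_lambda _ fun i => ?_
  by_cases h : i = Sum.inl z
  · subst h; simp only [replaceAt, Function.update_self]; fun_prop
  · simp only [replaceAt, Function.update_of_ne h]; fun_prop

theorem measurable_firstDiff (hL : Measurable (Function.uncurry L)) (hf : Measurable fl)
    (z : Fin l) : Measurable (firstDiff L fl z) :=
  (measurable_lossAt hL hf).sub ((measurable_lossAt hL hf).comp (measurable_replaceAt z))

theorem measurable_secondDiff (hL : Measurable (Function.uncurry L)) (hf : Measurable fl)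
    (z o : Fin l) : Measurable (secondDiff L fl z o) :=
  (measurable_firstDiff hL hf z).sub ((measurable_firstDiff hL hf z).comp (measurable_replaceAt o))

end Differences

section Indices

/-- The inclusion of `l` training observations, their copies and the test point into the family of
all observations. -/
def sampleIndex (l : ℕ) : Fin l ⊕ Fin l ⊕ Unit → ℕ ⊕ ℕ ⊕ Unit :=
  Sum.map Fin.val (Sum.map Fin.val id)

theorem sampleIndex_injective (l : ℕ) : Function.Injective (sampleIndex l) :=
  Fin.val_injective.sumMap (Fin.val_injective.sumMap Function.injective_id)

/-- The training observations `θ m`, their copies and the test point `k`, as observations of the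
whole sample. -/
def foldIndex {n l : ℕ} (θ : Fin l → Fin n) (k : Fin n) :
    Fin l ⊕ Fin l ⊕ Unit → Fin n ⊕ Fin n :=
  Sum.elim (fun m => Sum.inl (θ m)) (Sum.elim (fun m => Sum.inr (θ m)) fun _ => Sum.inl k)

theorem foldIndex_injective {n l : ℕ} {θ : Fin l → Fin n} {k : Fin n}
    (hθ : Function.Injective θ) (hk : ∀ m, θ m ≠ k) : Function.Injective (foldIndex θ k) := by
  rintro (a | a | a) (c | c | c) h <;> simp [foldIndex] at h ⊢
  · exact hθ h
  · exact hk a h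
  · exact hθ h
  · exact hk c h.symm

/-- The inclusion of the sample and of its copies into the family of all observations. -/
def pathIndex (n : ℕ) : Fin n ⊕ Fin n → ℕ ⊕ ℕ ⊕ Unit :=
  Sum.elim (fun i => Sum.inl i) (fun i => Sum.inr (Sum.inl i))

theorem pathIndex_injective (n : ℕ) : Function.Injective (pathIndex n) := by
  rintro (a | a) (c | c) h <;> simp [pathIndex] at h ⊢ <;> exact Fin.ext h

end Indices

section Betas

variable {Ω 𝒳 𝒴 : Type*} {X X' : ℕ → Ω → 𝒳} {Xt : Ω → 𝒳} {L : 𝒳 → 𝒴 → ℝ}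
  {f : ∀ l : ℕ, (Fin l → 𝒳) → 𝒴}

theorem initial_update {l : ℕ} (z : Fin l) (x : ℕ → 𝒳) (c : 𝒳) :
    initial l (Function.update x z c) = Function.update (initial l x) z c :=
  Function.update_comp_eq_of_injective x Fin.val_injective z c

theorem initial_update_of_le {l m : ℕ} (h : l ≤ m) (x : ℕ → 𝒳) (c : 𝒳) :
    initial l (Function.update x m c) = initial l x := by
  funext i
  exact Function.update_of_ne (by have := i.2; omega) _ _

theorem beta₁_eq {l : ℕ} (hl : 0 < l) (ω : Ω) : beta₁ X X' Xt L f l ω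
    = firstDiff L (f l) ⟨0, hl⟩ (fun k => allObservations X X' Xt (sampleIndex l k) ω) := by
  simp only [firstDiff, lossAt_replaceAt, beta₁, nabla]
  have := initial_update (⟨0, hl⟩ : Fin l) (fun i => X i ω) (X' 0 ω)
  simp only at this
  rw [this]
  rfl

theorem beta₂_eq {l : ℕ} (hl : 1 < l) (ω : Ω) : beta₂ X X' Xt L f l ω
    = secondDiff L (f l) ⟨0, by omega⟩ ⟨1, hl⟩
      (fun k => allObservations X X' Xt (sampleIndex l k) ω) := by
  simp only [secondDiff, firstDiff, beta₂, nabla₂, nabla]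
  have h0 := initial_update (⟨0, by omega⟩ : Fin l) (fun i => X i ω) (X' 0 ω)
  have h1 := initial_update (⟨1, hl⟩ : Fin l) (fun i => X i ω) (X' 1 ω)
  have h01 := initial_update (⟨0, by omega⟩ : Fin l)
    (Function.update (fun i => X i ω) 1 (X' 1 ω)) (X' 0 ω)
  simp only at h0 h1 h01
  rw [h01, h0, h1, lossAt_replaceAt_replaceAt, lossAt_replaceAt, lossAt_replaceAt]
  rfl

end Betas

section Laws

theorem IsIIDWithCopies.risk_eq {Ω 𝒳 𝒴 : Type*} [MeasurableSpace Ω] [MeasurableSpace 𝒳]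
    [MeasurableSpace 𝒴] {μ : Measure Ω} {X X' : ℕ → Ω → 𝒳} {Xt : Ω → 𝒳}
    (hX : IsIIDWithCopies μ X X' Xt)
    {L : 𝒳 → 𝒴 → ℝ} (hL : Measurable (Function.uncurry L)) (y : 𝒴) :
    risk μ Xt L y = ∫ c, L c y ∂μ.map (X 0) := by
  have h : μ.map Xt = μ.map (X 0) := (hX.identDistrib (Sum.inr (Sum.inr ()))).map_eq
  have hm : Measurable Xt := hX.measurable (Sum.inr (Sum.inr ()))
  have hLy : Measurable fun c => L c y := hL.comp measurable_prodMk_right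
  rw [← h, integral_map hm.aemeasurable hLy.aestronglyMeasurable]
  rfl

variable {Ω 𝒳 : Type*} [MeasurableSpace Ω] [MeasurableSpace 𝒳] {μ : Measure Ω}
  [IsProbabilityMeasure μ] {X X' : ℕ → Ω → 𝒳} {Xt : Ω → 𝒳}

/-- Distinct members of the family of all observations are i.i.d. -/
theorem IsIIDWithCopies.measurePreserving (hX : IsIIDWithCopies μ X X' Xt) {κ : Type*} [Fintype κ]
    {e : κ → ℕ ⊕ ℕ ⊕ Unit} (he : Function.Injective e) :
    MeasurePreserving (fun ω k => allObservations X X' Xt (e k) ω) μ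
      (Measure.pi fun _ : κ => μ.map (X 0)) := by
  refine ⟨measurable_pi_lambda _ fun k => hX.measurable (e k), ?_⟩
  have h := (iIndepFun_iff_map_fun_eq_pi_map
    fun k => (hX.measurable (e k)).aemeasurable).1 (hX.indep.precomp he)
  simpa only [(hX.identDistrib _).map_eq] using h

theorem IsIIDWithCopies.isProbabilityMeasure (hX : IsIIDWithCopies μ X X' Xt) :
    IsProbabilityMeasure (μ.map (X 0)) :=
  Measure.isProbabilityMeasure_map (hX.measurable (Sum.inl 0)).aemeasurable

/-- The law of a function of `l` training observations, their copies and a test point. -/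
abbrev sampleMeasure (l : ℕ) (ν : Measure 𝒳) : Measure (Fin l ⊕ Fin l ⊕ Unit → 𝒳) :=
  Measure.pi fun _ => ν

/-- Norms of functions of the observations on the original probability space pass to the product
space. -/
theorem lpBound_of_sampleIndex (hX : IsIIDWithCopies μ X X' Xt) {l : ℕ}
    {H : (Fin l ⊕ Fin l ⊕ Unit → 𝒳) → ℝ} (hH : Measurable H) {p : ℝ≥0∞} {a : ℝ}
    (h : eLpNorm (fun ω => H (fun k => allObservations X X' Xt (sampleIndex l k) ω)) p μ
      ≤ ENNReal.ofReal a) : LpBound p (sampleMeasure l (μ.map (X 0))) H a :=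
  ⟨hH.aestronglyMeasurable, by
    rwa [← eLpNorm_comp_measurePreserving hH.aestronglyMeasurable
      (hX.measurePreserving (sampleIndex_injective l))]⟩

end Laws

section FoldLosses

variable {𝒳 𝒴 : Type*} {n K : ℕ}

/-- The loss of the `k`-th observation, as a function of the sample. -/
def foldLoss (L : 𝒳 → 𝒴 → ℝ) (f : ∀ l : ℕ, (Fin l → 𝒳) → 𝒴) (b : Fin n → Fin K) (k : Fin n)
    (x : Fin n → 𝒳) : ℝ :=
  L (x k) (f (trainSize b (b k)) (x ∘ trainEmb b (b k)))

variable {L : 𝒳 → 𝒴 → ℝ} {f : ∀ l : ℕ, (Fin l → 𝒳) → 𝒴} {b : Fin n → Fin K}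

/-- By the symmetry of the estimator, its training sample may be enumerated in any order. -/
theorem foldLoss_comp_inl
    (hsymm : ∀ (l : ℕ) (π : Equiv.Perm (Fin l)) (x : Fin l → 𝒳), f l (x ∘ π) = f l x)
    (k : Fin n) (π : Equiv.Perm (Fin (trainSize b (b k)))) (s : Fin n ⊕ Fin n → 𝒳) :
    foldLoss L f b k (s ∘ Sum.inl)
      = lossAt L (f _) (s ∘ foldIndex (trainEmb b (b k) ∘ π) k) := by
  have := hsymm _ π ((s ∘ Sum.inl) ∘ trainEmb b (b k))
  simp only [foldLoss, lossAt]
  rw [← this]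
  rfl

theorem resample_comp_foldIndex_inl {l : ℕ} {θ : Fin l → Fin n} (hθ : Function.Injective θ)
    {k : Fin n} (z : Fin l) (s : Fin n ⊕ Fin n → 𝒳) :
    (resample (θ z) s ∘ foldIndex θ k) ∘ Sum.inl
      = Function.update ((s ∘ foldIndex θ k) ∘ Sum.inl) z (s (Sum.inr (θ z))) := by
  have := congrArg (fun x => x ∘ θ) (resample_comp_inl (θ z) s)
  simp only [Function.update_comp_eq_of_injective _ hθ] at this
  exact this

theorem resample_comp_foldIndex_test {l : ℕ} {θ : Fin l → Fin n} {k : Fin n}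
    (hk : ∀ m, θ m ≠ k) (z : Fin l) (s : Fin n ⊕ Fin n → 𝒳) :
    (resample (θ z) s ∘ foldIndex θ k) (Sum.inr (Sum.inr ())) = s (Sum.inl k) := by
  have := congrFun (resample_comp_inl (θ z) s) k
  rw [Function.update_of_ne (hk z).symm] at this
  exact this

/-- Exchanging the observation `θ z` with its copy, in the whole sample, replaces the `z`-th
training observation by its copy. -/
theorem lossAt_resample {l : ℕ} {θ : Fin l → Fin n} (hθ : Function.Injective θ) {k : Fin n}
    (hk : ∀ m, θ m ≠ k) (z : Fin l) (s : Fin n ⊕ Fin n → 𝒳) :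
    lossAt L (f l) (resample (θ z) s ∘ foldIndex θ k)
      = lossAt L (f l) (replaceAt z (s ∘ foldIndex θ k)) := by
  rw [lossAt_replaceAt, lossAt, resample_comp_foldIndex_inl hθ, resample_comp_foldIndex_test hk]
  rfl

theorem lossAt_replaceAt_resample {l : ℕ} {θ : Fin l → Fin n} (hθ : Function.Injective θ)
    {k : Fin n} (hk : ∀ m, θ m ≠ k) {z o : Fin l} (hzo : z ≠ o) (s : Fin n ⊕ Fin n → 𝒳) :
    lossAt L (f l) (replaceAt z (resample (θ o) s ∘ foldIndex θ k))
      = lossAt L (f l) (replaceAt z (replaceAt o (s ∘ foldIndex θ k))) := by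
  have h : (resample (θ o) s ∘ foldIndex θ k) (Sum.inr (Sum.inl z)) = s (Sum.inr (θ z)) := by
    simp [resample, foldIndex, Equiv.swap_apply_def, hθ.ne hzo]
  rw [lossAt_replaceAt_replaceAt, lossAt_replaceAt, resample_comp_foldIndex_inl hθ,
    resample_comp_foldIndex_test hk, h]
  rfl

theorem foldLoss_resample_of_notMem {i k : Fin n} (hik : i ≠ k)
    (hi : ∀ m, trainEmb b (b k) m ≠ i) (s : Fin n ⊕ Fin n → 𝒳) :
    foldLoss L f b k (resample i s ∘ Sum.inl) = foldLoss L f b k (s ∘ Sum.inl) := by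
  have : Function.update (s ∘ Sum.inl) i (s (Sum.inr i)) ∘ trainEmb b (b k)
      = (s ∘ Sum.inl) ∘ trainEmb b (b k) := by
    funext m
    exact Function.update_of_ne (hi m) _ _
  simp only [foldLoss, resample_comp_inl]
  rw [this, Function.update_of_ne hik.symm]

variable [MeasurableSpace 𝒳]

theorem measurable_foldLoss [MeasurableSpace 𝒴] (hL : Measurable (Function.uncurry L))
    (hf : ∀ l, Measurable (f l)) (k : Fin n) : Measurable (foldLoss L f b k) := by
  have h : Measurable fun x : Fin n → 𝒳 => x ∘ trainEmb b (b k) :=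
    measurable_pi_lambda _ fun m => measurable_pi_apply (trainEmb b (b k) m)
  exact hL.comp (Measurable.prodMk (measurable_pi_apply k) ((hf _).comp h))

variable {ν : Measure 𝒳} [IsProbabilityMeasure ν] {p : ℝ≥0∞} {a : ℝ}

theorem lpBound_foldLoss
    (hsymm : ∀ (l : ℕ) (π : Equiv.Perm (Fin l)) (x : Fin l → 𝒳), f l (x ∘ π) = f l x) (k : Fin n)
    (h : LpBound p (sampleMeasure (trainSize b (b k)) ν) (lossAt L (f _)) a) :
    LpBound p (pathMeasure (Fin n) ν) (fun s => foldLoss L f b k (s ∘ Sum.inl)) a := by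
  simp only [foldLoss_comp_inl hsymm k 1]
  exact h.comp (measurePreserving_comp_injective ν
    (foldIndex_injective (trainEmb_injective b (b k)) (trainEmb_ne b k)))

/-- The permutation of the training sample that brings `i` to the first position reduces the
increment in the `i`-th observation to the one in the first training observation. It vanishes if `i`
is outside of the training set. -/
theorem lpBound_foldLoss_diff
    (hsymm : ∀ (l : ℕ) (π : Equiv.Perm (Fin l)) (x : Fin l → 𝒳), f l (x ∘ π) = f l x) {i k : Fin n}
    (hik : i ≠ k)
    (h : ∀ hl : 0 < trainSize b (b k),
      LpBound p (sampleMeasure (trainSize b (b k)) ν) (firstDiff L (f _) ⟨0, hl⟩) a) :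
    LpBound p (pathMeasure (Fin n) ν)
      (fun s => foldLoss L f b k (s ∘ Sum.inl) - foldLoss L f b k (resample i s ∘ Sum.inl)) a := by
  by_cases hi : ∃ m, trainEmb b (b k) m = i
  · obtain ⟨m, rfl⟩ := hi
    have hl : 0 < trainSize b (b k) := m.pos
    set π := Equiv.swap (⟨0, hl⟩ : Fin (trainSize b (b k))) m
    set θ := trainEmb b (b k) ∘ π with hθd
    have hθ : Function.Injective θ := (trainEmb_injective b (b k)).comp π.injective
    have hθk : ∀ m, θ m ≠ k := fun m => trainEmb_ne b k _
    have h0 : trainEmb b (b k) m = θ ⟨0, hl⟩ := by simp [hθd, π]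
    simp only [foldLoss_comp_inl hsymm k π, h0, ← hθd, lossAt_resample hθ hθk]
    exact (h hl).comp (measurePreserving_comp_injective ν (foldIndex_injective hθ hθk))
  · push Not at hi
    simp only [foldLoss_resample_of_notMem hik hi, sub_self]
    exact ⟨aestronglyMeasurable_const, by simp⟩

theorem lpBound_foldLoss_diff₂
    (hsymm : ∀ (l : ℕ) (π : Equiv.Perm (Fin l)) (x : Fin l → 𝒳), f l (x ∘ π) = f l x)
    {i j k : Fin n} (hik : i ≠ k) (hjk : j ≠ k) (hij : i ≠ j)
    (h : ∀ hl : 1 < trainSize b (b k), LpBound p (sampleMeasure (trainSize b (b k)) ν)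
      (secondDiff L (f _) ⟨0, by omega⟩ ⟨1, hl⟩) a) :
    LpBound p (pathMeasure (Fin n) ν)
      (fun s => foldLoss L f b k (s ∘ Sum.inl) - foldLoss L f b k (resample i s ∘ Sum.inl)
        - (foldLoss L f b k (resample j s ∘ Sum.inl)
          - foldLoss L f b k (resample i (resample j s) ∘ Sum.inl))) a := by
  by_cases hi : ∃ m, trainEmb b (b k) m = i
  · by_cases hj : ∃ m, trainEmb b (b k) m = j
    · obtain ⟨m, rfl⟩ := hi
      obtain ⟨m', rfl⟩ := hj
      have hmm : m ≠ m' := fun h => hij (by rw [h])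
      have hl : 1 < trainSize b (b k) := by
        have h1 := m.2
        have h2 := m'.2
        have h3 : (m : ℕ) ≠ m' := fun h => hmm (Fin.ext h)
        omega
      obtain ⟨π, hπ0, hπ1⟩ := exists_perm_apply_eq
        (z := (⟨0, by omega⟩ : Fin (trainSize b (b k)))) (o := ⟨1, hl⟩) (by simp) hmm
      set θ := trainEmb b (b k) ∘ π with hθd
      have hθ : Function.Injective θ := (trainEmb_injective b (b k)).comp π.injective
      have hθk : ∀ m, θ m ≠ k := fun m => trainEmb_ne b k _
      have h0 : trainEmb b (b k) m = θ ⟨0, by omega⟩ := by simp [hθd, hπ0]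
      have h1 : trainEmb b (b k) m' = θ ⟨1, hl⟩ := by simp [hθd, hπ1]
      have h01 : (⟨0, by omega⟩ : Fin (trainSize b (b k))) ≠ ⟨1, hl⟩ := by simp
      simp only [foldLoss_comp_inl hsymm k π, h0, h1, ← hθd, lossAt_resample hθ hθk,
        lossAt_replaceAt_resample hθ hθk h01]
      exact (h hl).comp (measurePreserving_comp_injective ν (foldIndex_injective hθ hθk))
    · push Not at hj
      simp only [resample_comm i j, foldLoss_resample_of_notMem hjk hj, sub_self]
      exact ⟨aestronglyMeasurable_const, by simp⟩
  · push Not at hi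
    simp only [foldLoss_resample_of_notMem hik hi, sub_self]
    exact ⟨aestronglyMeasurable_const, by simp⟩

end FoldLosses

/-! ### Variances and risks of the estimators -/

section Wasserstein

theorem wassersteinOne_le {P Q : Measure ℝ} (hP : Integrable (fun x : ℝ => x) P)
    (hQ : Integrable (fun x : ℝ => x) Q) {B : ℝ}
    (hB : ∀ h : ℝ → ℝ, LipschitzWith 1 h → |(∫ x, h x ∂P) - ∫ x, h x ∂Q| ≤ B) :
    wassersteinOne P Q ≤ ENNReal.ofReal B := by
  rw [wassersteinOne, if_pos ⟨hP, hQ⟩]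
  exact iSup₂_le fun h hh => ENNReal.ofReal_le_ofReal (hB h hh)

end Wasserstein

section ConditionalVariance

theorem condMean_lossAt {𝒳 𝒴 : Type*} [MeasurableSpace 𝒳] {L : 𝒳 → 𝒴 → ℝ} {l : ℕ}
    (ν : Measure 𝒳) (fl : (Fin l → 𝒳) → 𝒴) (r : Fin l ⊕ Fin l ⊕ Unit → 𝒳) :
    condMean ν (Sum.inr (Sum.inr ())) (lossAt L fl) r = ∫ c, L c (fl (r ∘ Sum.inl)) ∂ν := by
  have e : ∀ c, Function.update r (Sum.inr (Sum.inr ())) c ∘ Sum.inl = r ∘ Sum.inl := fun c => by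
    funext m; simp
  simp only [condMean, lossAt, e, Function.update_self]

variable {Ω 𝒳 𝒴 : Type*} [MeasurableSpace Ω] [MeasurableSpace 𝒳] [MeasurableSpace 𝒴]
  {μ : Measure Ω} [IsProbabilityMeasure μ] {X X' : ℕ → Ω → 𝒳} {Xt : Ω → 𝒳} {L : 𝒳 → 𝒴 → ℝ}
  {f : ∀ l : ℕ, (Fin l → 𝒳) → 𝒴} {l : ℕ}

theorem measurable_risk (ν : Measure 𝒳) [SFinite ν] (hL : Measurable (Function.uncurry L)) :
    Measurable fun y => ∫ c, L c y ∂ν :=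
  (hL.comp measurable_swap).stronglyMeasurable.integral_prod_right'.measurable

/-- Since the test point is independent of the training sample, the conditional mean of the loss
given the estimator is the risk of the estimator. -/
theorem condExp_estimatorLoss (hX : IsIIDWithCopies μ X X' Xt)
    (hL : Measurable (Function.uncurry L)) (hf : Measurable (f l))
    (hi : Integrable (lossAt L (f l)) (sampleMeasure l (μ.map (X 0)))) :
    (fun ω => ∫ c, L c (f l (initial l fun i => X i ω)) ∂μ.map (X 0)) =ᵐ[μ]
      μ[estimatorLoss X Xt L f l |
        MeasurableSpace.comap (fun ω => f l (initial l (fun i => X i ω))) inferInstance] := by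
  have := hX.isProbabilityMeasure
  set ν := μ.map (X 0) with hν
  set Y : Ω → 𝒴 := fun ω => f l (initial l fun i => X i ω) with hY
  have hmp := hX.measurePreserving (sampleIndex_injective l)
  have hYm : Measurable Y := hf.comp (measurable_pi_lambda _ fun m =>
    hX.measurable (Sum.inl (m : ℕ)))
  have hR : Measurable fun y => ∫ c, L c y ∂ν := measurable_risk ν hL
  have hgm : Measurable fun r : Fin l ⊕ Fin l ⊕ Unit → 𝒳 => f l (r ∘ Sum.inl) :=
    hf.comp (measurable_pi_lambda _ fun m => measurable_pi_apply (Sum.inl m))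
  have hci : Integrable (fun r => ∫ c, L c (f l (r ∘ Sum.inl)) ∂ν) (sampleMeasure l ν) := by
    have h := (LpBound.condMean ν le_rfl (by norm_num) (Sum.inr (Sum.inr ()))
      (a := (eLpNorm (lossAt L (f l)) 1 (sampleMeasure l ν)).toReal) (measurable_lossAt hL hf)
      ⟨hi.aestronglyMeasurable, by
        rw [ENNReal.ofReal_toReal (memLp_one_iff_integrable.2 hi).2.ne]⟩).integrable
    exact h.congr (ae_of_all _ fun r => condMean_lossAt ν (f l) r)
  have hiE : Integrable (estimatorLoss X Xt L f l) μ := hmp.integrable_comp_of_integrable hi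
  have hiR : Integrable (fun ω => ∫ c, L c (Y ω) ∂ν) μ := hmp.integrable_comp_of_integrable hci
  refine ae_eq_condExp_of_forall_setIntegral_eq hYm.comap_le hiE (fun s _ _ => hiR.integrableOn)
    ?_ (hR.comp (comap_measurable Y)).aestronglyMeasurable
  rintro s ⟨B, hB, rfl⟩ -
  have hYB : MeasurableSet (Y ⁻¹' B) := hYm hB
  set Ψ : (Fin l ⊕ Fin l ⊕ Unit → 𝒳) → ℝ := fun r => B.indicator 1 (f l (r ∘ Sum.inl)) with hΨ
  have hΨm : Measurable Ψ := (measurable_one.indicator hB).comp hgm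
  have hΨb : ∀ r, ‖Ψ r‖ ≤ 1 := fun r => by
    by_cases h : f l (r ∘ Sum.inl) ∈ B
    · simp [hΨ, Set.indicator_of_mem h]
    · simp [hΨ, Set.indicator_of_notMem h]
  have hΨf : FreeAt (Sum.inr (Sum.inr ())) Ψ := fun r c => by
    have : Function.update r (Sum.inr (Sum.inr ())) c ∘ Sum.inl = r ∘ Sum.inl := by
      funext m; simp
    simp only [hΨ, this]
  have i1 : Integrable (fun r => lossAt L (f l) r * Ψ r) (sampleMeasure l ν) :=
    hi.mul_bdd hΨm.aestronglyMeasurable (ae_of_all _ hΨb)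
  have i2 : Integrable (fun r => (∫ c, L c (f l (r ∘ Sum.inl)) ∂ν) * Ψ r) (sampleMeasure l ν) :=
    hci.mul_bdd hΨm.aestronglyMeasurable (ae_of_all _ hΨb)
  have key := integral_mul_eq_condMean_mul ν (Sum.inr (Sum.inr ())) hΨf i1
  simp only [condMean_lossAt] at key
  rw [← integral_comp_mp hmp i1.aestronglyMeasurable,
    ← integral_comp_mp hmp i2.aestronglyMeasurable] at key
  rw [← integral_indicator hYB, ← integral_indicator hYB]
  refine Eq.trans ?_ (key.symm.trans ?_)
  · congr 1
    funext ω
    by_cases h : ω ∈ Y ⁻¹' B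
    · rw [Set.indicator_of_mem h]
      have : Ψ (fun k => allObservations X X' Xt (sampleIndex l k) ω) = 1 :=
        Set.indicator_of_mem h 1
      rw [this, mul_one]; rfl
    · rw [Set.indicator_of_notMem h]
      have : Ψ (fun k => allObservations X X' Xt (sampleIndex l k) ω) = 0 :=
        Set.indicator_of_notMem h 1
      rw [this, mul_zero]
  · congr 1
    funext ω
    by_cases h : ω ∈ Y ⁻¹' B
    · rw [Set.indicator_of_mem h]
      have : Ψ (fun k => allObservations X X' Xt (sampleIndex l k) ω) = 1 :=
        Set.indicator_of_mem h 1
      rw [this, mul_one]; rfl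
    · rw [Set.indicator_of_notMem h]
      have : Ψ (fun k => allObservations X X' Xt (sampleIndex l k) ω) = 0 :=
        Set.indicator_of_notMem h 1
      rw [this, mul_zero]

/-- `σ²_l` is the variance of the loss around the risk of the estimator. -/
theorem sigmaSq_eq (hX : IsIIDWithCopies μ X X' Xt)
    (hL : Measurable (Function.uncurry L)) (hf : Measurable (f l))
    (hi : Integrable (lossAt L (f l)) (sampleMeasure l (μ.map (X 0)))) :
    sigmaSq μ X Xt L f l = ∫ r, (lossAt L (f l) r
      - ∫ c, L c (f l (r ∘ Sum.inl)) ∂μ.map (X 0)) ^ 2 ∂sampleMeasure l (μ.map (X 0)) := by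
  have := hX.isProbabilityMeasure
  have hYm : Measurable fun ω => f l (initial l fun i => X i ω) :=
    hf.comp (measurable_pi_lambda _ fun m => hX.measurable (Sum.inl (m : ℕ)))
  have hmp := hX.measurePreserving (sampleIndex_injective l)
  have hgm : Measurable fun r : Fin l ⊕ Fin l ⊕ Unit → 𝒳 => f l (r ∘ Sum.inl) :=
    hf.comp (measurable_pi_lambda _ fun m => measurable_pi_apply (Sum.inl m))
  have hm : Measurable fun r : Fin l ⊕ Fin l ⊕ Unit → 𝒳 => (lossAt L (f l) r
      - ∫ c, L c (f l (r ∘ Sum.inl)) ∂μ.map (X 0)) ^ 2 :=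
    ((measurable_lossAt hL hf).sub ((measurable_risk _ hL).comp hgm)).pow_const 2
  rw [sigmaSq, condVar, integral_condExp hYm.comap_le,
    ← integral_comp_mp hmp hm.aestronglyMeasurable]
  refine integral_congr_ae ?_
  filter_upwards [condExp_estimatorLoss hX hL hf hi] with ω hω
  simp only [Pi.pow_apply, Pi.sub_apply, ← hω]
  rfl

end ConditionalVariance

section FoldCentering

variable {𝒳 𝒴 : Type*} [MeasurableSpace 𝒳] {n K : ℕ} {L : 𝒳 → 𝒴 → ℝ}
  {f : ∀ l : ℕ, (Fin l → 𝒳) → 𝒴} {b : Fin n → Fin K}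

theorem centering_foldLoss (ν : Measure 𝒳) (k : Fin n) (x : Fin n → 𝒳) :
    centering ν k (foldLoss L f b k) x
      = foldLoss L f b k x - ∫ c, L c (f _ (x ∘ trainEmb b (b k))) ∂ν := by
  have e : ∀ c, Function.update x k c ∘ trainEmb b (b k) = x ∘ trainEmb b (b k) := fun c => by
    funext m
    exact Function.update_of_ne (trainEmb_ne b k m) _ _
  simp only [centering, condMean, foldLoss, e, Function.update_self]

theorem centering_foldLoss_comp_inl (ν : Measure 𝒳) (k : Fin n) (s : Fin n ⊕ Fin n → 𝒳) :
    centering ν k (foldLoss L f b k) (s ∘ Sum.inl)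
      = lossAt L (f _) (s ∘ foldIndex (trainEmb b (b k)) k)
        - ∫ c, L c (f _ ((s ∘ foldIndex (trainEmb b (b k)) k) ∘ Sum.inl)) ∂ν :=
  centering_foldLoss ν k _

end FoldCentering

section Risks

variable {𝒳 𝒴 : Type*} {n K : ℕ} {L : 𝒳 → 𝒴 → ℝ} {f : ∀ l : ℕ, (Fin l → 𝒳) → 𝒴}
  {b : Fin n → Fin K}

theorem weightedAverageRisk_eq (R : 𝒴 → ℝ) (x : ℕ → 𝒳) :
    weightedAverageRisk R f b x = (1 / n) * ∑ i : Fin n, R (foldEstimator f b (b i) x) := by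
  have h := Finset.sum_fiberwise (Finset.univ : Finset (Fin n)) b
    (fun i => R (foldEstimator f b (b i) x))
  rw [weightedAverageRisk, ← h]
  congr 1
  refine Finset.sum_congr rfl fun j _ => ?_
  rw [Finset.sum_congr rfl (g := fun _ => R (foldEstimator f b j x)) fun i hi => by
    rw [(Finset.mem_filter.1 hi).2]]
  simp [fold]

theorem abs_weightedAverageRisk_sub_averageRisk_le (R : 𝒴 → ℝ) (x : ℕ → 𝒳) :
    |weightedAverageRisk R f b x - averageRisk R f b x|
      ≤ ∑ j : Fin K, |((fold b j).card : ℝ) / n - 1 / K| * |R (foldEstimator f b j x)| := by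
  have e : weightedAverageRisk R f b x - averageRisk R f b x
      = ∑ j : Fin K, (((fold b j).card : ℝ) / n - 1 / K) * R (foldEstimator f b j x) := by
    rw [weightedAverageRisk, averageRisk, Finset.mul_sum, Finset.mul_sum,
      ← Finset.sum_sub_distrib]
    exact Finset.sum_congr rfl fun j _ => by ring
  rw [e]
  refine (Finset.abs_sum_le_sum_abs _ _).trans (le_of_eq ?_)
  exact Finset.sum_congr rfl fun j _ => abs_mul _ _

end Risks

/-! ### The error of cross-validation -/

section Differences

variable {𝒳 𝒴 : Type*} {l : ℕ} {L : 𝒳 → 𝒴 → ℝ} {fl : (Fin l → 𝒳) → 𝒴}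

/-- As the loss does not see the copies, replacing an observation by its copy has the same effect
as exchanging the two. The exchange, in contrast to the replacement, preserves product measures. -/
theorem lossAt_replaceAt_eq_comp_swap (z : Fin l) (r : Fin l ⊕ Fin l ⊕ Unit → 𝒳) :
    lossAt L fl (replaceAt z r)
      = lossAt L fl (r ∘ Equiv.swap (Sum.inl z) (Sum.inr (Sum.inl z))) := by
  have e : Function.update (r ∘ Sum.inl) z (r (Sum.inr (Sum.inl z)))
      = (r ∘ Equiv.swap (Sum.inl z) (Sum.inr (Sum.inl z))) ∘ Sum.inl := by
    funext m
    by_cases h : m = z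
    · subst h; simp
    · simp [h, Equiv.swap_apply_of_ne_of_ne]
  have ht : (r ∘ Equiv.swap (Sum.inl z) (Sum.inr (Sum.inl z))) (Sum.inr (Sum.inr ()))
      = r (Sum.inr (Sum.inr ())) := by
    simp [Equiv.swap_apply_of_ne_of_ne]
  rw [lossAt_replaceAt, lossAt, e, ht]

theorem firstDiff_replaceAt_eq_comp_swap {z o : Fin l} (hzo : z ≠ o)
    (r : Fin l ⊕ Fin l ⊕ Unit → 𝒳) :
    firstDiff L fl z (replaceAt o r)
      = firstDiff L fl z (r ∘ Equiv.swap (Sum.inl o) (Sum.inr (Sum.inl o))) := by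
  have e : Function.update (r ∘ Sum.inl) o (r (Sum.inr (Sum.inl o)))
      = (r ∘ Equiv.swap (Sum.inl o) (Sum.inr (Sum.inl o))) ∘ Sum.inl := by
    funext m
    by_cases h : m = o
    · subst h; simp
    · simp [h, Equiv.swap_apply_of_ne_of_ne]
  have ht : (r ∘ Equiv.swap (Sum.inl o) (Sum.inr (Sum.inl o))) (Sum.inr (Sum.inr ()))
      = r (Sum.inr (Sum.inr ())) := by
    simp [Equiv.swap_apply_of_ne_of_ne]
  have hz : (r ∘ Equiv.swap (Sum.inl o) (Sum.inr (Sum.inl o))) (Sum.inr (Sum.inl z))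
      = r (Sum.inr (Sum.inl z)) := by
    simp [Equiv.swap_apply_of_ne_of_ne, hzo]
  rw [firstDiff, firstDiff, lossAt_replaceAt_eq_comp_swap o r, lossAt_replaceAt_replaceAt,
    lossAt_replaceAt, e, ht, hz]

variable [MeasurableSpace 𝒳] {ν : Measure 𝒳} [IsProbabilityMeasure ν] {p : ℝ≥0∞} {a : ℝ}

theorem lpBound_firstDiff (hp : 1 ≤ p) (ha : 0 ≤ a)
    (h : LpBound p (sampleMeasure l ν) (lossAt L fl) a) (z : Fin l) :
    LpBound p (sampleMeasure l ν) (firstDiff L fl z) (2 * a) := by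
  have := h.sub (h.comp (measurePreserving_comp_perm ν
    (Equiv.swap (Sum.inl z) (Sum.inr (Sum.inl z))))) hp ha ha
  rw [two_mul]
  exact this.congr (ae_of_all _ fun r => by rw [firstDiff, lossAt_replaceAt_eq_comp_swap])

theorem lpBound_secondDiff (hp : 1 ≤ p) (ha : 0 ≤ a)
    (h : LpBound p (sampleMeasure l ν) (lossAt L fl) a) {z o : Fin l} (hzo : z ≠ o) :
    LpBound p (sampleMeasure l ν) (secondDiff L fl z o) (2 * a + 2 * a) := by
  have h1 := lpBound_firstDiff hp ha h z
  have := h1.sub (h1.comp (measurePreserving_comp_perm ν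
    (Equiv.swap (Sum.inl o) (Sum.inr (Sum.inl o))))) hp (by positivity) (by positivity)
  exact this.congr (ae_of_all _ fun r => by rw [secondDiff, firstDiff_replaceAt_eq_comp_swap hzo])

end Differences

section Stability

theorem abs_sigmaSq_sub_le_sigmaGap {Ω 𝒳 𝒴 : Type*} [MeasurableSpace Ω] [MeasurableSpace 𝒴]
    {μ : Measure Ω} {X : ℕ → Ω → 𝒳} {Xt : Ω → 𝒳} {L : 𝒳 → 𝒴 → ℝ} {f : ∀ l : ℕ, (Fin l → 𝒳) → 𝒴}
    {n K : ℕ} {b : Fin n → Fin K} (v : ℝ) (j : Fin K) :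
    |sigmaSq μ X Xt L f (trainSize b j) - v| ≤ sigmaGap μ X Xt L f b v :=
  le_ciSup (f := fun l : trainSizes b => |sigmaSq μ X Xt L f l - v|) (Set.finite_range _).bddAbove
    ⟨_, trainSize_mem b j⟩

variable {Ω 𝒳 𝒴 : Type*} [MeasurableSpace Ω] [MeasurableSpace 𝒳] [MeasurableSpace 𝒴]
  {μ : Measure Ω} [IsProbabilityMeasure μ] {X X' : ℕ → Ω → 𝒳} {Xt : Ω → 𝒳} {L : 𝒳 → 𝒴 → ℝ}
  {f : ∀ l : ℕ, (Fin l → 𝒳) → 𝒴} {n K : ℕ} {b : Fin n → Fin K} {s : ℝ}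

theorem eLpNorm_sampleIndex (hX : IsIIDWithCopies μ X X' Xt) {l : ℕ}
    {H : (Fin l ⊕ Fin l ⊕ Unit → 𝒳) → ℝ} (hH : Measurable H) (p : ℝ≥0∞) :
    eLpNorm (fun ω => H (fun k => allObservations X X' Xt (sampleIndex l k) ω)) p μ
      = eLpNorm H p (sampleMeasure l (μ.map (X 0))) :=
  eLpNorm_comp_measurePreserving hH.aestronglyMeasurable
    (hX.measurePreserving (sampleIndex_injective l))

theorem lpBound_lossAt (hX : IsIIDWithCopies μ X X' Xt) (hL : Measurable (Function.uncurry L))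
    (hf : ∀ l, Measurable (f l)) (hs : lossNorm μ X Xt L f b ≤ ENNReal.ofReal s) (j : Fin K) :
    LpBound 4 (sampleMeasure (trainSize b j) (μ.map (X 0))) (lossAt L (f _)) s :=
  lpBound_of_sampleIndex hX (measurable_lossAt hL (hf _))
    (le_trans (le_iSup₂ (f := fun l (_ : l ∈ trainSizes b) =>
      eLpNorm (estimatorLoss X Xt L f l) 4 μ) _ (trainSize_mem b j)) hs)

theorem eLpNorm_beta₁_le (hX : IsIIDWithCopies μ X X' Xt) (hL : Measurable (Function.uncurry L))
    {l : ℕ} (hf : Measurable (f l)) (hs0 : 0 ≤ s)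
    (h : LpBound 4 (sampleMeasure l (μ.map (X 0))) (lossAt L (f l)) s) :
    eLpNorm (beta₁ X X' Xt L f l) 4 μ ≤ ENNReal.ofReal (2 * s) := by
  have := hX.isProbabilityMeasure
  rcases Nat.eq_zero_or_pos l with rfl | hl
  · have : beta₁ X X' Xt L f 0 = 0 := by
      funext ω
      simp [beta₁, nabla, Subsingleton.elim (initial 0 (Function.update _ _ _))
        (initial 0 fun i => X i ω)]
    simp [this]
  · rw [show beta₁ X X' Xt L f l = _ from funext fun ω => beta₁_eq hl ω,
      eLpNorm_sampleIndex hX (measurable_firstDiff hL hf _)]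
    exact (lpBound_firstDiff (by norm_num) hs0 h _).le

theorem eLpNorm_beta₂_le (hX : IsIIDWithCopies μ X X' Xt) (hL : Measurable (Function.uncurry L))
    {l : ℕ} (hf : Measurable (f l)) (hs0 : 0 ≤ s)
    (h : LpBound 4 (sampleMeasure l (μ.map (X 0))) (lossAt L (f l)) s) :
    eLpNorm (beta₂ X X' Xt L f l) 4 μ ≤ ENNReal.ofReal (2 * s + 2 * s) := by
  have := hX.isProbabilityMeasure
  rcases lt_or_ge 1 l with hl | hl
  · rw [show beta₂ X X' Xt L f l = _ from funext fun ω => beta₂_eq hl ω,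
      eLpNorm_sampleIndex hX (measurable_secondDiff hL hf _ _)]
    exact (lpBound_secondDiff (by norm_num) hs0 h (by simp)).le
  · have : beta₂ X X' Xt L f l = 0 := by
      funext ω
      have e1 := initial_update_of_le hl (fun i => X i ω) (X' 1 ω)
      have e2 : initial l (Function.update (Function.update (fun i => X i ω) 1 (X' 1 ω)) 0 (X' 0 ω))
          = initial l (Function.update (fun i => X i ω) 0 (X' 0 ω)) := by
        rw [Function.update_comm (by norm_num)]
        exact initial_update_of_le hl _ _
      simp [beta₂, nabla₂, nabla, e1, e2]
    simp [this]

/-- The stability coefficients, as real numbers, bound the norms of the differences. The bound `B`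
excludes an infinite supremum, whose real value would be the junk value `0`. -/
theorem le_ofReal_div_of_mul_iSup {A : Finset ℕ} {g : ℕ → ℝ≥0∞} {c : ℝ} (hc : 0 < c) {B : ℝ≥0∞}
    (hB : B ≠ ∞) (hg : ∀ l ∈ A, g l ≤ B) {l : ℕ} (hl : l ∈ A) :
    g l ≤ ENNReal.ofReal ((ENNReal.ofReal c * ⨆ l ∈ A, g l).toReal / c) := by
  have hlt : (⨆ l ∈ A, g l) ≠ ∞ := ne_top_of_le_ne_top hB (iSup₂_le hg)
  rw [ENNReal.toReal_mul, ENNReal.toReal_ofReal hc.le, mul_div_cancel_left₀ _ hc.ne',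
    ENNReal.ofReal_toReal hlt]
  exact le_iSup₂ (f := fun l (_ : l ∈ A) => g l) l hl

theorem lpBound_firstDiff_epsDelta (hX : IsIIDWithCopies μ X X' Xt)
    (hL : Measurable (Function.uncurry L)) (hf : ∀ l, Measurable (f l)) (hn : 0 < n) (hs0 : 0 ≤ s)
    (hs : lossNorm μ X Xt L f b ≤ ENNReal.ofReal s) (j : Fin K) (hl : 0 < trainSize b j) :
    LpBound 4 (sampleMeasure (trainSize b j) (μ.map (X 0))) (firstDiff L (f _) ⟨0, hl⟩)
      ((epsDelta μ X X' Xt L f b).toReal / √(n : ℝ)) := by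
  refine lpBound_of_sampleIndex hX (measurable_firstDiff hL (hf _) _) ?_
  rw [← show beta₁ X X' Xt L f _ = _ from funext fun ω => beta₁_eq hl ω]
  refine le_ofReal_div_of_mul_iSup (g := fun l => eLpNorm (beta₁ X X' Xt L f l) 4 μ)
    (Real.sqrt_pos.2 (by exact_mod_cast hn)) (B := ENNReal.ofReal (2 * s)) ENNReal.ofReal_ne_top
    (fun l hl => ?_) (trainSize_mem b j)
  obtain ⟨i, -, rfl⟩ := Finset.mem_image.1 hl
  exact eLpNorm_beta₁_le hX hL (hf _) hs0 (lpBound_lossAt hX hL hf hs i)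

theorem lpBound_secondDiff_epsNabla (hX : IsIIDWithCopies μ X X' Xt)
    (hL : Measurable (Function.uncurry L)) (hf : ∀ l, Measurable (f l)) (hn : 0 < n) (hs0 : 0 ≤ s)
    (hs : lossNorm μ X Xt L f b ≤ ENNReal.ofReal s) (j : Fin K) (hl : 1 < trainSize b j) :
    LpBound 4 (sampleMeasure (trainSize b j) (μ.map (X 0)))
      (secondDiff L (f _) ⟨0, by omega⟩ ⟨1, hl⟩)
      ((epsNabla μ X X' Xt L f b).toReal / n) := by
  refine lpBound_of_sampleIndex hX (measurable_secondDiff hL (hf _) _ _) ?_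
  rw [← show beta₂ X X' Xt L f _ = _ from funext fun ω => beta₂_eq hl ω, epsNabla,
    ← ENNReal.ofReal_natCast]
  refine le_ofReal_div_of_mul_iSup (g := fun l => eLpNorm (beta₂ X X' Xt L f l) 4 μ)
    (by exact_mod_cast hn) (B := ENNReal.ofReal (2 * s + 2 * s)) ENNReal.ofReal_ne_top
    (fun l hl => ?_) (trainSize_mem b j)
  obtain ⟨i, -, rfl⟩ := Finset.mem_image.1 hl
  exact eLpNorm_beta₂_le hX hL (hf _) hs0 (lpBound_lossAt hX hL hf hs i)

/-- The crude bound on the variances that makes the limiting standard deviation at most `2 S`. -/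
theorem sigmaSq_le (hX : IsIIDWithCopies μ X X' Xt) (hL : Measurable (Function.uncurry L))
    {l : ℕ} (hf : Measurable (f l)) (hs0 : 0 ≤ s)
    (h : LpBound 4 (sampleMeasure l (μ.map (X 0))) (lossAt L (f l)) s) :
    sigmaSq μ X Xt L f l ≤ (2 * s) ^ 2 := by
  have := hX.isProbabilityMeasure
  have h2 := h.mono_exponent (q := 2) (by norm_num)
  rw [sigmaSq_eq hX hL hf (h.mono_exponent (q := 1) (by norm_num)).integrable]
  simp only [← condMean_lossAt]
  refine LpBound.integral_sq_le ?_ (by positivity)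
  rw [two_mul]
  exact h2.sub (LpBound.condMean _ (by norm_num) (by norm_num) _ (measurable_lossAt hL hf) h2)
    (by norm_num) hs0 hs0

end Stability

section CrossValidation

variable {Ω 𝒳 𝒴 : Type*} [MeasurableSpace Ω] [MeasurableSpace 𝒳] [MeasurableSpace 𝒴]
  {μ : Measure Ω} {X X' : ℕ → Ω → 𝒳} {Xt : Ω → 𝒳} {L : 𝒳 → 𝒴 → ℝ}
  {f : ∀ l : ℕ, (Fin l → 𝒳) → 𝒴} {n K : ℕ} {b : Fin n → Fin K} {s : ℝ}

/-- The normalized error of cross-validation is a normalized sum of centered losses, where the loss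
of the `k`-th observation is centered in this observation. -/
theorem sqrt_mul_cvRisk_sub_eq (hX : IsIIDWithCopies μ X X' Xt)
    (hL : Measurable (Function.uncurry L)) (hn : 0 < n) (ω : Ω) :
    √(n : ℝ) * (cvRisk L f b (fun i => X i ω)
        - weightedAverageRisk (risk μ Xt L) f b (fun i => X i ω))
      = (√(n : ℝ))⁻¹ * ∑ k, centering (μ.map (X 0)) k (foldLoss L f b k)
        ((fun k => allObservations X X' Xt (pathIndex n k) ω) ∘ Sum.inl) := by
  have hn' : (0 : ℝ) < n := by exact_mod_cast hn
  have hsq : √(n : ℝ) * (1 / n) = (√(n : ℝ))⁻¹ := by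
    rw [mul_one_div, Real.sqrt_div_self', one_div]
  rw [weightedAverageRisk_eq, cvRisk, ← mul_sub, ← Finset.sum_sub_distrib, ← mul_assoc, hsq]
  congr 1
  refine Finset.sum_congr rfl fun k _ => ?_
  rw [centering_foldLoss, hX.risk_eq hL]
  rfl

variable [IsProbabilityMeasure μ]

theorem integral_centering_foldLoss_sq (hX : IsIIDWithCopies μ X X' Xt)
    (hL : Measurable (Function.uncurry L)) (hf : ∀ l, Measurable (f l)) (k : Fin n)
    (h : LpBound 4 (sampleMeasure (trainSize b (b k)) (μ.map (X 0))) (lossAt L (f _)) s) :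
    ∫ t, centering (μ.map (X 0)) k (foldLoss L f b k) (t ∘ Sum.inl) ^ 2
        ∂pathMeasure (Fin n) (μ.map (X 0)) = sigmaSq μ X Xt L f (trainSize b (b k)) := by
  have := hX.isProbabilityMeasure
  rw [sigmaSq_eq hX hL (hf _) (h.mono_exponent (q := 1) (by norm_num)).integrable,
    ← integral_comp_mp (measurePreserving_comp_injective (μ.map (X 0))
      (foldIndex_injective (trainEmb_injective b (b k)) (trainEmb_ne b k)))]
  · simp only [centering_foldLoss_comp_inl]
  · have hgm : Measurable fun r : Fin (trainSize b (b k)) ⊕ Fin (trainSize b (b k)) ⊕ Unit → 𝒳 =>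
        f _ (r ∘ Sum.inl) :=
      (hf _).comp (measurable_pi_lambda _ fun m => measurable_pi_apply (Sum.inl m))
    exact (((measurable_lossAt hL (hf _)).sub
      ((measurable_risk _ hL).comp hgm)).pow_const 2).aestronglyMeasurable

theorem integrable_cvError (hX : IsIIDWithCopies μ X X' Xt)
    (hL : Measurable (Function.uncurry L)) (hf : ∀ l, Measurable (f l))
    (hsymm : ∀ (l : ℕ) (π : Equiv.Perm (Fin l)) (x : Fin l → 𝒳), f l (x ∘ π) = f l x)
    (hn : 0 < n) (hs0 : 0 ≤ s) (hs : lossNorm μ X Xt L f b ≤ ENNReal.ofReal s) :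
    Integrable (fun ω => √(n : ℝ) * (cvRisk L f b (fun i => X i ω)
      - weightedAverageRisk (risk μ Xt L) f b (fun i => X i ω))) μ := by
  have := hX.isProbabilityMeasure
  simp only [sqrt_mul_cvRisk_sub_eq hX hL hn]
  refine (integrable_finsetSum _ fun k _ => ?_).const_mul _
  have h := lpBound_centering (k := k) (by norm_num) (by norm_num) hs0 (measurable_foldLoss hL hf k)
    (lpBound_foldLoss hsymm k (lpBound_lossAt hX hL hf hs (b k)))
  exact (hX.measurePreserving (pathIndex_injective n)).integrable_comp_of_integrable
    (h.mono_exponent (q := 1) (by norm_num)).integrable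

/-- The comparison of the normalized error of cross-validation with a normal variable. -/
theorem abs_integral_cvError_sub_le (hX : IsIIDWithCopies μ X X' Xt)
    (hL : Measurable (Function.uncurry L)) (hf : ∀ l, Measurable (f l))
    (hsymm : ∀ (l : ℕ) (π : Equiv.Perm (Fin l)) (x : Fin l → 𝒳), f l (x ∘ π) = f l x)
    (hn : 0 < n) (hs0 : 0 ≤ s) (hs : lossNorm μ X Xt L f b ≤ ENNReal.ofReal s)
    {h : ℝ → ℝ} (hh : LipschitzWith 1 h) {σ : ℝ≥0} (hσ : 0 < σ) :
    |(∫ ω, h (√(n : ℝ) * (cvRisk L f b (fun i => X i ω)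
          - weightedAverageRisk (risk μ Xt L) f b (fun i => X i ω))) ∂μ)
        - ∫ y, h y ∂gaussianReal 0 (σ ^ 2)|
      ≤ 1 / σ * (16 * s ^ 2 / √(n : ℝ) + 12 * (s * (epsDelta μ X X' Xt L f b).toReal)
          + 4 * (s * (epsNabla μ X X' Xt L f b).toReal)
          + sigmaGap μ X Xt L f b ((σ : ℝ) ^ 2)) + 64 * s ^ 3 / (σ ^ 2 * √(n : ℝ)) := by
  have := hX.isProbabilityMeasure
  have hn' : (0 : ℝ) < n := by exact_mod_cast hn
  have hb := lpBound_lossAt hX hL hf hs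
  have key := abs_integral_lipschitz_sub_le (ν := μ.map (X 0)) (u := foldLoss L f b)
    (measurable_foldLoss hL hf) hs0
    (d := (epsDelta μ X X' Xt L f b).toReal) (e := (epsNabla μ X X' Xt L f b).toReal)
    ENNReal.toReal_nonneg ENNReal.toReal_nonneg (by simpa using hn)
    (fun k => lpBound_foldLoss hsymm k (hb (b k)))
    (fun i k hik => lpBound_foldLoss_diff hsymm hik fun hl => by
      simpa using lpBound_firstDiff_epsDelta hX hL hf hn hs0 hs (b k) hl)
    (fun i j k hik hjk hij => lpBound_foldLoss_diff₂ hsymm hik hjk hij fun hl => by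
      simpa using lpBound_secondDiff_epsNabla hX hL hf hn hs0 hs (b k) hl) hh hσ
  simp only [Fintype.card_fin] at key
  have hmp := hX.measurePreserving (pathIndex_injective n)
  simp only [sqrt_mul_cvRisk_sub_eq hX hL hn]
  have hmeas : AEStronglyMeasurable (fun t : Fin n ⊕ Fin n → 𝒳 =>
      h ((√(n : ℝ))⁻¹ * ∑ k, centering (μ.map (X 0)) k (foldLoss L f b k) (t ∘ Sum.inl)))
      (pathMeasure (Fin n) (μ.map (X 0))) := by
    refine hh.continuous.comp_aestronglyMeasurable
      ((Finset.aestronglyMeasurable_fun_sum _ fun k _ => ?_).const_mul _)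
    exact (lpBound_centering (by norm_num) (by norm_num) hs0 (measurable_foldLoss hL hf k)
      (lpBound_foldLoss hsymm k (hb (b k)))).aesm
  rw [← integral_comp_mp hmp hmeas] at key
  refine key.trans ?_
  have hgap : |(n : ℝ)⁻¹ * ∑ k, (∫ t, centering (μ.map (X 0)) k (foldLoss L f b k)
      (t ∘ Sum.inl) ^ 2 ∂pathMeasure (Fin n) (μ.map (X 0))) - (σ : ℝ) ^ 2|
      ≤ sigmaGap μ X Xt L f b ((σ : ℝ) ^ 2) := by
    have e1 : (n : ℝ)⁻¹ * ∑ k, (∫ t, centering (μ.map (X 0)) k (foldLoss L f b k)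
        (t ∘ Sum.inl) ^ 2 ∂pathMeasure (Fin n) (μ.map (X 0))) - (σ : ℝ) ^ 2
        = (n : ℝ)⁻¹ * ∑ k, (sigmaSq μ X Xt L f (trainSize b (b k)) - (σ : ℝ) ^ 2) := by
      rw [Finset.sum_sub_distrib, mul_sub]
      simp only [integral_centering_foldLoss_sq hX hL hf _ (hb _), Finset.sum_const,
        Finset.card_univ, Fintype.card_fin, nsmul_eq_mul]
      rw [inv_mul_cancel_left₀ hn'.ne']
    rw [e1, abs_mul, abs_of_pos (inv_pos.2 hn'), inv_mul_le_iff₀ hn']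
    refine (Finset.abs_sum_le_sum_abs _ _).trans
      ((Finset.sum_le_card_nsmul _ _ _ fun k _ => abs_sigmaSq_sub_le_sigmaGap _ (b k)).trans ?_)
    simp
  gcongr

/-- The risks of the trained estimators have first moments bounded by those of the losses. -/
theorem lpBound_risk_foldEstimator (hX : IsIIDWithCopies μ X X' Xt)
    (hL : Measurable (Function.uncurry L)) (hf : ∀ l, Measurable (f l))
    (hs : lossNorm μ X Xt L f b ≤ ENNReal.ofReal s) (j : Fin K) :
    LpBound 1 μ (fun ω => risk μ Xt L (foldEstimator f b j fun i => X i ω)) s := by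
  have := hX.isProbabilityMeasure
  have he : Function.Injective (Sum.map (fun m => (trainEmb b j m : ℕ))
      (Sum.map (fun m => (trainEmb b j m : ℕ)) id) :
      Fin (trainSize b j) ⊕ Fin (trainSize b j) ⊕ Unit → ℕ ⊕ ℕ ⊕ Unit) :=
    have h := Fin.val_injective.comp (trainEmb_injective b j)
    h.sumMap (h.sumMap Function.injective_id)
  have h1 := (lpBound_lossAt hX hL hf hs j).mono_exponent (q := 1) (by norm_num)
  have h2 := (LpBound.condMean _ le_rfl (by norm_num) (Sum.inr (Sum.inr ()))
    (measurable_lossAt hL (hf _)) h1).comp (hX.measurePreserving he)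
  refine h2.congr (ae_of_all _ fun ω => ?_)
  simp only [condMean_lossAt, hX.risk_eq hL]
  rfl

theorem integrable_averageError (hX : IsIIDWithCopies μ X X' Xt)
    (hL : Measurable (Function.uncurry L)) (hf : ∀ l, Measurable (f l))
    (hs : lossNorm μ X Xt L f b ≤ ENNReal.ofReal s) :
    Integrable (fun ω => √(n : ℝ) * (weightedAverageRisk (risk μ Xt L) f b (fun i => X i ω)
      - averageRisk (risk μ Xt L) f b (fun i => X i ω))) μ := by
  have h := fun j => (lpBound_risk_foldEstimator hX hL hf hs j).integrable
  refine Integrable.const_mul (Integrable.sub ?_ ?_) _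
  · exact (integrable_finsetSum _ fun j _ => (h j).const_mul _).const_mul _
  · exact (integrable_finsetSum _ fun j _ => h j).const_mul _

theorem integral_abs_averageError_le (hX : IsIIDWithCopies μ X X' Xt)
    (hL : Measurable (Function.uncurry L)) (hf : ∀ l, Measurable (f l)) (hs0 : 0 ≤ s)
    (hs : lossNorm μ X Xt L f b ≤ ENNReal.ofReal s) :
    ∫ ω, |√(n : ℝ) * (weightedAverageRisk (risk μ Xt L) f b (fun i => X i ω)
      - averageRisk (risk μ Xt L) f b (fun i => X i ω))| ∂μ ≤ √(n : ℝ) * s * imbalance b := by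
  have h := lpBound_risk_foldEstimator hX hL hf hs
  have hi : ∀ j ∈ (Finset.univ : Finset (Fin K)),
      Integrable (fun ω => |((fold b j).card : ℝ) / n - 1 / K| *
        |risk μ Xt L (foldEstimator f b j fun i => X i ω)|) μ :=
    fun j _ => (h j).integrable.abs.const_mul _
  calc ∫ ω, |√(n : ℝ) * (weightedAverageRisk (risk μ Xt L) f b (fun i => X i ω)
      - averageRisk (risk μ Xt L) f b (fun i => X i ω))| ∂μ
    _ ≤ ∫ ω, √(n : ℝ) * ∑ j : Fin K, |((fold b j).card : ℝ) / n - 1 / K| *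
        |risk μ Xt L (foldEstimator f b j fun i => X i ω)| ∂μ := by
        refine integral_mono (integrable_averageError hX hL hf hs).abs
          ((integrable_finsetSum _ hi).const_mul _) fun ω => ?_
        simp only [abs_mul, abs_of_nonneg (Real.sqrt_nonneg _)]
        exact mul_le_mul_of_nonneg_left (abs_weightedAverageRisk_sub_averageRisk_le _ _)
          (Real.sqrt_nonneg _)
    _ = √(n : ℝ) * ∑ j : Fin K, |((fold b j).card : ℝ) / n - 1 / K| *
        ∫ ω, |risk μ Xt L (foldEstimator f b j fun i => X i ω)| ∂μ := by
        rw [integral_const_mul, integral_finsetSum _ hi]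
        simp only [integral_const_mul]
    _ ≤ √(n : ℝ) * ∑ j : Fin K, |((fold b j).card : ℝ) / n - 1 / K| * s := by
        gcongr with j
        exact (h j).integral_abs_le hs0
    _ = √(n : ℝ) * s * imbalance b := by
        rw [imbalance, ← Finset.sum_mul]; ring

/-- The Wasserstein distance of the law of an integrable variable to a normal law, in terms of an
approximation `W` of that variable. -/
theorem wassersteinOne_map_add_le {W A : Ω → ℝ} (hW : Integrable W μ) (hA : Integrable A μ)
    {v : ℝ≥0} {B a : ℝ} (ha : ∫ ω, |A ω| ∂μ ≤ a)
    (hB : ∀ h : ℝ → ℝ, LipschitzWith 1 h →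
      |(∫ ω, h (W ω) ∂μ) - ∫ y, h y ∂gaussianReal 0 v| ≤ B) :
    wassersteinOne (μ.map fun ω => W ω + A ω) (gaussianReal 0 v) ≤ ENNReal.ofReal (B + a) := by
  have hWA : Integrable (fun ω => W ω + A ω) μ := hW.add hA
  have hid : Integrable (fun x : ℝ => x) (μ.map fun ω => W ω + A ω) :=
    (integrable_map_measure aestronglyMeasurable_id hWA.aemeasurable).2 hWA
  have lip : ∀ {V : Ω → ℝ} {h : ℝ → ℝ}, Integrable V μ → LipschitzWith 1 h →
      Integrable (fun ω => h (V ω)) μ := fun {V h} hV hh => by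
    have := Measure.isProbabilityMeasure_map hV.aemeasurable
    exact (integrable_map_measure hh.continuous.aestronglyMeasurable hV.aemeasurable).1
      (integrable_lipschitz ((integrable_map_measure aestronglyMeasurable_id hV.aemeasurable).2 hV)
        hh)
  refine wassersteinOne_le hid (integrable_id_gaussianReal 0 v) fun h hh => ?_
  rw [integral_map hWA.aemeasurable hh.continuous.aestronglyMeasurable]
  have h1 : |(∫ ω, h (W ω + A ω) ∂μ) - ∫ ω, h (W ω) ∂μ| ≤ a := by
    rw [← integral_sub (lip hWA hh) (lip hW hh)]
    refine (abs_integral_le_integral_abs.trans ?_).trans ha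
    refine integral_mono ((lip hWA hh).sub (lip hW hh)).abs hA.abs fun ω => ?_
    have := hh.dist_le_mul (W ω + A ω) (W ω)
    simpa [Real.dist_eq] using this
  rw [add_comm B a]
  exact (abs_sub_le _ (∫ ω, h (W ω) ∂μ) _).trans (add_le_add h1 (hB h hh))

/-- Since `σ ≤ 2 s`, the term `s ^ 2 / (σ √n)` is of the order of `s ^ 3 / (σ ^ 2 √n)`. -/
theorem le_rate {σ : ℝ} {n : ℕ} {s d e g : ℝ} (hσ : 0 < σ) (hn : 0 < n) (hs : 0 ≤ s) (hd : 0 ≤ d)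
    (he : 0 ≤ e) (hσs : σ ≤ 2 * s) :
    1 / σ * (16 * s ^ 2 / √(n : ℝ) + 12 * (s * d) + 4 * (s * e) + g)
      + 64 * s ^ 3 / (σ ^ 2 * √(n : ℝ)) ≤ rate 100 σ n s d e g := by
  have hr : 0 < √(n : ℝ) := Real.sqrt_pos.2 (by exact_mod_cast hn)
  have h1 : s ^ 2 / (σ * √(n : ℝ)) ≤ 2 * s ^ 3 / (σ ^ 2 * √(n : ℝ)) := by
    rw [div_le_div_iff₀ (by positivity) (by positivity)]
    have : 0 ≤ (2 * s - σ) * (s ^ 2 * σ * √(n : ℝ)) :=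
      mul_nonneg (by linarith) (by positivity)
    linarith
  have h2 : rate 100 σ n s d e g - (1 / σ * (16 * s ^ 2 / √(n : ℝ) + 12 * (s * d) + 4 * (s * e) + g)
      + 64 * s ^ 3 / (σ ^ 2 * √(n : ℝ)))
      = 88 * (s * d / σ) + 96 * (s * e / σ)
        + 100 * ((d ^ 2 * (e + s) + s * e ^ 2) / (σ ^ 2 * √(n : ℝ)))
        + 4 * (s ^ 3 / (σ ^ 2 * √(n : ℝ)))
        + 16 * (2 * s ^ 3 / (σ ^ 2 * √(n : ℝ)) - s ^ 2 / (σ * √(n : ℝ))) := by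
    rw [rate]; field_simp; ring
  have : 0 ≤ 88 * (s * d / σ) + 96 * (s * e / σ)
        + 100 * ((d ^ 2 * (e + s) + s * e ^ 2) / (σ ^ 2 * √(n : ℝ)))
        + 4 * (s ^ 3 / (σ ^ 2 * √(n : ℝ))) := by positivity
  linarith

end CrossValidation

end CrossVal

end

theorem theorem2 :
    ∃ C : ℝ, 0 < C ∧
    ∀ (Ω 𝒳 𝒴 : ℕ → Type*)
      [∀ n, MeasurableSpace (Ω n)] [∀ n, MeasurableSpace (𝒳 n)] [∀ n, MeasurableSpace (𝒴 n)]
      (μ : ∀ n, Measure (Ω n)) [∀ n, IsProbabilityMeasure (μ n)]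
      (X X' : ∀ n, ℕ → Ω n → 𝒳 n) (Xt : ∀ n, Ω n → 𝒳 n)
      (L : ∀ n, 𝒳 n → 𝒴 n → ℝ)
      (f : ∀ n l : ℕ, (Fin l → 𝒳 n) → 𝒴 n)
      (K : ℕ → ℕ) (b : ∀ n, Fin n → Fin (K n))
      (S : ℝ≥0∞) (σ₁ : ℝ≥0),
      -- a triangular array of i.i.d. observations, with independent copies
      (∀ n, CrossVal.IsIIDWithCopies (μ n) (X n) (X' n) (Xt n)) →
      (∀ n, Measurable (Function.uncurry (L n))) →
      (∀ n l, Measurable (f n l)) →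
      -- the folds
      Monotone K →
      (∀ n, CrossVal.Balanced (b n)) →
      -- symmetry of the estimators
      (∀ (n l : ℕ) (π : Equiv.Perm (Fin l)) (x : Fin l → 𝒳 n), f n l (x ∘ π) = f n l x) →
      -- fourth moments
      (S = ⨆ (n : ℕ) (_ : 1 ≤ n), CrossVal.lossNorm (μ n) (X n) (Xt n) (L n) (f n) (b n)) →
      S < ∞ →
      -- first-order and second-order stability
      Tendsto (fun n => CrossVal.epsDelta (μ n) (X n) (X' n) (Xt n) (L n) (f n) (b n))
        atTop (𝓝 0) →
      Tendsto (fun n => CrossVal.epsNabla (μ n) (X n) (X' n) (Xt n) (L n) (f n) (b n))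
        atTop (𝓝 0) →
      -- convergence of the variances
      0 < σ₁ →
      Tendsto (fun n => CrossVal.sigmaGap (μ n) (X n) (Xt n) (L n) (f n) (b n) ((σ₁ : ℝ) ^ 2))
        atTop (𝓝 0) →
      ∀ n : ℕ, 1 ≤ n →
        CrossVal.wassersteinOne
          ((μ n).map (fun ω => √(n : ℝ) *
            (CrossVal.cvRisk (L n) (f n) (b n) (fun i => X n i ω)
              - CrossVal.averageRisk (CrossVal.risk (μ n) (Xt n) (L n)) (f n) (b n)
                  (fun i => X n i ω))))
          (gaussianReal 0 (σ₁ ^ 2))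
        ≤ ENNReal.ofReal
            (CrossVal.rate C σ₁ n S.toReal
              (CrossVal.epsDelta (μ n) (X n) (X' n) (Xt n) (L n) (f n) (b n)).toReal
              (CrossVal.epsNabla (μ n) (X n) (X' n) (Xt n) (L n) (f n) (b n)).toReal
              (CrossVal.sigmaGap (μ n) (X n) (Xt n) (L n) (f n) (b n) ((σ₁ : ℝ) ^ 2))
              + √(n : ℝ) * S.toReal * CrossVal.imbalance (b n))
        ∧
        CrossVal.wassersteinOne
          ((μ n).map (fun ω => √(n : ℝ) *
            (CrossVal.cvRisk (L n) (f n) (b n) (fun i => X n i ω)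
              - CrossVal.weightedAverageRisk (CrossVal.risk (μ n) (Xt n) (L n)) (f n) (b n)
                  (fun i => X n i ω))))
          (gaussianReal 0 (σ₁ ^ 2))
        ≤ ENNReal.ofReal
            (CrossVal.rate C σ₁ n S.toReal
              (CrossVal.epsDelta (μ n) (X n) (X' n) (Xt n) (L n) (f n) (b n)).toReal
              (CrossVal.epsNabla (μ n) (X n) (X' n) (Xt n) (L n) (f n) (b n)).toReal
              (CrossVal.sigmaGap (μ n) (X n) (Xt n) (L n) (f n) (b n) ((σ₁ : ℝ) ^ 2))) := by
  refine ⟨100, by norm_num, ?_⟩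
  intro Ω 𝒳 𝒴 _ _ _ μ _ X X' Xt L f K b S σ₁ hX hL hf _ _ hsymm hS hStop _ _ hσ hgap n hn
  have hs0 : 0 ≤ S.toReal := ENNReal.toReal_nonneg
  have hσ' : (0 : ℝ) < σ₁ := hσ
  have hs : ∀ m, 1 ≤ m → CrossVal.lossNorm (μ m) (X m) (Xt m) (L m) (f m) (b m)
      ≤ ENNReal.ofReal S.toReal := fun m hm => by
    rw [ENNReal.ofReal_toReal hStop.ne, hS]
    exact le_iSup₂ (f := fun (n : ℕ) (_ : 1 ≤ n) =>
      CrossVal.lossNorm (μ n) (X n) (Xt n) (L n) (f n) (b n)) m hm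
  -- The limiting variance inherits the bound `(2 S)²` of the variances `σ²_l`.
  have hσS : (σ₁ : ℝ) ≤ 2 * S.toReal := by
    refine le_of_sq_le_sq ?_ (by positivity)
    have hlim := hgap.add_const ((2 * S.toReal) ^ 2)
    rw [zero_add] at hlim
    refine ge_of_tendsto hlim ?_
    filter_upwards [eventually_ge_atTop 1] with m hm
    have h1 := CrossVal.abs_sigmaSq_sub_le_sigmaGap (μ := μ m) (X := X m) (Xt := Xt m) (L := L m)
      (f := f m) (b := b m) ((σ₁ : ℝ) ^ 2) (b m ⟨0, hm⟩)
    have h2 := CrossVal.sigmaSq_le (hX m) (hL m) (hf m _) hs0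
      (CrossVal.lpBound_lossAt (hX m) (hL m) (hf m) (hs m hm) (b m ⟨0, hm⟩))
    have h3 := neg_abs_le (CrossVal.sigmaSq (μ m) (X m) (Xt m) (L m) (f m)
      (CrossVal.trainSize (b m) (b m ⟨0, hm⟩)) - (σ₁ : ℝ) ^ 2)
    linarith
  have hB := fun (h : ℝ → ℝ) (hh : LipschitzWith 1 h) =>
    (CrossVal.abs_integral_cvError_sub_le (hX n) (hL n) (hf n) (hsymm n) hn hs0 (hs n hn) hh
      hσ).trans (CrossVal.le_rate hσ' hn hs0 ENNReal.toReal_nonneg ENNReal.toReal_nonneg hσS)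
  have hW := CrossVal.integrable_cvError (hX n) (hL n) (hf n) (hsymm n) hn hs0 (hs n hn)
  constructor
  · have := CrossVal.wassersteinOne_map_add_le hW
      (CrossVal.integrable_averageError (hX n) (hL n) (hf n) (hs n hn))
      (CrossVal.integral_abs_averageError_le (hX n) (hL n) (hf n) hs0 (hs n hn)) hB
    simpa only [← mul_add, sub_add_sub_cancel] using this
  · simpa using CrossVal.wassersteinOne_map_add_le hW (integrable_zero _ _ _) (a := 0) (by simp) hB
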